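/- **Setting.** Let $\mathbb G$ be a graded Lie group, realised on $\mathbb R^n$ in homogeneous (e.g. exponential) coordinates, so that the dilations $D_r(x)=(r^{\nu_1}x_1,\dots,r^{\nu_n}x_n)$, with positive integers $\nu_j$, are automorphisms; let $Q=\nu_1+\dots+\nu_n$ and let $X_j$ be the left-invariant vector field equal to $\partial_j$ at the unit. Let $\mathcal R=\sum_{[\alpha]=\nu}c_\alpha X^\alpha$ (where $[\alpha]=\sum_j\nu_j\alpha_j$) be a positive Rockland operator of homogeneous degree $\nu>0$: $\langle\mathcal R\varphi,\varphi\rangle_{L^2}\ge 0$ for all $\varphi\in C_c^\infty(\mathbb G)$, and $\pi(\mathcal R)$ is injective on the smooth vectors of every non-trivial irreducible unitary representation $\pi$ of $\mathbb G$. We also write $\mathcal R$ for its self-adjoint (Friedrichs) extension on $L^2(\mathbb G)$. The space $H^{\nu/2}(\mathbb G)\subset L^2(\mathbb G)$ is the completion of $C_c^\infty(\mathbb G)$ for the norm $\|f\|_{H^{\nu/2}}=\|\mathcal R^{1/2}f\|_{L^2}+\|f\|_{L^2}$, where $\|\mathcal R^{1/2}\varphi\|_{L^2}^2=\langle \mathcal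 R\varphi,\varphi\rangle$ for $\varphi\in C_c^\infty(\mathbb G)$. A *scale* is a bounded function $\omega:(0,1]\to(0,\infty)$ with $\omega(\epsilon)\to0$ as $\epsilon\to0$. A *regularisation* of a distribution $v$ is a net $v_\epsilon=v*\psi_\epsilon$, $\epsilon\in(0,1]$, where $\psi_\epsilon=\omega_0(\epsilon)^{-Q}\,\psi\circ D_{\omega_0(\epsilon)^{-1}}$ for some scale $\omega_0$ and some real $\psi\in C_c^\infty(\mathbb G)$ with $\int\psi=1$. Given a scale $\omega$, a net $(f_\epsilon)_{\epsilon\in(0,1]}$ in a normed space $X$ is *$X$-moderate* if $\|f_\epsilon\|_X\le C\,\omega(\epsilon)^{-N}$ for some $C$, some $N\in\mathbb N$ and all $\epsilon\in(0,1]$; a net $(u_\epsilon)$ in $C([0,T];X)$ is *$C([0,T];X)$-moderate* if $\sup_{t\in[0,T]}\|u_\epsilon(t)\|_X\le C\,\omega(\epsilon)^{-N}$ in the same sense. Let $T>0$, let $V$ be a real distribution and $u_0$ a complex distribution on $\mathbb G$. A *very weak solution* (with respect to $\omega$) of the Cauchy problem $$\partial_tu+\mathcal Ru+Vu=0,\qquad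 u(0)=u_0,$$ is a net $(u_\epsilon)_\epsilon$ for which there are * a net of real functions $V_\epsilon\in L^\infty(\mathbb G)$ that converges to $V$ in the sense of distributions as $\epsilon\to0$ and is $L^\infty$-moderate, * a regularisation $(u_{0,\epsilon})_\epsilon$ of $u_0$ that is $H^{\nu/2}(\mathbb G)$-moderate, such that each $u_\epsilon\in C([0,T];L^2(\mathbb G))$ solves $\partial_tu_\epsilon+\mathcal Ru_\epsilon+V_\epsilon u_\epsilon=0$, $u_\epsilon(0)=u_{0,\epsilon}$ (that is, for $0<t\le T$, $u_\epsilon(t)$ lies in the domain of $\mathcal R$, $u_\epsilon$ is differentiable at $t$ as an $L^2$-valued map, and the equation holds in $L^2$), and $(u_\epsilon)_\epsilon$ is $C([0,T];L^2(\mathbb G))$-moderate. **Statement.** Let $V\in L^\infty(\mathbb G)\cup\mathcal E'(\mathbb G)$ be real and let $u_0\in L^2(\mathbb G)\cup\mathcal E'(\mathbb G)$, where $\mathcal E'$ denotes the compactly supported distributions. Then, for every $T>0$ and every scale $\omega$, a very weak solution of the Cauchy problem exists, even with $(V_\epsilon)_\epsilon$ a regularisation of $V$; and every very weak solution $(u_\epsilon)_\epsilon$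 is also $C([0,T];H^{\nu/2}(\mathbb G))$-moderate: $u_\epsilon\in C([0,T];H^{\nu/2}(\mathbb G))$ for every $\epsilon\in(0,1]$, and there are $N\in\mathbb N$ and $C$ with $\sup_{t\in[0,T]}\|u_\epsilon(t)\|_{H^{\nu/2}}\le C\,\omega(\epsilon)^{-N}$ for all $\epsilon\in(0,1]$. -/

import Mathlib

open MeasureTheory Filter Topology Set
open scoped ENNReal ContDiff Distributions ComplexConjugate

noncomputable section

namespace VeryWeakHeat

/-- Smooth compactly supported functions on `ℝⁿ` with values in `F`. -/
abbrev Test (n : ℕ) (F : Type) [NormedAddCommGroup F] [NormedSpace ℝ F] : Type :=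
  𝓓((⊤ : TopologicalSpace.Opens (Fin n → ℝ)), F)

/-- Distributions on `ℝⁿ`, real (`F = ℝ`) or complex (`F = ℂ`). -/
abbrev Distr (n : ℕ) (F : Type) [NormedAddCommGroup F] [NormedSpace ℝ F] : Type :=
  𝓓'((⊤ : TopologicalSpace.Opens (Fin n → ℝ)), F)

abbrev L2 (n : ℕ) : Type := Lp ℂ 2 (volume : Measure (Fin n → ℝ))

abbrev Linfty (n : ℕ) : Type := Lp ℝ ∞ (volume : Measure (Fin n → ℝ))

/-- The dilation `D_r x = (r ^ w₁ x₁, …, r ^ wₙ xₙ)`. -/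
def dilation {n : ℕ} (w : Fin n → ℕ) (r : ℝ) (x : Fin n → ℝ) : Fin n → ℝ :=
  fun i => r ^ w i * x i

/-- A graded Lie group in homogeneous (for instance exponential) coordinates: a Lie group
structure on the manifold `ℝⁿ` with unit `0`, for which the dilations with positive integer
weights are automorphisms. The differential of `D_r` at `0` is `diag (r ^ wᵢ)`; its eigenspaces
`𝔤ₖ` (the span of the `∂ᵢ` with `wᵢ = k`) satisfy `[𝔤ₖ, 𝔤ₗ] ⊆ 𝔤ₖ₊ₗ`. In these coordinates Lebesgue
measure is the bi-invariant Haar measure. -/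
structure GradedLieGroup (n : ℕ) where
  mul : (Fin n → ℝ) → (Fin n → ℝ) → (Fin n → ℝ)
  inv : (Fin n → ℝ) → (Fin n → ℝ)
  weight : Fin n → ℕ
  mul_assoc : ∀ x y z, mul (mul x y) z = mul x (mul y z)
  zero_mul : ∀ x, mul 0 x = x
  mul_zero : ∀ x, mul x 0 = x
  inv_mul : ∀ x, mul (inv x) x = 0
  mul_inv : ∀ x, mul x (inv x) = 0
  contDiff_mul : ContDiff ℝ ∞ (fun p : (Fin n → ℝ) × (Fin n → ℝ) => mul p.1 p.2)
  contDiff_inv : ContDiff ℝ ∞ inv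
  weight_pos : ∀ i, 0 < weight i
  dilation_mul : ∀ r : ℝ, 0 < r → ∀ x y,
    dilation weight r (mul x y) = mul (dilation weight r x) (dilation weight r y)

namespace GradedLieGroup

variable {n : ℕ} (G : GradedLieGroup n)

/-- The homogeneous dimension `Q`. -/
def homDim : ℕ := ∑ i, G.weight i

/-- The homogeneous length `[α] = ∑ wⱼ αⱼ`. -/
def homLength (α : Fin n → ℕ) : ℕ := ∑ i, G.weight i * α i

/-! ### Left-invariant differential operators -/

/-- The left-invariant vector field `Xⱼ`, equal to `∂ⱼ` at the unit `0`. -/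
def vectorField (j : Fin n) (f : (Fin n → ℝ) → ℂ) : (Fin n → ℝ) → ℂ :=
  fun x => fderiv ℝ (fun y => f (G.mul x y)) 0 (Pi.single j 1)

/-- `X^α = X₁^α₁ ⋯ Xₙ^αₙ`. -/
def monomial (α : Fin n → ℕ) (f : (Fin n → ℝ) → ℂ) : (Fin n → ℝ) → ℂ :=
  (List.finRange n).foldr (fun j g => (G.vectorField j)^[α j] g) f

/-- The left-invariant differential operator `R = ∑ c_α X^α`. -/
def diffOp (c : (Fin n → ℕ) →₀ ℂ) (f : (Fin n → ℝ) → ℂ) : (Fin n → ℝ) → ℂ :=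
  fun x => c.sum fun α a => a * G.monomial α f x

/-! ### Unitary representations and the Rockland condition -/

section Representations

variable {H : Type} [NormedAddCommGroup H] [InnerProductSpace ℂ H]

/-- Irreducible strongly continuous unitary representations. -/
structure IsIrreducibleUnitaryRep (π : (Fin n → ℝ) → (H ≃ₗᵢ[ℂ] H)) : Prop where
  map_mul : ∀ x y, π (G.mul x y) = π x * π y
  continuous : ∀ v, Continuous fun x => π x v
  nontrivial : Nontrivial H
  irreducible : ∀ W : Submodule ℂ H, IsClosed (W : Set H) →
    (∀ x, ∀ v ∈ W, π x v ∈ W) → W = ⊥ ∨ W = ⊤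

/-- Smooth vectors of a representation. -/
def IsSmoothVector (π : (Fin n → ℝ) → (H ≃ₗᵢ[ℂ] H)) (v : H) : Prop :=
  ContDiff ℝ ∞ fun x => π x v

/-- The infinitesimal operator `π(Xⱼ)`, on smooth vectors. -/
def repVector (π : (Fin n → ℝ) → (H ≃ₗᵢ[ℂ] H)) (j : Fin n) (v : H) : H :=
  fderiv ℝ (fun y => π y v) 0 (Pi.single j 1)

/-- `π(X^α) = π(X₁)^α₁ ⋯ π(Xₙ)^αₙ`, on smooth vectors. -/
def repMonomial (π : (Fin n → ℝ) → (H ≃ₗᵢ[ℂ] H)) (α : Fin n → ℕ) (v : H) : H :=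
  (List.finRange n).foldr (fun j w => (repVector π j)^[α j] w) v

/-- `π(R) = ∑ c_α π(X^α)`, on smooth vectors. -/
def repOp (π : (Fin n → ℝ) → (H ≃ₗᵢ[ℂ] H)) (c : (Fin n → ℕ) →₀ ℂ) (v : H) : H :=
  c.sum fun α a => a • repMonomial π α v

end Representations

/-- `R = ∑ c_α X^α` is a positive Rockland operator of homogeneous degree `ν`. Every irreducible
unitary representation of the group is separable, so Hilbert spaces in `Type` suffice. -/
structure IsPositiveRockland (c : (Fin n → ℕ) →₀ ℂ) (ν : ℕ) : Prop where
  degree_pos : 0 < ν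
  homogeneous : ∀ α ∈ c.support, G.homLength α = ν
  rockland : ∀ (H : Type) [NormedAddCommGroup H] [InnerProductSpace ℂ H] [CompleteSpace H]
    (π : (Fin n → ℝ) → (H ≃ₗᵢ[ℂ] H)), G.IsIrreducibleUnitaryRep π → (∃ x, π x ≠ 1) →
    ∀ v, IsSmoothVector π v → repOp π c v = 0 → v = 0
  positive : ∀ φ : Test n ℂ, 0 ≤ (∫ x, G.diffOp c φ x * conj (φ x)).re ∧
    (∫ x, G.diffOp c φ x * conj (φ x)).im = 0

/-! ### The Sobolev space `H^{ν/2}` and the self-adjoint realisation of `R` -/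

/-- A test function as an element of `L²`. -/
def toL2 (φ : Test n ℂ) : L2 n :=
  (φ.continuous.memLp_of_hasCompactSupport φ.hasCompactSupport : MemLp φ 2 volume).toLp φ

/-- `⟨Rφ, φ⟩ = ‖R^{1/2} φ‖²` for a test function `φ`. -/
def energy (c : (Fin n → ℕ) →₀ ℂ) (φ : Test n ℂ) : ℝ :=
  (∫ x, G.diffOp c φ x * conj (φ x)).re

/-- `f ∈ L²` is the limit of test functions that are Cauchy for `‖R^{1/2} ·‖`, and `e` is the
limit of `‖R^{1/2} ·‖²` along them, that is `e = ‖R^{1/2} f‖²`. -/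
def IsEnergyLimit (c : (Fin n → ℕ) →₀ ℂ) (f : L2 n) (e : ℝ) : Prop :=
  ∃ φ : ℕ → Test n ℂ,
    Tendsto (fun k => toL2 (φ k)) atTop (𝓝 f) ∧
    Tendsto (fun p : ℕ × ℕ => G.energy c (φ p.1 - φ p.2)) atTop (𝓝 0) ∧
    Tendsto (fun k => G.energy c (φ k)) atTop (𝓝 e)

/-- Membership in `H^{ν/2}`, the completion (inside `L²`) of the test functions for the norm
`‖R^{1/2} f‖ + ‖f‖`. -/
def MemSobolev (c : (Fin n → ℕ) →₀ ℂ) (f : L2 n) : Prop :=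
  ∃ e, G.IsEnergyLimit c f e

/-- The homogeneous norm `‖R^{1/2} f‖` of `f ∈ H^{ν/2}`. The set is a singleton. -/
def homSobolevNorm (c : (Fin n → ℕ) →₀ ℂ) (f : L2 n) : ℝ :=
  √(sInf {e | G.IsEnergyLimit c f e})

/-- The norm of `H^{ν/2}`. -/
def sobolevNorm (c : (Fin n → ℕ) →₀ ℂ) (f : L2 n) : ℝ :=
  G.homSobolevNorm c f + ‖f‖

/-- `f` lies in the domain of the self-adjoint (Friedrichs) realisation of `R` on `L²`, and
`R f = g`: `f ∈ H^{ν/2}` and `R f = g` in the sense of distributions. -/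
def IsOpValue (c : (Fin n → ℕ) →₀ ℂ) (f g : L2 n) : Prop :=
  G.MemSobolev c f ∧
    ∀ φ : Test n ℂ, (∫ x, conj (G.diffOp c φ x) * f x) = ∫ x, conj (φ x) * g x

/-! ### Mollification -/

theorem dilation_continuous (w : Fin n → ℕ) (r : ℝ) : Continuous (dilation w r) := by
  unfold dilation
  fun_prop

theorem dilation_contDiff (w : Fin n → ℕ) (r : ℝ) : ContDiff ℝ ∞ (dilation w r) := by
  unfold dilation
  fun_prop

theorem dilation_dilation_inv (w : Fin n → ℕ) {r : ℝ} (hr : 0 < r) (x : Fin n → ℝ) :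
    dilation w r (dilation w r⁻¹ x) = x := by
  funext i
  have : r ^ w i ≠ 0 := (pow_pos hr _).ne'
  simp only [dilation, inv_pow]
  field_simp

/-- The rescaled mollifier `ψ_δ x = δ^{-Q} ψ (D_{1/δ} x)`, for `δ > 0`. -/
def rescale (ψ : Test n ℝ) (δ : ℝ) : Test n ℝ :=
  if hδ : 0 < δ then
    { toFun := fun x => (δ ^ G.homDim)⁻¹ * ψ (dilation G.weight δ⁻¹ x)
      contDiff' := contDiff_const.mul (ψ.contDiff.comp (dilation_contDiff _ _))
      hasCompactSupport' := by
        refine HasCompactSupport.intro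
          (ψ.hasCompactSupport.isCompact.image (dilation_continuous G.weight δ)) ?_
        intro x hx
        have : ψ (dilation G.weight δ⁻¹ x) = 0 := by
          by_contra h
          exact hx ⟨_, subset_tsupport _ h, dilation_dilation_inv _ hδ x⟩
        simp [this]
      tsupport_subset' := fun _ _ => trivial }
  else 0

/-- The test function `y ↦ χ (y⁻¹ x)`. -/
def reflect (χ : Test n ℝ) (x : Fin n → ℝ) : Test n ℝ where
  toFun := fun y => χ (G.mul (G.inv y) x)
  contDiff' := χ.contDiff.comp (G.contDiff_mul.comp (G.contDiff_inv.prodMk contDiff_const))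
  hasCompactSupport' := by
    have hc : Continuous fun z => G.mul x (G.inv z) :=
      G.contDiff_mul.continuous.comp (continuous_const.prodMk G.contDiff_inv.continuous)
    refine HasCompactSupport.intro (χ.hasCompactSupport.isCompact.image hc) ?_
    intro y hy
    by_contra h
    refine hy ⟨_, subset_tsupport _ h, ?_⟩
    have h1 : G.mul (G.mul (G.inv y) x) (G.inv (G.mul (G.inv y) x)) = 0 := G.mul_inv _
    have h2 := congrArg (G.mul y) h1
    rwa [← G.mul_assoc, ← G.mul_assoc, G.mul_inv, G.zero_mul, G.mul_zero] at h2
  tsupport_subset' := fun _ _ => trivial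

/-- The group convolution `v ∗ χ` of a distribution and a test function;
for a function `v` it is `x ↦ ∫ v y χ (y⁻¹ x) dy`. -/
def conv {F : Type} [NormedAddCommGroup F] [NormedSpace ℝ F] (v : Distr n F) (χ : Test n ℝ)
    (x : Fin n → ℝ) : F :=
  v (G.reflect χ x)

end GradedLieGroup

/-- A scale: a bounded positive function `ρ` on `(0, 1]` with `ρ ε → 0` as `ε → 0`. -/
structure IsScale (ρ : ℝ → ℝ) : Prop where
  pos : ∀ ε ∈ Ioc (0 : ℝ) 1, 0 < ρ ε
  bounded : ∃ B, ∀ ε ∈ Ioc (0 : ℝ) 1, ρ ε ≤ B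
  tendsto : Tendsto ρ (𝓝[>] 0) (𝓝 0)

/-- The distribution `v` is (given by) an `L^p` function. -/
def IsLpDistr {n : ℕ} {F : Type} [NormedAddCommGroup F] [NormedSpace ℝ F] (p : ℝ≥0∞)
    (v : Distr n F) : Prop :=
  ∃ f : Lp F p (volume : Measure (Fin n → ℝ)), ∀ φ : Test n ℝ, v φ = ∫ x, φ x • f x

/-- The distribution `v` belongs to `𝓔'`. -/
def IsCompactlySupported {n : ℕ} {F : Type} [NormedAddCommGroup F] [NormedSpace ℝ F]
    (v : Distr n F) : Prop :=
  IsCompact (Distribution.dsupport v)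

namespace GradedLieGroup

variable {n : ℕ} (G : GradedLieGroup n)

/-- `(f_ε)` is a regularisation `v ∗ ψ_ε` of `v` by a Friedrichs mollifier `ψ`,
`ψ_ε = ρ(ε)^{-Q} ψ ∘ D_{1/ρ(ε)}`. -/
def IsRegularisation {F : Type} [NormedAddCommGroup F] [NormedSpace ℝ F] (v : Distr n F)
    (f : ℝ → (Fin n → ℝ) → F) : Prop :=
  ∃ ψ : Test n ℝ, (∫ x, ψ x) = 1 ∧ ∃ ρ : ℝ → ℝ, IsScale ρ ∧
    ∀ ε ∈ Ioc (0 : ℝ) 1, f ε =ᵐ[volume] G.conv v (G.rescale ψ (ρ ε))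

/-- `u ∈ C([0,T]; L²)` solves `∂ₜu + R u + V u = 0` in `L²` for `0 < t ≤ T`, and `u 0 = u₀`. -/
structure IsSolution (c : (Fin n → ℕ) →₀ ℂ) (T : ℝ) (V : Linfty n) (u₀ : L2 n)
    (u : ℝ → L2 n) : Prop where
  continuousOn : ContinuousOn u (Icc 0 T)
  initial : u 0 = u₀
  equation : ∀ t ∈ Ioc (0 : ℝ) T, ∃ u' Ru : L2 n,
    HasDerivWithinAt u u' (Icc 0 T) t ∧ G.IsOpValue c (u t) Ru ∧
    ∀ᵐ x, u' x + Ru x + (V x : ℂ) * u t x = 0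

/-- The net `(u_ε)` is a very weak solution of `∂ₜu + R u + V u = 0`, `u(0) = u₀` (real potential),
with approximating nets `(V_ε)`, `(u_{0,ε})`; moderateness is with respect to the scale `ρ`. -/
structure IsVeryWeakSolution (c : (Fin n → ℕ) →₀ ℂ) (T : ℝ) (ρ : ℝ → ℝ)
    (V : Distr n ℝ) (u₀ : Distr n ℂ)
    (Vε : ℝ → Linfty n) (u₀ε : ℝ → L2 n) (u : ℝ → ℝ → L2 n) : Prop where
  potential_approx : ∀ φ : Test n ℝ,
    Tendsto (fun ε => ∫ x, φ x * Vε ε x) (𝓝[>] 0) (𝓝 (V φ))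
  potential_moderate : ∃ N : ℕ, ∃ C : ℝ, ∀ ε ∈ Ioc (0 : ℝ) 1, ‖Vε ε‖ ≤ C * (ρ ε ^ N)⁻¹
  data_regularisation : G.IsRegularisation u₀ (fun ε => u₀ε ε)
  data_moderate : ∃ N : ℕ, ∃ C : ℝ, ∀ ε ∈ Ioc (0 : ℝ) 1,
    G.MemSobolev c (u₀ε ε) ∧ G.sobolevNorm c (u₀ε ε) ≤ C * (ρ ε ^ N)⁻¹
  solution : ∀ ε ∈ Ioc (0 : ℝ) 1, G.IsSolution c T (Vε ε) (u₀ε ε) (u ε)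
  moderate : ∃ N : ℕ, ∃ C : ℝ, ∀ ε ∈ Ioc (0 : ℝ) 1, ∀ t ∈ Icc (0 : ℝ) T,
    ‖u ε t‖ ≤ C * (ρ ε ^ N)⁻¹

/-- `u ∈ C([0,T]; H^{ν/2})`. -/
def ContinuousSobolev (c : (Fin n → ℕ) →₀ ℂ) (T : ℝ) (u : ℝ → L2 n) : Prop :=
  ∀ t ∈ Icc (0 : ℝ) T, G.MemSobolev c (u t) ∧
    Tendsto (fun s => G.sobolevNorm c (u s - u t)) (𝓝[Icc 0 T] t) (𝓝 0)

/-- The net `(u_ε)` is `C([0,T]; H^{ν/2})`-moderate. -/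
def IsSobolevModerate (c : (Fin n → ℕ) →₀ ℂ) (T : ℝ) (ρ : ℝ → ℝ) (u : ℝ → ℝ → L2 n) : Prop :=
  (∀ ε ∈ Ioc (0 : ℝ) 1, G.ContinuousSobolev c T (u ε)) ∧
  ∃ N : ℕ, ∃ C : ℝ, ∀ ε ∈ Ioc (0 : ℝ) 1, ∀ t ∈ Icc (0 : ℝ) T,
    G.sobolevNorm c (u ε t) ≤ C * (ρ ε ^ N)⁻¹

end GradedLieGroup

end VeryWeakHeat

end

set_option linter.unusedSectionVars false

noncomputable section

namespace VeryWeakHeat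

/-! ### The heat semigroup generated by the inverse of a positive bounded operator -/

section HeatFunctions

/-! For a fixed parameter the equation is a heat equation with a bounded real potential, treated by
quadratic forms. Write `A` for the Rockland operator on test functions and take `c` with `V + c ≥
1`. The form of `A + V + c` dominates the `L²` norm, and its Hilbert completion `K` maps injectively
into `L²` by a bounded `j`. The operator `S = j* j` on `K` is bounded, positive and injective, and
its inverse is the form version of `A + V + c`. Hence no unbounded functional calculus is needed:
`exp (-t S⁻¹)` is the continuous function `s ↦ exp (-t / s)`, extended by `0` at `s = 0`, applied to
`S`. The solution is `u t = j (exp (c t) exp (-t S⁻¹) k₀)`, where `j k₀ = u₀` (`exists_evolution`).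

Uniqueness is the `L²` energy estimate `IsEvolution.norm_le`, valid for every solution. So every
solution is the one built from `S`; it is continuous in `K`, and `⟨A u, u⟩ + ⟨V u, u⟩` does not
increase along it (`heat_energy_le`). This bounds the energy norm by a polynomial in `‖V‖`, the
energy norm of the datum and `‖u t‖`, all of them moderate. No exponential of `‖V‖` enters, which is
why `L²` moderateness implies energy moderateness.

For existence an exponential does occur: the `L²` norm is only bounded by `exp (‖V‖ T) ‖u₀‖`. Since
the mollification scale is free, it is slowed down until all norms grow at most like `1 / ρ`
(`exists_slow_index`). It remains that each mollification is admissible. Mollifying an `L²` function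
gives an element of the energy space, because left-invariant operators satisfy `R (h ∗ χ) = h ∗ R χ`
(`diffOpTest_testConv`) and convolution by a test function is bounded on `L²`. A compactly supported
datum is mollified by `ψ ∗ ψ`, the first factor bringing it into `L²`. Convergence of the mollified
potentials is a duality computation (`integral_mul_conv_rescale`). Convolution estimates use the
invariance of Lebesgue measure, deduced from the dilations. -/

theorem continuous_inv_mul_expNegInvGlue (t : ℝ) :
    Continuous fun s : ℝ => s⁻¹ * expNegInvGlue (s / t) := by
  have h1 : Continuous fun x : ℝ => x⁻¹ * expNegInvGlue x := by
    simpa using expNegInvGlue.continuous_polynomial_eval_inv_mul Polynomial.X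
  have h2 : Continuous fun s : ℝ => t⁻¹ * ((s / t)⁻¹ * expNegInvGlue (s / t)) :=
    continuous_const.mul (h1.comp (continuous_id.div_const t))
  rcases eq_or_ne t 0 with rfl | ht
  · simpa [expNegInvGlue.zero] using continuous_const
  · refine h2.congr fun s => ?_
    rcases eq_or_ne s 0 with rfl | hs
    · simp
    · field_simp

theorem continuous_expNegInvGlue_div (t : ℝ) :
    Continuous fun s : ℝ => expNegInvGlue (s / t) :=
  (expNegInvGlue.contDiff (n := 0)).continuous.comp (continuous_id.div_const t)

theorem expNegInvGlue_div_of_pos {s t : ℝ} (hs : 0 < s) (ht : 0 < t) :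
    expNegInvGlue (s / t) = Real.exp (-(t / s)) := by
  rw [expNegInvGlue, if_neg (not_le.2 (div_pos hs ht)), inv_div]

theorem expNegInvGlue_le_one (x : ℝ) : expNegInvGlue x ≤ 1 := by
  rw [expNegInvGlue]
  split_ifs with h
  · exact zero_le_one
  · exact Real.exp_le_one_iff.2 (by simpa using (not_le.1 h).le)

theorem abs_exp_sub_one_sub_id_le_sq_mul_exp (x : ℝ) :
    |Real.exp x - 1 - x| ≤ x ^ 2 * Real.exp |x| := by
  have h := Complex.norm_exp_sub_sum_le_norm_mul_exp (x : ℂ) 2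
  simp only [Finset.sum_range_succ, Finset.range_zero, Finset.sum_empty] at h
  have h2 : Complex.exp x - (0 + (x : ℂ) ^ 0 / (Nat.factorial 0 : ℂ)
      + (x : ℂ) ^ 1 / (Nat.factorial 1 : ℂ)) = ((Real.exp x - 1 - x : ℝ) : ℂ) := by
    push_cast
    simp
    ring
  rw [h2, Complex.norm_real, Complex.norm_real, Real.norm_eq_abs, Real.norm_eq_abs, sq_abs] at h
  exact h

/-- The second order Taylor estimate for `t ↦ exp (-t / s)`, uniform in `s`. -/
theorem abs_expNegInvGlue_taylor {t t' s : ℝ} (ht : 0 < t) (ht' : |t' - t| ≤ t / 2) (hs : 0 ≤ s) :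
    |expNegInvGlue (s / t') - expNegInvGlue (s / t) +
      (t' - t) * (s⁻¹ * expNegInvGlue (s / t))| ≤ 8 / t ^ 2 * (t' - t) ^ 2 := by
  have hpos : 0 < t' := by have := abs_le.1 ht'; linarith
  rcases hs.eq_or_lt with rfl | hs
  · simp only [zero_div, expNegInvGlue.zero]
    simp
    positivity
  rw [expNegInvGlue_div_of_pos hs hpos, expNegInvGlue_div_of_pos hs ht]
  set d := t' - t
  have e1 : Real.exp (-(t' / s)) = Real.exp (-(t / s)) * Real.exp (-(d / s)) := by
    rw [← Real.exp_add]; congr 1; simp only [d]; ring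
  have e2 : Real.exp (-(t' / s)) - Real.exp (-(t / s)) + d * (s⁻¹ * Real.exp (-(t / s)))
      = Real.exp (-(t / s)) * (Real.exp (-(d / s)) - 1 - (-(d / s))) := by
    rw [e1]; ring
  rw [e2, abs_mul, abs_of_pos (Real.exp_pos _)]
  have h1 := abs_exp_sub_one_sub_id_le_sq_mul_exp (-(d / s))
  have h2 : |-(d / s)| ≤ t / 2 / s := by
    rw [abs_neg, abs_div, abs_of_pos hs]; gcongr
  -- Half of the decay `exp (-t / s)` pays for the Taylor remainder, whose exponent is at most `t /
  -- (2 s)`. The other half pays for `1 / s²` through `y² / 2 ≤ exp y` with `y = t / (2 s)`; this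
  -- produces the constant `8 / t²`.
  have h3 : Real.exp (-(t / s)) * Real.exp (t / 2 / s) = Real.exp (-(t / 2 / s)) := by
    rw [← Real.exp_add]; congr 1; ring
  have h4 : (t / 2 / s) ^ 2 / 2 * Real.exp (-(t / 2 / s)) ≤ 1 := by
    rw [Real.exp_neg, ← div_eq_mul_inv, div_le_one (Real.exp_pos _)]
    have := Real.quadratic_le_exp_of_nonneg (x := t / 2 / s) (by positivity)
    have : 0 ≤ t / 2 / s := by positivity
    linarith
  calc Real.exp (-(t / s)) * |Real.exp (-(d / s)) - 1 - -(d / s)|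
      ≤ Real.exp (-(t / s)) * ((-(d / s)) ^ 2 * Real.exp (t / 2 / s)) := by
        gcongr
        exact h1.trans (by gcongr)
    _ = (-(d / s)) ^ 2 * Real.exp (-(t / 2 / s)) := by rw [← h3]; ring
    _ = 8 / t ^ 2 * d ^ 2 * ((t / 2 / s) ^ 2 / 2 * Real.exp (-(t / 2 / s))) := by
        field_simp; ring
    _ ≤ 8 / t ^ 2 * d ^ 2 * 1 := by gcongr
    _ = _ := mul_one _

end HeatFunctions

section HeatOperator

variable {K : Type*} [NormedAddCommGroup K] [InnerProductSpace ℂ K] [CompleteSpace K]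

/-- `exp (-t S⁻¹)` for a positive operator `S`. -/
def heat (S : K →L[ℂ] K) (t : ℝ) : K →L[ℂ] K :=
  -- The branch matters at `t = 0`: there `s / 0 = 0` and the functional calculus would return `0`
  -- instead of the identity.
  if t ≤ 0 then 1 else cfc (fun s : ℝ => expNegInvGlue (s / t)) S

/-- `S⁻¹ exp (-t S⁻¹)` for a positive operator `S` and `t > 0`. -/
def heatDeriv (S : K →L[ℂ] K) (t : ℝ) : K →L[ℂ] K :=
  cfc (fun s : ℝ => s⁻¹ * expNegInvGlue (s / t)) S

variable {S : K →L[ℂ] K}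

theorem heat_of_pos {t : ℝ} (ht : 0 < t) :
    heat S t = cfc (fun s : ℝ => expNegInvGlue (s / t)) S :=
  if_neg (not_le.2 ht)

theorem heat_zero : heat S 0 = 1 := if_pos le_rfl

theorem norm_heat_le (S : K →L[ℂ] K) (t : ℝ) : ‖heat S t‖ ≤ 1 := by
  rw [heat]
  split_ifs with h
  · exact ContinuousLinearMap.norm_id_le
  · refine norm_cfc_le zero_le_one fun x _ => ?_
    rw [Real.norm_of_nonneg (expNegInvGlue.nonneg _)]
    exact expNegInvGlue_le_one _

/-- The smoothing effect: for `t > 0` the flow takes values in the range of `S`, which later places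
the solution in the operator domain. At `s = 0`, where `s * s⁻¹` is not `1`, both functions vanish.
-/
theorem comp_heatDeriv (hS : 0 ≤ S) {t : ℝ} (ht : 0 < t) : S * heatDeriv S t = heat S t := by
  have hsa : IsSelfAdjoint S := .of_nonneg hS
  rw [heat_of_pos ht, heatDeriv]
  nth_rewrite 1 [← cfc_id' ℝ S]
  rw [← cfc_mul (fun x : ℝ => x) _ S continuousOn_id
    (continuous_inv_mul_expNegInvGlue t).continuousOn]
  refine cfc_congr fun s _ => ?_
  rcases eq_or_ne s 0 with rfl | hs
  · simp [expNegInvGlue.zero]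
  · simp [hs]

/-- The Taylor bound is uniform in `s ≥ 0`, hence on the spectrum of `S`, so the functional calculus
turns it into a quadratic remainder in operator norm. -/
theorem hasDerivAt_heat (hS : 0 ≤ S) {t : ℝ} (ht : 0 < t) :
    HasDerivAt (heat S) (-heatDeriv S t) t := by
  have hsa : IsSelfAdjoint S := .of_nonneg hS
  rw [hasDerivAt_iff_isLittleO]
  have hO : (fun t' => heat S t' - heat S t - (t' - t) • (-heatDeriv S t)) =O[𝓝 t]
      fun t' => (t' - t) ^ 2 := by
    refine Asymptotics.IsBigO.of_bound (8 / t ^ 2) ?_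
    have hnear : ∀ᶠ t' in 𝓝 t, |t' - t| < t / 2 := by
      have := Metric.ball_mem_nhds t (half_pos ht)
      filter_upwards [this] with t' h
      simpa [Real.dist_eq] using h
    filter_upwards [hnear] with t' h
    have hpos : 0 < t' := by have := abs_lt.1 h; linarith
    have hc := continuous_inv_mul_expNegInvGlue t
    rw [heat_of_pos ht, heat_of_pos hpos, heatDeriv, smul_neg, sub_neg_eq_add,
      ← cfc_sub _ _ S (continuous_expNegInvGlue_div t').continuousOn
        (continuous_expNegInvGlue_div t).continuousOn,
      ← cfc_smul (t' - t) _ S hc.continuousOn,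
      ← cfc_add (a := S) (fun x => expNegInvGlue (x / t') - expNegInvGlue (x / t))
        (fun x => (t' - t) • (x⁻¹ * expNegInvGlue (x / t)))
        (((continuous_expNegInvGlue_div t').sub
        (continuous_expNegInvGlue_div t)).continuousOn) (hc.const_smul (t' - t)).continuousOn]
    rw [Real.norm_of_nonneg (sq_nonneg (t' - t))]
    refine norm_cfc_le (by positivity) fun s hs => ?_
    rw [Real.norm_eq_abs]
    exact abs_expNegInvGlue_taylor ht h.le (spectrum_nonneg_of_nonneg hS hs)
  refine hO.trans_isLittleO ?_
  have := (Asymptotics.isLittleO_pow_id (𝕜 := ℝ) (n := 2) one_lt_two)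
  have h0 : Tendsto (fun t' => t' - t) (𝓝 t) (𝓝 0) := by
    have : Tendsto (fun t' : ℝ => t' - t) (𝓝 t) (𝓝 (t - t)) :=
      (continuous_id.sub continuous_const).tendsto t
    simpa using this
  exact this.comp_tendsto h0

/-- Reduces to `0 ≤ s (1 - exp (-t / s)) ≤ t` for `s > 0`. It gives continuity at time `0` on the
range of `S`. -/
theorem norm_heat_comp_sub_le (hS : 0 ≤ S) {t : ℝ} (ht : 0 ≤ t) : ‖heat S t * S - S‖ ≤ t := by
  have hsa : IsSelfAdjoint S := .of_nonneg hS
  rcases ht.eq_or_lt with rfl | ht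
  · simp [heat_zero]
  have hc := continuous_expNegInvGlue_div t
  have e : heat S t * S - S = cfc (fun s : ℝ => expNegInvGlue (s / t) * s - s) S := by
    rw [cfc_sub (fun s : ℝ => expNegInvGlue (s / t) * s) (fun s => s) S
        (hc.mul continuous_id).continuousOn continuousOn_id,
      cfc_mul _ (fun s => s) S hc.continuousOn continuousOn_id, cfc_id' ℝ S, heat_of_pos ht]
  rw [e]
  refine norm_cfc_le ht.le fun s hs => ?_
  have hs0 : 0 ≤ s := spectrum_nonneg_of_nonneg hS hs
  rcases hs0.eq_or_lt with rfl | hs0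
  · simpa using ht.le
  rw [expNegInvGlue_div_of_pos hs0 ht]
  have h1 := Real.one_sub_le_exp_neg (t / s)
  have h2 : Real.exp (-(t / s)) ≤ 1 := Real.exp_le_one_iff.2 (by simp; positivity)
  rw [Real.norm_eq_abs, abs_le]
  have h3 : t / s * s = t := by field_simp
  constructor <;> nlinarith

theorem dense_range_of_injective (hS : 0 ≤ S) (hinj : ∀ k, S k = 0 → k = 0) :
    DenseRange S := by
  have hsa : IsSelfAdjoint S := .of_nonneg hS
  have h : (LinearMap.range S.toLinearMap)ᗮ = ⊥ := by
    rw [Submodule.eq_bot_iff]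
    intro x hx
    refine hinj x ?_
    rw [← inner_self_eq_zero (𝕜 := ℂ)]
    have h2 : inner ℂ (S (S x)) x = 0 := by
      rw [Submodule.mem_orthogonal] at hx
      exact hx _ ⟨S x, rfl⟩
    rw [← ContinuousLinearMap.adjoint_inner_left, ← ContinuousLinearMap.star_eq_adjoint,
      hsa.star_eq, h2]
  have := Submodule.topologicalClosure_eq_top_iff.2 h
  rw [← Submodule.dense_iff_topologicalClosure_eq_top] at this
  exact this

/-- In general only strong continuity can be expected at `0`. It holds on the range of `S` at rate
`t`, this range is dense by injectivity, and the contraction bound carries it to the closure. -/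
theorem tendsto_heat_zero (hS : 0 ≤ S) (hinj : ∀ k, S k = 0 → k = 0) (k : K) :
    Tendsto (fun t => heat S t k) (𝓝[≥] 0) (𝓝 k) := by
  rw [Metric.tendsto_nhdsWithin_nhds]
  intro ε hε
  obtain ⟨x, hx⟩ := (dense_range_of_injective hS hinj).exists_dist_lt k
    (show 0 < ε / 3 by positivity)
  refine ⟨ε / 3 / (‖x‖ + 1), by positivity, fun t ht hd => ?_⟩
  have ht0 : (0 : ℝ) ≤ t := ht
  rw [dist_zero_right, Real.norm_of_nonneg ht0] at hd
  rw [dist_eq_norm] at hx ⊢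
  have e : heat S t k - k = heat S t (k - S x) + ((heat S t * S - S) x) - (k - S x) := by
    simp
  have h1 : ‖heat S t (k - S x)‖ ≤ ‖k - S x‖ := by
    simpa using (heat S t).le_of_opNorm_le (norm_heat_le S t) (k - S x)
  have h2 : ‖(heat S t * S - S) x‖ ≤ t * ‖x‖ :=
    (heat S t * S - S).le_of_opNorm_le (norm_heat_comp_sub_le hS ht0) x
  have h3 : t * ‖x‖ ≤ ε / 3 := by
    rw [lt_div_iff₀ (by positivity)] at hd
    nlinarith
  calc ‖heat S t k - k‖ ≤ ‖heat S t (k - S x)‖ + ‖(heat S t * S - S) x‖ + ‖k - S x‖ := by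
        rw [e]; exact (norm_sub_le _ _).trans (by gcongr; exact norm_add_le _ _)
    _ < ε := by linarith

theorem continuousOn_heat (hS : 0 ≤ S) (hinj : ∀ k, S k = 0 → k = 0) (k : K) :
    ContinuousOn (fun t => heat S t k) (Ici 0) := by
  intro t ht
  rcases (show (0 : ℝ) ≤ t from ht).eq_or_lt with rfl | ht
  · rw [ContinuousWithinAt, heat_zero]
    exact tendsto_heat_zero hS hinj k
  · exact ((hasDerivAt_heat hS ht).continuousAt.clm_apply continuousAt_const).continuousWithinAt

/-- The quadratic form of `S⁻¹ - c` decreases along the flow `t ↦ exp (c t) exp (-t S⁻¹)`. -/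
theorem heat_energy_le (hS : 0 ≤ S) (c : ℝ) {t : ℝ} (ht : 0 ≤ t) (k : K) :
    ‖(Real.exp (c * t) : ℂ) • heat S t k‖ ^ 2
      - c * (inner ℂ (S ((Real.exp (c * t) : ℂ) • heat S t k))
        ((Real.exp (c * t) : ℂ) • heat S t k)).re
      ≤ ‖k‖ ^ 2 - c * (inner ℂ (S k) k).re := by
  have hsa : IsSelfAdjoint S := .of_nonneg hS
  rcases ht.eq_or_lt with rfl | ht
  · simp [heat_zero]
  set E := Real.exp (c * t) • heat S t with hE
  have hg := continuous_expNegInvGlue_div t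
  have hE' : E = cfc (fun s : ℝ => Real.exp (c * t) • expNegInvGlue (s / t)) S := by
    rw [hE, heat_of_pos ht, cfc_smul _ _ S hg.continuousOn]
  have hEsa : IsSelfAdjoint E := by rw [hE']; exact cfc_predicate _ _
  have hEk : (Real.exp (c * t) : ℂ) • heat S t k = E k := by
    rw [hE]; rfl
  -- Under the calculus this reads `e² (1 - c s) ≤ 1 - c s` with `e = exp (-(t / s) (1 - c s))`. It
  -- holds because `e ≤ 1` when `1 - c s ≥ 0` and `e ≥ 1` when `1 - c s ≤ 0`; at `s = 0` it is `0 ≤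
  -- 1`.
  have key : E * (1 - c • S) * E ≤ 1 - c • S := by
    have e0 : 1 - c • S = cfc (fun s : ℝ => 1 - c • s) S := by
      rw [cfc_sub (fun _ : ℝ => (1 : ℝ)) (fun s : ℝ => c • s) S continuousOn_const
        (continuous_id.const_smul c).continuousOn, cfc_const_one ℝ S,
        cfc_smul c (fun s : ℝ => s) S continuousOn_id, cfc_id' ℝ S]
    have c1 : Continuous fun s : ℝ => 1 - c • s := by fun_prop
    have c2 : Continuous fun s : ℝ => Real.exp (c * t) • expNegInvGlue (s / t) :=
      continuous_const.mul hg
    rw [e0, hE', ← cfc_mul _ _ S c2.continuousOn c1.continuousOn,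
      ← cfc_mul (fun s => Real.exp (c * t) • expNegInvGlue (s / t) * (1 - c • s)) _ S
        (c2.mul c1).continuousOn c2.continuousOn]
    refine cfc_mono (fun s hs => ?_) ((c2.mul c1).mul c2).continuousOn c1.continuousOn
    have hs0 : 0 ≤ s := spectrum_nonneg_of_nonneg hS hs
    rcases hs0.eq_or_lt with rfl | hs0
    · simp [expNegInvGlue.zero]
    rw [expNegInvGlue_div_of_pos hs0 ht]
    simp only [smul_eq_mul, ← Real.exp_add]
    have e1 : c * t + -(t / s) = -(t / s * (1 - c * s)) := by field_simp; ring
    rw [e1]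
    have hts : 0 < t / s := by positivity
    rcases le_total 0 (1 - c * s) with h | h
    · have : Real.exp (-(t / s * (1 - c * s))) ≤ 1 :=
        Real.exp_le_one_iff.2 (by nlinarith)
      have h0 := Real.exp_pos (-(t / s * (1 - c * s)))
      have h5 : Real.exp (-(t / s * (1 - c * s))) * Real.exp (-(t / s * (1 - c * s))) ≤ 1 := by
        nlinarith
      nlinarith
    · have : 1 ≤ Real.exp (-(t / s * (1 - c * s))) :=
        Real.one_le_exp (by nlinarith)
      have h5 : 1 ≤ Real.exp (-(t / s * (1 - c * s))) * Real.exp (-(t / s * (1 - c * s))) := by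
        nlinarith
      nlinarith
  have q : ∀ x : K, (inner ℂ ((1 - c • S) x) x).re = ‖x‖ ^ 2 - c * (inner ℂ (S x) x).re := by
    intro x
    have : (1 - c • S) x = x - (c : ℂ) • S x := rfl
    rw [this, inner_sub_left, inner_smul_left, Complex.sub_re, Complex.conj_ofReal,
      Complex.re_ofReal_mul]
    have := inner_self_eq_norm_sq (𝕜 := ℂ) x
    rw [← this]; rfl
  rw [hEk, ← q, ← q]
  have h := (ContinuousLinearMap.le_def _ _).1 key
  have h2 := h.re_inner_nonneg_left k
  have h3 : inner ℂ ((E * (1 - c • S) * E) k) k = inner ℂ ((1 - c • S) (E k)) (E k) := by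
    change inner ℂ (E ((1 - c • S) (E k))) k = _
    rw [← ContinuousLinearMap.adjoint_inner_right, ← ContinuousLinearMap.star_eq_adjoint,
      hEsa.star_eq]
  rw [sub_apply, inner_sub_left, h3, map_sub] at h2
  exact sub_nonneg.1 h2

end HeatOperator

/-! ### The Friedrichs realisation of a positive symmetric operator -/

section Friedrichs

open InnerProductSpace

universe u

theorem exists_hilbert_completion {D : Type u} [AddCommGroup D] [Module ℂ D]
    (c : PreInnerProductSpace.Core ℂ D) :
    ∃ (K : Type u) (_ : NormedAddCommGroup K) (_ : InnerProductSpace ℂ K) (_ : CompleteSpace K)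
      (i : D →ₗ[ℂ] K), DenseRange i ∧ ∀ x y, inner ℂ (i x) (i y) = c.inner x y := by
  let : SeminormedAddCommGroup D := InnerProductSpace.Core.toSeminormedAddCommGroup (𝕜 := ℂ) (F := D)
  let : InnerProductSpace ℂ D := InnerProductSpace.ofCore c
  refine ⟨UniformSpace.Completion D, inferInstance, inferInstance, inferInstance,
    (UniformSpace.Completion.toComplL (𝕜 := ℂ) (E := D)).toLinearMap, ?_, fun x y => ?_⟩
  · exact UniformSpace.Completion.denseRange_coe
  · exact UniformSpace.Completion.inner_coe x y

variable {D : Type u} [AddCommGroup D] [Module ℂ D]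
variable {H : Type*} [NormedAddCommGroup H] [InnerProductSpace ℂ H] [CompleteSpace H]

/-- The operator `A`, defined on the image of `ι`, is symmetric and nonnegative. -/
structure IsPositiveSymmetric (ι A : D →ₗ[ℂ] H) : Prop where
  symm : ∀ φ ψ, inner ℂ (ι φ) (A ψ) = inner ℂ (A φ) (ι ψ)
  nonneg : ∀ φ, 0 ≤ (inner ℂ (ι φ) (A φ)).re

/-- Polarisation over `ℂ`: a real quadratic form, evaluated at `φ + ψ` and `φ + iψ`, forces the
sesquilinear form to be Hermitian. -/
theorem IsPositiveSymmetric.of_real {ι A : D →ₗ[ℂ] H}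
    (him : ∀ φ, (inner ℂ (ι φ) (A φ)).im = 0) (hre : ∀ φ, 0 ≤ (inner ℂ (ι φ) (A φ)).re) :
    IsPositiveSymmetric ι A := by
  refine ⟨fun φ ψ => ?_, hre⟩
  have h1 := him (φ + ψ)
  have h2 := him (φ + Complex.I • ψ)
  simp only [map_add, map_smul, inner_add_left, inner_add_right, inner_smul_left,
    inner_smul_right, Complex.add_im, him] at h1 h2
  simp only [Complex.conj_I, Complex.add_im, Complex.mul_im, Complex.I_re, Complex.I_im, him,
    Complex.neg_re, Complex.neg_im, Complex.add_re, Complex.mul_re] at h1 h2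
  have e := inner_conj_symm (𝕜 := ℂ) (A φ) (ι ψ)
  apply Complex.ext
  · have := congrArg Complex.re e
    simp only [Complex.conj_re] at this
    linarith
  · have := congrArg Complex.im e
    simp only [Complex.conj_im] at this
    linarith

/-- `f` is the limit of a sequence in `D` which is Cauchy in energy, with limit energy `e`. -/
def EnergyLimit (ι A : D →ₗ[ℂ] H) (f : H) (e : ℝ) : Prop :=
  ∃ φ : ℕ → D,
    Tendsto (fun k => ι (φ k)) atTop (𝓝 f) ∧
    Tendsto (fun p : ℕ × ℕ => (inner ℂ (ι (φ p.1 - φ p.2)) (A (φ p.1 - φ p.2))).re)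
      atTop (𝓝 0) ∧
    Tendsto (fun k => (inner ℂ (ι (φ k)) (A (φ k))).re) atTop (𝓝 e)

/-- `f` lies in the domain of the Friedrichs extension of `A`, with value `g`. -/
def FriedrichsValue (ι A : D →ₗ[ℂ] H) (f g : H) : Prop :=
  (∃ e, EnergyLimit ι A f e) ∧ ∀ φ, inner ℂ (A φ) f = inner ℂ (ι φ) g

/-- `K` is the completion of `D` for the form `⟪ι ·, A ·⟫ + ⟪ι ·, W (ι ·)⟫`, and `j : K → H`
extends `ι`. -/
structure IsFormCompletion {K : Type*} [NormedAddCommGroup K] [InnerProductSpace ℂ K]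
    (ι A : D →ₗ[ℂ] H) (W : H →L[ℂ] H) (i : D →ₗ[ℂ] K) (j : K →L[ℂ] H) : Prop where
  dense : DenseRange i
  inner_eq : ∀ φ ψ, inner ℂ (i φ) (i ψ) = inner ℂ (ι φ) (A ψ) + inner ℂ (ι φ) (W (ι ψ))
  extends_eq : ∀ φ, j (i φ) = ι φ

/-- The lower bound on `W` makes the form norm dominate `‖ι ·‖`, so `ι` factors through the
completion and extends to a bounded `j`. -/
theorem exists_formCompletion {ι A : D →ₗ[ℂ] H} (hA : IsPositiveSymmetric ι A) {W : H →L[ℂ] H}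
    (hW : IsSelfAdjoint W) (hW1 : ∀ f, ‖f‖ ^ 2 ≤ (inner ℂ f (W f)).re) :
    ∃ (K : Type u) (_ : NormedAddCommGroup K) (_ : InnerProductSpace ℂ K) (_ : CompleteSpace K)
      (i : D →ₗ[ℂ] K) (j : K →L[ℂ] H), IsFormCompletion ι A W i j := by
  have hWs : ∀ x y, inner ℂ (W x) y = inner ℂ x (W y) := fun x y => by
    rw [← ContinuousLinearMap.adjoint_inner_right, ← ContinuousLinearMap.star_eq_adjoint,
      hW.star_eq]
  let c : PreInnerProductSpace.Core ℂ D :=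
    { inner := fun φ ψ => inner ℂ (ι φ) (A ψ) + inner ℂ (ι φ) (W (ι ψ))
      conj_inner_symm := fun φ ψ => by
        simp only [map_add, inner_conj_symm]
        rw [hA.symm, hWs]
      re_inner_nonneg := fun φ => by
        have h1 := hA.nonneg φ
        have h2 := (sq_nonneg _).trans (hW1 (ι φ))
        simpa using add_nonneg h1 h2
      add_left := fun x y z => by simp only [map_add, inner_add_left]; ring
      smul_left := fun x y r => by simp only [map_smul, inner_smul_left]; ring }
  obtain ⟨K, i1, i2, i3, i, hd, hi⟩ := exists_hilbert_completion c
  have hb : ∀ φ, ‖ι φ‖ ≤ 1 * ‖i φ‖ := fun φ => by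
    rw [one_mul]
    refine le_of_sq_le_sq ?_ (norm_nonneg _)
    have h3 : ‖i φ‖ ^ 2 = (inner ℂ (i φ) (i φ)).re := (inner_self_eq_norm_sq (𝕜 := ℂ) _).symm
    rw [h3, hi]
    have h1 := hA.nonneg φ
    have h2 := hW1 (ι φ)
    change ‖ι φ‖ ^ 2 ≤ (inner ℂ (ι φ) (A φ) + inner ℂ (ι φ) (W (ι φ))).re
    rw [Complex.add_re]
    linarith
  exact ⟨K, i1, i2, i3, i, ι.extendOfNorm i, hd, hi,
    LinearMap.extendOfNorm_eq hd ⟨1, hb⟩⟩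

namespace IsFormCompletion

variable {K : Type*} [NormedAddCommGroup K] [InnerProductSpace ℂ K] [CompleteSpace K]
  {ι A : D →ₗ[ℂ] H} {W : H →L[ℂ] H} {i : D →ₗ[ℂ] K} {j : K →L[ℂ] H}

theorem inner_right (h : IsFormCompletion ι A W i j) (k : K) (φ : D) :
    inner ℂ k (i φ) = inner ℂ (j k) (A φ) + inner ℂ (j k) (W (ι φ)) := by
  refine h.dense.induction_on (p := fun k =>
    inner ℂ k (i φ) = inner ℂ (j k) (A φ) + inner ℂ (j k) (W (ι φ))) k ?_ fun ψ => ?_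
  · exact isClosed_eq (by fun_prop) (by fun_prop)
  · rw [h.inner_eq, h.extends_eq]

/-- This is closability of the form. It holds because the form comes from an operator: by
`inner_right`, pairing `k` with `i φ` only sees `j k`, so `j k = 0` makes `k` orthogonal to a dense
set. -/
theorem injective (h : IsFormCompletion ι A W i j) {k : K} (hk : j k = 0) : k = 0 := by
  have h1 : ∀ x : K, inner ℂ k x = 0 := fun x =>
    h.dense.induction_on (p := fun x => inner ℂ k x = 0) x
      (isClosed_eq (by fun_prop) (by fun_prop)) fun φ => by
        rw [h.inner_right, hk]; simp
  exact inner_self_eq_zero.1 (h1 k)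

theorem energy_eq (h : IsFormCompletion ι A W i j) (φ : D) :
    (inner ℂ (ι φ) (A φ)).re = ‖i φ‖ ^ 2 - (inner ℂ (ι φ) (W (ι φ))).re := by
  have h3 : ‖i φ‖ ^ 2 = (inner ℂ (i φ) (i φ)).re := (inner_self_eq_norm_sq (𝕜 := ℂ) _).symm
  rw [h3, h.inner_eq, Complex.add_re, add_sub_cancel_right]

theorem energyLimit (h : IsFormCompletion ι A W i j) (k : K) :
    EnergyLimit ι A (j k) (‖k‖ ^ 2 - (inner ℂ (j k) (W (j k))).re) := by
  obtain ⟨x, hx, hk⟩ := mem_closure_iff_seq_limit.1 (h.dense k)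
  choose φ hφ using hx
  have hφ' : ∀ m, i (φ m) = x m := hφ
  have hcont : Continuous fun k : K => ‖k‖ ^ 2 - (inner ℂ (j k) (W (j k))).re :=
    (continuous_norm.pow 2).sub (Complex.continuous_re.comp (by fun_prop))
  refine ⟨φ, ?_, ?_, ?_⟩
  · simp_rw [← h.extends_eq, hφ']
    exact (j.continuous.tendsto k).comp hk
  · simp_rw [h.energy_eq, ← h.extends_eq, map_sub i, hφ']
    have h1 : Tendsto (fun p : ℕ × ℕ => x p.1 - x p.2) atTop (𝓝 (k - k)) := by
      rw [← prod_atTop_atTop_eq]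
      exact (hk.comp tendsto_fst).sub (hk.comp tendsto_snd)
    rw [sub_self] at h1
    have h2 := (hcont.tendsto 0).comp h1
    rw [map_zero, map_zero, inner_zero_left, norm_zero] at h2
    simpa only [Function.comp_def, map_sub, ne_eq, OfNat.ofNat_ne_zero, not_false_eq_true,
      zero_pow, Complex.zero_re, sub_zero] using h2
  · simp_rw [h.energy_eq, ← h.extends_eq, hφ']
    exact (hcont.tendsto k).comp hk

/-- Convergence in `H` together with the Cauchy property in energy is exactly the Cauchy property in
`K`. With `energyLimit` this identifies the energy space with `j(K)`, whichever `W` was used to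
complete. -/
theorem exists_of_energyLimit (h : IsFormCompletion ι A W i j) {f : H} {e : ℝ}
    (hf : EnergyLimit ι A f e) :
    ∃ k, j k = f ∧ e = ‖k‖ ^ 2 - (inner ℂ f (W f)).re := by
  obtain ⟨φ, h1, h2, h3⟩ := hf
  have hcont : Continuous fun f : H => (inner ℂ f (W f)).re :=
    Complex.continuous_re.comp (by fun_prop)
  have hc : CauchySeq fun m => i (φ m) := by
    rw [cauchySeq_iff_tendsto_dist_atTop_0]
    have h4 : Tendsto (fun p : ℕ × ℕ => ι (φ p.1 - φ p.2)) atTop (𝓝 (f - f)) := by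
      simp_rw [map_sub]
      rw [← prod_atTop_atTop_eq]
      exact (h1.comp tendsto_fst).sub (h1.comp tendsto_snd)
    have h5 := h2.add ((hcont.tendsto _).comp h4)
    simp_rw [h.energy_eq] at h5
    simp only [Function.comp_def, sub_add_cancel, sub_self, map_zero, inner_zero_left,
      Complex.zero_re, add_zero] at h5
    have h6 := h5.sqrt
    simpa [dist_eq_norm, map_sub] using h6
  obtain ⟨k, hk⟩ := cauchySeq_tendsto_of_complete hc
  have hjk : j k = f := by
    refine tendsto_nhds_unique ((j.continuous.tendsto k).comp hk) ?_
    simpa [Function.comp_def, h.extends_eq] using h1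
  refine ⟨k, hjk, tendsto_nhds_unique h3 ?_⟩
  simp_rw [h.energy_eq]
  exact (hk.norm.pow 2).sub ((hcont.tendsto f).comp h1)

/-- `j j*` is the inverse of the Friedrichs extension of `A + W`: pairing `j* g` with `i φ` in `K`
is pairing `g` with `ι φ` in `H`. -/
theorem friedrichsValue_adjoint (h : IsFormCompletion ι A W i j) (hW : IsSelfAdjoint W) (g : H) :
    FriedrichsValue ι A (j (j.adjoint g)) (g - W (j (j.adjoint g))) := by
  refine ⟨⟨_, h.energyLimit _⟩, fun φ => ?_⟩
  have h1 := congrArg conj (h.inner_right (j.adjoint g) φ)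
  simp only [map_add, inner_conj_symm] at h1
  rw [ContinuousLinearMap.adjoint_inner_right, h.extends_eq] at h1
  have hWs : inner ℂ (W (ι φ)) (j (j.adjoint g)) = inner ℂ (ι φ) (W (j (j.adjoint g))) := by
    rw [← ContinuousLinearMap.adjoint_inner_right, ← ContinuousLinearMap.star_eq_adjoint,
      hW.star_eq]
  rw [inner_sub_right, h1, hWs]
  ring

/-- The weak equation, known against `D`, extends by density to test vectors in `K`; the vector
itself may then serve as test vector. -/
theorem inner_of_friedrichsValue (h : IsFormCompletion ι A W i j) (hW : IsSelfAdjoint W)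
    {k : K} {g : H} (hg : ∀ φ, inner ℂ (A φ) (j k) = inner ℂ (ι φ) g) (k' : K) :
    inner ℂ k' k = inner ℂ (j k') (g + W (j k)) := by
  refine h.dense.induction_on (p := fun k' => inner ℂ k' k = inner ℂ (j k') (g + W (j k))) k'
    (isClosed_eq (by fun_prop) (by fun_prop)) fun φ => ?_
  have h1 := congrArg conj (h.inner_right k φ)
  simp only [map_add, inner_conj_symm] at h1
  have hWs : inner ℂ (W (ι φ)) (j k) = inner ℂ (ι φ) (W (j k)) := by
    rw [← ContinuousLinearMap.adjoint_inner_right, ← ContinuousLinearMap.star_eq_adjoint,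
      hW.star_eq]
  rw [h1, hg, hWs, h.extends_eq, inner_add_right]

end IsFormCompletion

variable {ι A : D →ₗ[ℂ] H}

theorem IsPositiveSymmetric.exists_formCompletion_one (hA : IsPositiveSymmetric ι A) :
    ∃ (K : Type u) (_ : NormedAddCommGroup K) (_ : InnerProductSpace ℂ K) (_ : CompleteSpace K)
      (i : D →ₗ[ℂ] K) (j : K →L[ℂ] H), IsFormCompletion ι A 1 i j :=
  exists_formCompletion hA (.one _) fun f => (inner_self_eq_norm_sq (𝕜 := ℂ) f).ge

theorem EnergyLimit.unique (hA : IsPositiveSymmetric ι A) {f : H} {e e' : ℝ}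
    (h : EnergyLimit ι A f e) (h' : EnergyLimit ι A f e') : e = e' := by
  obtain ⟨K, _, _, _, i, j, hK⟩ := hA.exists_formCompletion_one
  obtain ⟨k, hk, rfl⟩ := hK.exists_of_energyLimit h
  obtain ⟨k', hk', rfl⟩ := hK.exists_of_energyLimit h'
  have : k = k' := by
    rw [← sub_eq_zero]
    exact hK.injective (by rw [map_sub, hk, hk', sub_self])
  rw [this]

theorem EnergyLimit.nonneg (hA : IsPositiveSymmetric ι A) {f : H} {e : ℝ}
    (h : EnergyLimit ι A f e) : 0 ≤ e := by
  obtain ⟨φ, -, -, h3⟩ := h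
  exact ge_of_tendsto' h3 fun k => hA.nonneg _

theorem EnergyLimit.exists_sub (hA : IsPositiveSymmetric ι A) {f f' : H} {e e' : ℝ}
    (h : EnergyLimit ι A f e) (h' : EnergyLimit ι A f' e') :
    ∃ e'', EnergyLimit ι A (f - f') e'' := by
  obtain ⟨K, _, _, _, i, j, hK⟩ := hA.exists_formCompletion_one
  obtain ⟨k, hk, -⟩ := hK.exists_of_energyLimit h
  obtain ⟨k', hk', -⟩ := hK.exists_of_energyLimit h'
  exact ⟨_, by simpa only [map_sub, hk, hk'] using hK.energyLimit (k - k')⟩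

theorem FriedrichsValue.sub (hA : IsPositiveSymmetric ι A) {f f' g g' : H}
    (h : FriedrichsValue ι A f g) (h' : FriedrichsValue ι A f' g') :
    FriedrichsValue ι A (f - f') (g - g') := by
  obtain ⟨⟨e, he⟩, h⟩ := h
  obtain ⟨⟨e', he'⟩, h'⟩ := h'
  exact ⟨he.exists_sub hA he', fun φ => by rw [inner_sub_right, inner_sub_right, h, h']⟩

/-- Testing the equation with `f` itself shows that the real part of `⟨f, g⟩` is the limit energy of
`f`. -/
theorem FriedrichsValue.nonneg (hA : IsPositiveSymmetric ι A) {f g : H}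
    (h : FriedrichsValue ι A f g) : 0 ≤ (inner ℂ f g).re := by
  obtain ⟨⟨e, he⟩, h⟩ := h
  obtain ⟨K, _, _, _, i, j, hK⟩ := hA.exists_formCompletion_one
  obtain ⟨k, rfl, hk⟩ := hK.exists_of_energyLimit he
  have h1 := congrArg Complex.re (hK.inner_of_friedrichsValue (.one _) h k)
  rw [inner_add_right, Complex.add_re] at h1
  have h2 : ‖k‖ ^ 2 = (inner ℂ k k).re := (inner_self_eq_norm_sq (𝕜 := ℂ) _).symm
  have := he.nonneg hA
  linarith

end Friedrichs

/-! ### The abstract Cauchy problem -/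

section Evolution

universe u

variable {D : Type u} [AddCommGroup D] [Module ℂ D]
variable {H : Type*} [NormedAddCommGroup H] [InnerProductSpace ℂ H] [CompleteSpace H]

/-- `u ∈ C([0,T]; H)` solves `u' + A u + V u = 0` on `(0, T]`, for the Friedrichs extension of `A`
and a bounded operator `V`. -/
structure IsEvolution (ι A : D →ₗ[ℂ] H) (T : ℝ) (V : H →L[ℂ] H) (u : ℝ → H) : Prop where
  continuousOn : ContinuousOn u (Icc 0 T)
  equation : ∀ t ∈ Ioc (0 : ℝ) T, ∃ u' Ru : H,
    HasDerivWithinAt u u' (Icc 0 T) t ∧ FriedrichsValue ι A (u t) Ru ∧ u' + Ru + V (u t) = 0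

variable {ι A : D →ₗ[ℂ] H} {T : ℝ} {V : H →L[ℂ] H}

theorem IsEvolution.sub (hA : IsPositiveSymmetric ι A) {u v : ℝ → H}
    (hu : IsEvolution ι A T V u) (hv : IsEvolution ι A T V v) :
    IsEvolution ι A T V fun t => u t - v t := by
  refine ⟨hu.continuousOn.sub hv.continuousOn, fun t ht => ?_⟩
  obtain ⟨u', Ru, h1, h2, h3⟩ := hu.equation t ht
  obtain ⟨v', Rv, g1, g2, g3⟩ := hv.equation t ht
  refine ⟨u' - v', Ru - Rv, h1.sub g1, h2.sub hA g2, ?_⟩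
  rw [map_sub]
  calc u' - v' + (Ru - Rv) + (V (u t) - V (v t))
      = (u' + Ru + V (u t)) - (v' + Rv + V (v t)) := by abel
    _ = 0 := by rw [h3, g3, sub_zero]

theorem abs_re_inner_apply_le {M : ℝ} (hV : ‖V‖ ≤ M) (f : H) :
    |(inner ℂ f (V f)).re| ≤ M * ‖f‖ ^ 2 := by
  calc |(inner ℂ f (V f)).re| ≤ ‖inner ℂ f (V f)‖ := Complex.abs_re_le_norm _
    _ ≤ ‖f‖ * ‖V f‖ := norm_inner_le_norm _ _
    _ ≤ ‖f‖ * (M * ‖f‖) := by gcongr; exact V.le_of_opNorm_le hV f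
    _ = _ := by ring

/-- From the equation, `(‖u‖²)' = -2 Re⟨u, A u⟩ - 2 Re⟨u, V u⟩ ≤ 2 M ‖u‖²`, so `exp (-2 M t) ‖u‖²`
is antitone. Nothing is assumed on how the solution was obtained, hence uniqueness follows. -/
theorem IsEvolution.norm_le (hA : IsPositiveSymmetric ι A) {M : ℝ} (hV : ‖V‖ ≤ M) {u : ℝ → H}
    (hu : IsEvolution ι A T V u) {t : ℝ} (ht : t ∈ Icc 0 T) :
    ‖u t‖ ≤ Real.exp (M * t) * ‖u 0‖ := by
  have hderiv : ∀ s ∈ interior (Icc 0 T), ∃ d ≤ 0,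
      HasDerivAt (fun s => Real.exp (-(2 * M * s)) * ‖u s‖ ^ 2) d s := by
    intro s hs
    rw [interior_Icc] at hs
    obtain ⟨u', Ru, h1, h2, h3⟩ := hu.equation s ⟨hs.1, hs.2.le⟩
    have h4 : HasDerivAt u u' s := h1.hasDerivAt (Icc_mem_nhds hs.1 hs.2)
    have h5 : HasDerivAt (fun s => ‖u s‖ ^ 2) (2 * (inner ℂ (u s) u').re) s := by
      have := (Complex.reCLM.hasFDerivAt.comp_hasDerivAt s (h4.inner ℂ h4))
      refine (this.congr_deriv ?_).congr_of_eventuallyEq (.of_forall fun x => ?_)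
      · have e := congrArg Complex.re (inner_conj_symm (𝕜 := ℂ) u' (u s))
        rw [Complex.conj_re] at e
        simp only [Complex.reCLM_apply, Complex.add_re]
        linarith
      · exact (inner_self_eq_norm_sq (𝕜 := ℂ) (u x)).symm
    have h6 : HasDerivAt (fun s => Real.exp (-(2 * M * s)))
        (Real.exp (-(2 * M * s)) * -(2 * M * 1)) s :=
      (((hasDerivAt_id s).const_mul (2 * M)).neg).exp
    refine ⟨_, ?_, h6.mul h5⟩
    have h7 : u' = -(Ru + V (u s)) := by
      rw [eq_neg_iff_add_eq_zero, ← h3]; abel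
    have h8 := h2.nonneg hA
    have h9 := (abs_le.1 (abs_re_inner_apply_le hV (u s))).1
    have h10 : (inner ℂ (u s) u').re ≤ M * ‖u s‖ ^ 2 := by
      rw [h7, inner_neg_right, inner_add_right, Complex.neg_re, Complex.add_re]
      linarith
    have h11 := Real.exp_pos (-(2 * M * s))
    nlinarith
  have hanti : AntitoneOn (fun s => Real.exp (-(2 * M * s)) * ‖u s‖ ^ 2) (Icc 0 T) := by
    refine antitoneOn_of_deriv_nonpos (convex_Icc 0 T) ?_ ?_ ?_
    · exact (Continuous.continuousOn (by fun_prop)).mul (hu.continuousOn.norm.pow 2)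
    · intro s hs
      obtain ⟨d, -, h⟩ := hderiv s hs
      exact h.differentiableAt.differentiableWithinAt
    · intro s hs
      obtain ⟨d, hd, h⟩ := hderiv s hs
      rwa [h.deriv]
  have h0 : (0 : ℝ) ∈ Icc 0 T := ⟨le_rfl, ht.1.trans ht.2⟩
  have h := hanti h0 ht ht.1
  simp only [mul_zero, neg_zero, Real.exp_zero, one_mul] at h
  refine le_of_sq_le_sq ?_ (by positivity)
  calc ‖u t‖ ^ 2 = Real.exp (2 * M * t) * (Real.exp (-(2 * M * t)) * ‖u t‖ ^ 2) := by
        rw [← mul_assoc, ← Real.exp_add]; simp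
    _ ≤ Real.exp (2 * M * t) * ‖u 0‖ ^ 2 := by gcongr
    _ = (Real.exp (M * t) * ‖u 0‖) ^ 2 := by
        rw [mul_pow, ← Real.exp_nat_mul]; congr 2; push_cast; ring

theorem IsEvolution.eqOn (hA : IsPositiveSymmetric ι A) {u v : ℝ → H}
    (hu : IsEvolution ι A T V u) (hv : IsEvolution ι A T V v) (h0 : u 0 = v 0) :
    EqOn u v (Icc 0 T) := by
  intro t ht
  have h := (hu.sub hA hv).norm_le hA le_rfl ht
  rw [h0, sub_self, norm_zero, mul_zero] at h
  exact sub_eq_zero.1 (norm_le_zero_iff.1 h)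

/-- The solution is the image under `j` of a curve continuous in the form completion. This gives
continuity in energy, and an energy bound without any exponential factor. -/
theorem exists_evolution (hA : IsPositiveSymmetric ι A) (hV : IsSelfAdjoint V) {M : ℝ}
    (hVM : ‖V‖ ≤ M) {u₀ : H} {e₀ : ℝ} (h0 : EnergyLimit ι A u₀ e₀) (T : ℝ) :
    ∃ u : ℝ → H, IsEvolution ι A T V u ∧ u 0 = u₀ ∧
      (∀ t ∈ Icc 0 T, ∃ e, EnergyLimit ι A (u t) e ∧ e ≤ e₀ + M * ‖u₀‖ ^ 2 + M * ‖u t‖ ^ 2) ∧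
      ∀ t ∈ Icc 0 T, ∃ a : ℝ → ℝ, (∀ s, EnergyLimit ι A (u s - u t) (a s)) ∧
        Tendsto a (𝓝[Icc 0 T] t) (𝓝 0) := by
  -- The shift makes `V + c ≥ 1`, as the form completion requires; the factor `exp (c t)` in the
  -- solution undoes it.
  set c : ℝ := M + 1
  set W : H →L[ℂ] H := V + (c : ℂ) • 1 with hWdef
  have hW : IsSelfAdjoint W := by
    refine hV.add ?_
    rw [IsSelfAdjoint, star_smul, star_one]
    simp
  have hWre : ∀ f, (inner ℂ f (W f)).re = (inner ℂ f (V f)).re + c * ‖f‖ ^ 2 := fun f => by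
    have : W f = V f + (c : ℂ) • f := rfl
    rw [this, inner_add_right, inner_smul_right, Complex.add_re, Complex.re_ofReal_mul]
    congr 2
    exact inner_self_eq_norm_sq (𝕜 := ℂ) f
  have hW1 : ∀ f, ‖f‖ ^ 2 ≤ (inner ℂ f (W f)).re := fun f => by
    have := (abs_le.1 (abs_re_inner_apply_le hVM f)).1
    rw [hWre]
    simp only [c]
    linarith
  obtain ⟨K, _, _, _, i, j, hK⟩ := exists_formCompletion hA hW hW1
  obtain ⟨k₀, hk₀, he₀⟩ := hK.exists_of_energyLimit h0
  set S : K →L[ℂ] K := j.adjoint ∘L j with hSdef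
  have hSk : ∀ k, (inner ℂ (S k) k).re = ‖j k‖ ^ 2 := fun k => by
    have : S k = j.adjoint (j k) := rfl
    rw [this, ContinuousLinearMap.adjoint_inner_left]
    exact inner_self_eq_norm_sq (𝕜 := ℂ) (j k)
  have hS : 0 ≤ S :=
    ContinuousLinearMap.nonneg_iff_isPositive _ |>.2 (ContinuousLinearMap.isPositive_adjoint_comp_self j)
  have hinj : ∀ k, S k = 0 → k = 0 := fun k hk => by
    have h1 := hSk k
    rw [hk, inner_zero_left, Complex.zero_re] at h1
    exact hK.injective (norm_eq_zero.1 (pow_eq_zero_iff two_ne_zero |>.1 h1.symm))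
  set w : ℝ → K := fun t => (Real.exp (c * t) : ℂ) • heat S t k₀ with hw
  have hwc : ContinuousOn w (Ici 0) :=
    (Continuous.continuousOn (by fun_prop)).smul (continuousOn_heat hS hinj k₀)
  have hw0 : w 0 = k₀ := by simp [w, heat_zero]
  have hWcont : Continuous fun k : K => ‖k‖ ^ 2 - (inner ℂ (j k) (W (j k))).re :=
    (continuous_norm.pow 2).sub (Complex.continuous_re.comp (by fun_prop))
  refine ⟨fun t => j (w t), ⟨?_, ?_⟩, by simp only [hw0, hk₀], ?_, ?_⟩
  · exact j.continuous.comp_continuousOn (hwc.mono Icc_subset_Ici_self)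
  · intro t ht
    -- Since the flow lies in the range of `S = j* j`, `w t = j* g`, and `friedrichsValue_adjoint`
    -- gives `A (j (w t)) = g - W (j (w t))`.
    set g : H := j ((Real.exp (c * t) : ℂ) • heatDeriv S t k₀) with hg
    have hwg : w t = j.adjoint g := by
      have h1 : heat S t k₀ = S (heatDeriv S t k₀) := by
        rw [← comp_heatDeriv hS ht.1]; rfl
      simp only [w, h1, hg, map_smul]
      rfl
    have hd : HasDerivAt w ((c : ℂ) • w t - (Real.exp (c * t) : ℂ) • heatDeriv S t k₀) t := by
      have h1 : HasDerivAt (fun t => (Real.exp (c * t) : ℂ)) ((Real.exp (c * t) * (c * 1) : ℝ) : ℂ) t :=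
        (((hasDerivAt_id t).const_mul c).exp).ofReal_comp
      have h2 : HasDerivAt (fun t => heat S t k₀) (-(heatDeriv S t k₀)) t := by
        have := ((ContinuousLinearMap.apply ℂ K k₀).restrictScalars ℝ).hasFDerivAt.comp_hasDerivAt t
          (hasDerivAt_heat hS ht.1)
        exact this
      refine (h1.smul h2).congr_deriv ?_
      simp only [w, smul_neg, smul_smul, mul_one, Complex.ofReal_mul]
      rw [mul_comm (c : ℂ), neg_add_eq_sub]
    refine ⟨(c : ℂ) • j (w t) - g, g - W (j (w t)), ?_, ?_, ?_⟩
    · have := (j.restrictScalars ℝ).hasFDerivAt.comp_hasDerivAt t hd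
      refine HasDerivAt.hasDerivWithinAt ?_
      simp only [ContinuousLinearMap.coe_restrictScalars', map_sub, map_smul] at this
      have hgs : g = (Real.exp (c * t) : ℂ) • j (heatDeriv S t k₀) := map_smul j _ _
      rw [hgs]
      exact this
    · rw [hwg]
      exact hK.friedrichsValue_adjoint hW g
    · have : W (j (w t)) = V (j (w t)) + (c : ℂ) • j (w t) := rfl
      rw [this]
      abel
  · intro t ht
    refine ⟨_, hK.energyLimit (w t), ?_⟩
    -- As `⟨S k, k⟩ = ‖j k‖²`, the quantity that does not increase is `‖w‖² - c ‖j w‖²`, which is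
    -- the energy plus `⟨u, V u⟩`. The two potential terms are then bounded by `M ‖u₀‖²` and `M ‖u
    -- t‖²`.
    have h1 := heat_energy_le hS c ht.1 k₀
    change ‖w t‖ ^ 2 - c * (inner ℂ (S (w t)) (w t)).re ≤ _ at h1
    rw [hSk, hSk, hk₀] at h1
    rw [he₀, hWre, hWre]
    have h2 := (abs_le.1 (abs_re_inner_apply_le hVM u₀)).2
    have h3 := (abs_le.1 (abs_re_inner_apply_le hVM (j (w t)))).1
    linarith
  · intro t ht
    refine ⟨_, fun s => by simpa only [map_sub] using hK.energyLimit (w s - w t), ?_⟩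
    have h1 : Tendsto (fun s => w s - w t) (𝓝[Icc 0 T] t) (𝓝 (w t - w t)) :=
      ((hwc t ht.1).mono Icc_subset_Ici_self).sub tendsto_const_nhds
    have h2 := (hWcont.tendsto _).comp h1
    rw [sub_self, map_zero, map_zero, inner_zero_left, norm_zero] at h2
    simpa only [Function.comp_def, map_sub, ne_eq, OfNat.ofNat_ne_zero, not_false_eq_true,
      zero_pow, Complex.zero_re, sub_zero] using h2

end Evolution

/-! ### Invariance of Lebesgue measure under translations and inversion -/

theorem measurePreserving_of_abs_det_fderiv {n : ℕ} (e : (Fin n → ℝ) ≃ₜ (Fin n → ℝ))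
    (he : Differentiable ℝ e) (hdet : ∀ x, |(fderiv ℝ e x).det| = 1) :
    MeasurePreserving e volume volume := by
  refine ⟨e.continuous.measurable, Measure.ext fun s hs => ?_⟩
  have hs' : MeasurableSet (e ⁻¹' s) := e.continuous.measurable hs
  have h := lintegral_abs_det_fderiv_eq_addHaar_image volume hs'
    (fun x _ => (he x).hasFDerivAt.hasFDerivWithinAt) e.injective.injOn
  rw [image_preimage_eq s e.surjective] at h
  rw [Measure.map_apply e.continuous.measurable hs, ← h]
  simp [hdet]

/-- The dilation as a continuous linear map. -/
def dilationCLM {n : ℕ} (w : Fin n → ℕ) (r : ℝ) : (Fin n → ℝ) →L[ℝ] (Fin n → ℝ) :=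
  ContinuousLinearMap.pi fun i => (r ^ w i) • ContinuousLinearMap.proj i

theorem hasFDerivAt_dilation {n : ℕ} (w : Fin n → ℕ) (r : ℝ) (x : Fin n → ℝ) :
    HasFDerivAt (dilation w r) (dilationCLM w r) x :=
  (dilationCLM w r).hasFDerivAt

theorem det_dilationCLM {n : ℕ} (w : Fin n → ℕ) (r : ℝ) :
    (dilationCLM w r).det = r ^ ∑ i, w i := by
  have h : LinearMap.toMatrix' (dilationCLM w r : (Fin n → ℝ) →ₗ[ℝ] (Fin n → ℝ))
      = Matrix.diagonal fun i => r ^ w i := by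
    ext i j
    rw [LinearMap.toMatrix'_apply, Matrix.diagonal_apply]
    change r ^ w i * (Pi.single j 1 : Fin n → ℝ) i = _
    rw [Pi.single_apply]
    split_ifs <;> simp
  rw [ContinuousLinearMap.det, ← LinearMap.det_toMatrix', h, Matrix.det_diagonal,
    Finset.prod_pow_eq_pow_sum]

/-- By the chain rule both differentials are conjugate up to the same invertible diagonal map, whose
determinant cancels. Jacobians of maps intertwined by dilations are thus constant along dilation
orbits. -/
theorem det_fderiv_of_dilation {n : ℕ} {w : Fin n → ℕ} {r : ℝ} (hr : 0 < r)
    {f g : (Fin n → ℝ) → (Fin n → ℝ)} (hf : Differentiable ℝ f) (hg : Differentiable ℝ g)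
    (h : ∀ y, g (dilation w r y) = dilation w r (f y)) (y : Fin n → ℝ) :
    (fderiv ℝ g (dilation w r y)).det = (fderiv ℝ f y).det := by
  have h1 : HasFDerivAt (fun y => g (dilation w r y))
      ((fderiv ℝ g (dilation w r y)).comp (dilationCLM w r)) y :=
    (hg _).hasFDerivAt.comp y (hasFDerivAt_dilation w r y)
  have h2 : HasFDerivAt (fun y => g (dilation w r y))
      ((dilationCLM w r).comp (fderiv ℝ f y)) y := by
    simp_rw [h]
    exact (hasFDerivAt_dilation w r _).comp y (hf y).hasFDerivAt
  have h3 := congrArg ContinuousLinearMap.det (h1.unique h2)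
  simp only [ContinuousLinearMap.det, ContinuousLinearMap.toLinearMap_comp, LinearMap.det_comp] at h3 ⊢
  have h4 : LinearMap.det (dilationCLM w r : (Fin n → ℝ) →ₗ[ℝ] (Fin n → ℝ)) ≠ 0 := by
    have := det_dilationCLM w r
    rw [ContinuousLinearMap.det] at this
    rw [this]
    positivity
  rw [mul_comm] at h3
  exact mul_left_cancel₀ h4 h3

theorem dilation_zero_right {n : ℕ} (w : Fin n → ℕ) (r : ℝ) : dilation w r 0 = 0 := by
  funext i; simp [dilation]

theorem continuous_dilation_left {n : ℕ} (w : Fin n → ℕ) (x : Fin n → ℝ) :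
    Continuous fun r => dilation w r x := by
  unfold dilation
  fun_prop

theorem continuous_dilation_uncurry {n : ℕ} (w : Fin n → ℕ) :
    Continuous fun p : ℝ × (Fin n → ℝ) => dilation w p.1 p.2 := by
  unfold dilation
  fun_prop

namespace GradedLieGroup

variable {n : ℕ} (G : GradedLieGroup n)

theorem dilation_zero_left (x : Fin n → ℝ) : dilation G.weight 0 x = 0 := by
  funext i; simp [dilation, (G.weight_pos i).ne']

theorem inv_mul_mul (x y : Fin n → ℝ) : G.mul (G.inv x) (G.mul x y) = y := by
  rw [← G.mul_assoc, G.inv_mul, G.zero_mul]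

theorem mul_inv_mul (x y : Fin n → ℝ) : G.mul x (G.mul (G.inv x) y) = y := by
  rw [← G.mul_assoc, G.mul_inv, G.zero_mul]

theorem mul_mul_inv (x y : Fin n → ℝ) : G.mul (G.mul x y) (G.inv y) = x := by
  rw [G.mul_assoc, G.mul_inv, G.mul_zero]

theorem mul_inv_mul_right (x y : Fin n → ℝ) : G.mul (G.mul x (G.inv y)) y = x := by
  rw [G.mul_assoc, G.inv_mul, G.mul_zero]

theorem eq_inv_of_mul_eq_zero {x y : Fin n → ℝ} (h : G.mul x y = 0) : x = G.inv y := by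
  rw [← G.mul_mul_inv x y, h, G.zero_mul]

theorem inv_inv (x : Fin n → ℝ) : G.inv (G.inv x) = x :=
  (G.eq_inv_of_mul_eq_zero (G.mul_inv x)).symm

theorem inv_mul_rev (x y : Fin n → ℝ) : G.inv (G.mul x y) = G.mul (G.inv y) (G.inv x) :=
  (G.eq_inv_of_mul_eq_zero (by rw [G.mul_assoc, G.inv_mul_mul, G.inv_mul])).symm

theorem dilation_inv {r : ℝ} (hr : 0 < r) (x : Fin n → ℝ) :
    dilation G.weight r (G.inv x) = G.inv (dilation G.weight r x) :=
  G.eq_inv_of_mul_eq_zero (by rw [← G.dilation_mul r hr, G.inv_mul, dilation_zero_right])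

theorem continuous_mul : Continuous fun p : (Fin n → ℝ) × (Fin n → ℝ) => G.mul p.1 p.2 :=
  G.contDiff_mul.continuous

theorem continuous_inv : Continuous G.inv := G.contDiff_inv.continuous

theorem contDiff_mul_left (x : Fin n → ℝ) : ContDiff ℝ ∞ (G.mul x) :=
  G.contDiff_mul.comp (contDiff_const.prodMk contDiff_id)

theorem contDiff_mul_right (x : Fin n → ℝ) : ContDiff ℝ ∞ fun y => G.mul y x :=
  G.contDiff_mul.comp (contDiff_id.prodMk contDiff_const)

/-- Left translation. -/
def mulLeft (x : Fin n → ℝ) : (Fin n → ℝ) ≃ₜ (Fin n → ℝ) where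
  toFun := G.mul x
  invFun := G.mul (G.inv x)
  left_inv := G.inv_mul_mul x
  right_inv := G.mul_inv_mul x
  continuous_toFun := (G.contDiff_mul_left x).continuous
  continuous_invFun := (G.contDiff_mul_left _).continuous

/-- Right translation. -/
def mulRight (x : Fin n → ℝ) : (Fin n → ℝ) ≃ₜ (Fin n → ℝ) where
  toFun := fun y => G.mul y x
  invFun := fun y => G.mul y (G.inv x)
  left_inv := fun y => G.mul_mul_inv y x
  right_inv := fun y => G.mul_inv_mul_right y x
  continuous_toFun := (G.contDiff_mul_right x).continuous
  continuous_invFun := (G.contDiff_mul_right _).continuous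

/-- Inversion. -/
def invHomeo : (Fin n → ℝ) ≃ₜ (Fin n → ℝ) where
  toFun := G.inv
  invFun := G.inv
  left_inv := G.inv_inv
  right_inv := G.inv_inv
  continuous_toFun := G.continuous_inv
  continuous_invFun := G.continuous_inv

/-- Dilating by `r → 0` contracts every point to the unit, so a continuous dilation-invariant
quantity may be evaluated at the unit. -/
theorem eq_of_dilation_invariant {X : Type*} [TopologicalSpace X] [T2Space X] {F : ℝ → X}
    (hF : Continuous F) (h : ∀ r, 0 < r → F r = F 1) : F 1 = F 0 := by
  have h1 : Tendsto F (𝓝[>] 0) (𝓝 (F 0)) := (hF.tendsto 0).mono_left nhdsWithin_le_nhds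
  have h2 : Tendsto F (𝓝[>] 0) (𝓝 (F 1)) :=
    tendsto_const_nhds.congr' (by filter_upwards [self_mem_nhdsWithin] with r hr using (h r hr).symm)
  exact tendsto_nhds_unique h2 h1

theorem dilation_one (x : Fin n → ℝ) : dilation G.weight 1 x = x := by
  funext i; simp [dilation]

theorem continuous_det_fderiv {P : Type*} [NormedAddCommGroup P] [NormedSpace ℝ P]
    {f : P → (Fin n → ℝ) → (Fin n → ℝ)} (hf : ContDiff ℝ ∞ (Function.uncurry f))
    {p : ℝ → P} (hp : Continuous p) {y : ℝ → (Fin n → ℝ)} (hy : Continuous y) :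
    Continuous fun r => (fderiv ℝ (f (p r)) (y r)).det := by
  have h : ContDiff ℝ 0 fun q : P × (Fin n → ℝ) => fderiv ℝ (f q.1) q.2 :=
    ContDiff.fderiv (m := ∞) (f := fun (q : P × (Fin n → ℝ)) => f q.1)
      (hf.comp (contDiff_fst.fst.prodMk contDiff_snd)) contDiff_snd (by simp)
  exact ContinuousLinearMap.continuous_det.comp (h.continuous.comp (hp.prodMk hy))

/-- The Jacobian at `(x, y)` equals the one at `(D_r x, D_r y)`; letting `r → 0` gives the Jacobian
of translation by the unit. -/
theorem det_fderiv_mul_left (x y : Fin n → ℝ) : (fderiv ℝ (G.mul x) y).det = 1 := by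
  have hd : ∀ x, Differentiable ℝ (G.mul x) := fun x =>
    (G.contDiff_mul_left x).differentiable (by simp)
  have h := eq_of_dilation_invariant (F := fun r =>
      (fderiv ℝ (G.mul (dilation G.weight r x)) (dilation G.weight r y)).det)
    (continuous_det_fderiv G.contDiff_mul (continuous_dilation_left _ x)
      (continuous_dilation_left _ y)) fun r hr => by
        rw [det_fderiv_of_dilation hr (hd x) (hd _) (fun y => (G.dilation_mul r hr x y).symm),
          G.dilation_one, G.dilation_one]
  simp only [dilation_one, dilation_zero_left] at h
  have h0 : G.mul 0 = id := funext G.zero_mul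
  rw [h, h0, fderiv_id]
  simp [ContinuousLinearMap.det]

/-- Dilations reduce this to the unit, a fixed point of inversion, where the differential is an
involution and so has determinant `±1`. -/
theorem abs_det_fderiv_inv (y : Fin n → ℝ) : |(fderiv ℝ G.inv y).det| = 1 := by
  have hd : Differentiable ℝ G.inv := G.contDiff_inv.differentiable (by simp)
  have hc : ContDiff ℝ ∞ (Function.uncurry fun (_ : ℝ) y => G.inv y) :=
    G.contDiff_inv.comp contDiff_snd
  have h := eq_of_dilation_invariant (F := fun r =>
      (fderiv ℝ G.inv (dilation G.weight r y)).det)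
    (continuous_det_fderiv hc continuous_id (continuous_dilation_left _ y)) fun r hr => by
        rw [det_fderiv_of_dilation hr hd hd (fun y => (G.dilation_inv hr y).symm), G.dilation_one]
  simp only [dilation_one, dilation_zero_left] at h
  have h0 : G.inv 0 = 0 := (G.eq_inv_of_mul_eq_zero (G.zero_mul 0)).symm
  have h1 : HasFDerivAt (fun y => G.inv (G.inv y))
      ((fderiv ℝ G.inv 0).comp (fderiv ℝ G.inv 0)) 0 := by
    have h2 := (hd 0).hasFDerivAt
    exact HasFDerivAt.comp (g := G.inv) 0 (by rw [h0]; exact h2) h2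
  have h2 : (fun y => G.inv (G.inv y)) = id := funext G.inv_inv
  rw [h2] at h1
  have h3 := congrArg ContinuousLinearMap.det (h1.unique (hasFDerivAt_id 0))
  have h4 : (fderiv ℝ G.inv 0).det * (fderiv ℝ G.inv 0).det = 1 := by
    rw [ContinuousLinearMap.det, ContinuousLinearMap.toLinearMap_comp, LinearMap.det_comp] at h3
    refine h3.trans ?_
    simp [ContinuousLinearMap.det]
  rw [h]
  rcases mul_self_eq_one_iff.1 h4 with h5 | h5 <;> simp [h5]

theorem measurePreserving_mul_left (x : Fin n → ℝ) : MeasurePreserving (G.mul x) volume volume :=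
  measurePreserving_of_abs_det_fderiv (G.mulLeft x)
    ((G.contDiff_mul_left x).differentiable (by simp))
    fun y => by
      have := G.det_fderiv_mul_left x y
      exact (congrArg abs this).trans abs_one

theorem measurePreserving_inv : MeasurePreserving G.inv volume volume :=
  measurePreserving_of_abs_det_fderiv G.invHomeo (G.contDiff_inv.differentiable (by simp))
    G.abs_det_fderiv_inv

theorem integral_mul_left {E : Type*} [NormedAddCommGroup E] [NormedSpace ℝ E] (x : Fin n → ℝ)
    (f : (Fin n → ℝ) → E) : ∫ y, f (G.mul x y) = ∫ y, f y :=
  (G.measurePreserving_mul_left x).integral_comp (G.mulLeft x).measurableEmbedding f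

theorem integral_inv {E : Type*} [NormedAddCommGroup E] [NormedSpace ℝ E]
    (f : (Fin n → ℝ) → E) : ∫ y, f (G.inv y) = ∫ y, f y :=
  G.measurePreserving_inv.integral_comp G.invHomeo.measurableEmbedding f

end GradedLieGroup

theorem integral_comp_dilation {n : ℕ} (w : Fin n → ℕ) {r : ℝ} (hr : 0 < r)
    {E : Type*} [NormedAddCommGroup E] [NormedSpace ℝ E] (f : (Fin n → ℝ) → E) :
    ∫ y, f (dilation w r y) = (r ^ ∑ i, w i)⁻¹ • ∫ y, f y := by
  have h := det_dilationCLM w r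
  rw [ContinuousLinearMap.det] at h
  have h0 : LinearMap.det (dilationCLM w r : (Fin n → ℝ) →ₗ[ℝ] (Fin n → ℝ)) ≠ 0 := by
    rw [h]; positivity
  have h1 := Measure.map_linearMap_addHaar_eq_smul_addHaar volume h0
  have hinj : Function.Injective (dilation w r) := fun x y hxy => by
    have h2 := congrArg (dilation w r⁻¹) hxy
    have h3 : ∀ x, dilation w r⁻¹ (dilation w r x) = x := fun x => by
      simpa using GradedLieGroup.dilation_dilation_inv w (inv_pos.2 hr) x
    rwa [h3, h3] at h2
  have hemb : MeasurableEmbedding (dilation w r) :=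
    (GradedLieGroup.dilation_continuous w r).measurableEmbedding hinj
  have h4 := hemb.integral_map (μ := volume) f
  rw [← h4]
  have h5 : Measure.map (dilation w r) volume
      = ENNReal.ofReal |(LinearMap.det (dilationCLM w r : (Fin n → ℝ) →ₗ[ℝ] (Fin n → ℝ)))⁻¹|
        • (volume : Measure (Fin n → ℝ)) := h1
  rw [h5, integral_smul_measure, h, abs_of_pos (by positivity),
    ENNReal.toReal_ofReal (by positivity)]

/-! ### Parametric integrals of smooth functions -/

section Parametric

variable {X Y E : Type} [NormedAddCommGroup X] [NormedSpace ℝ X] [FiniteDimensional ℝ X]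
  [NormedAddCommGroup Y] [NormedSpace ℝ Y] [FiniteDimensional ℝ Y]
  [NormedAddCommGroup E] [NormedSpace ℝ E]

theorem contDiff_fderiv_right {Φ : X → Y → E} (hΦ : ContDiff ℝ ∞ (Function.uncurry Φ)) :
    ContDiff ℝ ∞ (Function.uncurry fun x y => fderiv ℝ (Φ x) y) :=
  ContDiff.fderiv (m := ∞) (f := fun (q : X × Y) => Φ q.1)
    (hΦ.comp (contDiff_fst.fst.prodMk contDiff_snd)) contDiff_snd (by simp)

theorem contDiff_iteratedFDeriv_right {Φ : X → Y → E} (hΦ : ContDiff ℝ ∞ (Function.uncurry Φ))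
    (i : ℕ) : ContDiff ℝ ∞ (Function.uncurry fun x y => iteratedFDeriv ℝ i (Φ x) y) := by
  induction i with
  | zero =>
    simp only [iteratedFDeriv_zero_eq_comp]
    exact (LinearIsometryEquiv.contDiff _).comp hΦ
  | succ i ih =>
    simp only [iteratedFDeriv_succ_eq_comp_left]
    exact (LinearIsometryEquiv.contDiff _).comp (contDiff_fderiv_right ih)

theorem fderiv_eq_zero_of_forall {Φ : X → Y → E} {K : Set X} (h0 : ∀ x ∉ K, ∀ y, Φ x y = 0) :
    ∀ x ∉ K, ∀ y, fderiv ℝ (Φ x) y = 0 := fun x hx y => by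
  have : Φ x = fun _ => 0 := funext fun y => h0 x hx y
  rw [this]
  simp

theorem iteratedFDeriv_eq_zero_of_forall {Φ : X → Y → E} {K : Set X}
    (h0 : ∀ x ∉ K, ∀ y, Φ x y = 0) (i : ℕ) :
    ∀ x ∉ K, ∀ y, iteratedFDeriv ℝ i (Φ x) y = 0 := fun x hx y => by
  have : Φ x = 0 := funext fun y => h0 x hx y
  rw [this]
  simp

variable [MeasurableSpace X] [BorelSpace X] {μ : Measure X} [IsLocallyFiniteMeasure μ]

theorem continuous_integral_of_compact {Φ : X → Y → E} (hΦ : Continuous (Function.uncurry Φ))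
    {K : Set X} (hK : IsCompact K) (h0 : ∀ x ∉ K, ∀ y, Φ x y = 0) :
    Continuous fun y => ∫ x, Φ x y ∂μ := by
  have h := continuous_parametric_integral_of_continuous (μ := μ) (f := fun y x => Φ x y)
    (hΦ.comp continuous_swap) hK
  refine h.congr fun y => ?_
  exact setIntegral_eq_integral_of_forall_compl_eq_zero fun x hx => h0 x hx y

theorem hasFDerivAt_integral_of_compact {Φ : X → Y → E}
    (hΦ : ContDiff ℝ ∞ (Function.uncurry Φ))
    {K : Set X} (hK : IsCompact K) (h0 : ∀ x ∉ K, ∀ y, Φ x y = 0) (y₀ : Y) :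
    HasFDerivAt (fun y => ∫ x, Φ x y ∂μ) (∫ x, fderiv ℝ (Φ x) y₀ ∂μ) y₀ := by
  have hc : ∀ y, Continuous fun x => Φ x y := fun y =>
    hΦ.continuous.comp (continuous_id.prodMk continuous_const)
  have hs : ∀ y, HasCompactSupport fun x => Φ x y := fun y =>
    HasCompactSupport.intro hK fun x hx => h0 x hx y
  have hd := (contDiff_fderiv_right hΦ).continuous
  have hB := (isCompact_closedBall y₀ 1)
  obtain ⟨C, hC⟩ := ((hK.prod hB).bddAbove_image hd.norm.continuousOn)
  have hdiff : ∀ x, Differentiable ℝ (Φ x) := fun x =>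
    (hΦ.comp (contDiff_const.prodMk contDiff_id)).differentiable (by simp)
  have hd0 : ∀ x ∉ K, ∀ y, fderiv ℝ (Φ x) y = 0 := fun x hx y => by
    have : Φ x = fun _ => 0 := funext fun y => h0 x hx y
    rw [this]
    simp
  refine hasFDerivAt_integral_of_dominated_of_fderiv_le (𝕜 := ℝ)
    (F := fun y x => Φ x y) (F' := fun y x => fderiv ℝ (Φ x) y) (bound := K.indicator fun _ => C)
    (Metric.closedBall_mem_nhds y₀ one_pos)
    (.of_forall fun y => (hc y).aestronglyMeasurable)
    ((hc y₀).integrable_of_hasCompactSupport (μ := μ) (hs y₀)) ?_ ?_ ?_ ?_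
  · exact (hd.comp (continuous_id.prodMk continuous_const)).aestronglyMeasurable
  · refine .of_forall fun x y hy => ?_
    by_cases hx : x ∈ K
    · rw [indicator_of_mem hx]
      exact hC ⟨(x, y), ⟨hx, hy⟩, rfl⟩
    · rw [indicator_of_notMem hx, hd0 x hx, norm_zero]
  · exact (integrable_indicator_iff hK.measurableSet).2 (integrableOn_const hK.measure_ne_top)
  · exact .of_forall fun x y _ => (hdiff x y).hasFDerivAt

/-- The codomain is quantified inside the induction because each differentiation under the integral
replaces `E` by `Y →L[ℝ] E`. -/
theorem contDiff_nat_integral_of_compact {K : Set X} (hK : IsCompact K) (m : ℕ) :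
    ∀ {E : Type} [NormedAddCommGroup E] [NormedSpace ℝ E] {Φ : X → Y → E},
      ContDiff ℝ ∞ (Function.uncurry Φ) → (∀ x ∉ K, ∀ y, Φ x y = 0) →
      ContDiff ℝ m (fun y => ∫ x, Φ x y ∂μ) := by
  induction m with
  | zero =>
    intro E _ _ Φ hΦ h0
    exact contDiff_zero.2 (continuous_integral_of_compact hΦ.continuous hK h0)
  | succ m ih =>
    intro E _ _ Φ hΦ h0
    have hd := hasFDerivAt_integral_of_compact (μ := μ) hΦ hK h0
    rw [show ((m + 1 : ℕ) : WithTop ℕ∞) = (m : WithTop ℕ∞) + 1 by push_cast; rfl,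
      contDiff_succ_iff_fderiv]
    refine ⟨fun y => (hd y).differentiableAt, by simp, ?_⟩
    have : (fderiv ℝ fun y => ∫ x, Φ x y ∂μ) = fun y => ∫ x, fderiv ℝ (Φ x) y ∂μ :=
      funext fun y => (hd y).fderiv
    rw [this]
    exact ih (contDiff_fderiv_right hΦ) (fderiv_eq_zero_of_forall h0)

theorem contDiff_integral_of_compact {Φ : X → Y → E} (hΦ : ContDiff ℝ ∞ (Function.uncurry Φ))
    {K : Set X} (hK : IsCompact K) (h0 : ∀ x ∉ K, ∀ y, Φ x y = 0) :
    ContDiff ℝ ∞ (fun y => ∫ x, Φ x y ∂μ) :=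
  contDiff_infty.2 fun m => contDiff_nat_integral_of_compact hK m hΦ h0

theorem iteratedFDeriv_integral_of_compact [CompleteSpace E] {Φ : X → Y → E}
    (hΦ : ContDiff ℝ ∞ (Function.uncurry Φ))
    {K : Set X} (hK : IsCompact K) (h0 : ∀ x ∉ K, ∀ y, Φ x y = 0) (i : ℕ) (y : Y) :
    iteratedFDeriv ℝ i (fun y => ∫ x, Φ x y ∂μ) y = ∫ x, iteratedFDeriv ℝ i (Φ x) y ∂μ := by
  induction i generalizing y with
  | zero =>
    simp only [iteratedFDeriv_zero_eq_comp, Function.comp_apply]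
    exact ((continuousMultilinearCurryFin0 ℝ Y E).symm.toContinuousLinearEquiv.integral_comp_comm
      _).symm
  | succ i ih =>
    have h1 : iteratedFDeriv ℝ i (fun y => ∫ x, Φ x y ∂μ)
        = fun y => ∫ x, iteratedFDeriv ℝ i (Φ x) y ∂μ := funext ih
    simp only [iteratedFDeriv_succ_eq_comp_left, Function.comp_apply]
    rw [h1, (hasFDerivAt_integral_of_compact (contDiff_iteratedFDeriv_right hΦ i) hK
      (iteratedFDeriv_eq_zero_of_forall h0 i) y).fderiv]
    let e : (Y →L[ℝ] (Y [×i]→L[ℝ] E)) ≃L[ℝ] (Y [×(i + 1)]→L[ℝ] E) :=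
      (continuousMultilinearCurryLeftEquiv ℝ (fun _ : Fin (i + 1) => Y) E).symm
    exact (ContinuousLinearEquiv.integral_comp_comm (𝕜 := ℝ) (μ := μ) e
      fun x => fderiv ℝ (iteratedFDeriv ℝ i (Φ x)) y).symm

end Parametric

/-! ### Distributions applied to smooth families of test functions -/

section Families

open TopologicalSpace
open scoped BoundedContinuousFunction

/-- Joint continuity becomes uniform in `y` over the compact set, by the tube lemma; off it all
functions vanish. -/
theorem continuous_bcf_of_compact {X Y E : Type} [TopologicalSpace X] [TopologicalSpace Y]
    [PseudoMetricSpace E] [Zero E] {g : X → Y →ᵇ E}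
    (hg : Continuous fun p : X × Y => g p.1 p.2) {K : Set Y} (hK : IsCompact K)
    (h0 : ∀ x, ∀ y ∉ K, g x y = 0) : Continuous g := by
  rw [continuous_iff_continuousAt]
  intro x₀
  rw [ContinuousAt, BoundedContinuousFunction.tendsto_iff_tendstoUniformly,
    Metric.tendstoUniformly_iff]
  intro ε hε
  have h := hK.eventually_forall_of_forall_eventually (x₀ := x₀)
    (P := fun x y => dist (g x₀ y) (g x y) < ε) fun y _ => by
      have hc : Continuous fun p : X × Y => dist (g x₀ p.2) (g p.1 p.2) :=
        ((g x₀).continuous.comp continuous_snd).dist hg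
      exact (hc.tendsto (x₀, y)).eventually_lt_const (by simpa using hε)
  filter_upwards [h] with x hx y
  by_cases hy : y ∈ K
  · exact hx y hy
  · rw [h0 x y hy, h0 x₀ y hy, dist_self]
    exact hε

/-- The family is Bochner integrable in the space of bounded continuous functions. Evaluations
identify its integral with `J`, and `ℓ` commutes with the integral. -/
theorem integral_clm_bcf {X Y E F : Type} [TopologicalSpace X] [T2Space X] [MeasurableSpace X]
    [OpensMeasurableSpace X] {μ : Measure X} [IsFiniteMeasureOnCompacts μ] [TopologicalSpace Y]
    [NormedAddCommGroup E] [NormedSpace ℝ E] [CompleteSpace E] [NormedAddCommGroup F]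
    [NormedSpace ℝ F] [CompleteSpace F] (ℓ : (Y →ᵇ E) →L[ℝ] F) {g : X → Y →ᵇ E} (hg : Continuous g)
    {L : Set X} (hL : IsCompact L) (h0 : ∀ x ∉ L, ∀ y, g x y = 0) {J : Y →ᵇ E}
    (hJ : ∀ y, J y = ∫ x, g x y ∂μ) :
    Integrable (fun x => ℓ (g x)) μ ∧ ∫ x, ℓ (g x) ∂μ = ℓ J := by
  have hi : Integrable g μ := hg.integrable_of_hasCompactSupport
    (HasCompactSupport.intro hL fun x hx => BoundedContinuousFunction.ext (h0 x hx))
  refine ⟨ℓ.integrable_comp hi, ?_⟩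
  rw [ContinuousLinearMap.integral_comp_comm ℓ hi]
  congr 1
  ext1 y
  rw [hJ]
  exact (ContinuousLinearMap.integral_comp_comm (BoundedContinuousFunction.evalCLM ℝ y) hi).symm


/-- A map bounded by finitely many seminorms descends to the range of `(J i)` in the product of
normed spaces, and extends from there by Hahn–Banach since `F` is finite-dimensional. -/
theorem exists_clm_of_bound {D ι F : Type} [Fintype ι] [DecidableEq ι] {E : ι → Type}
    [AddCommGroup D] [Module ℝ D] [∀ i, NormedAddCommGroup (E i)] [∀ i, NormedSpace ℝ (E i)]
    [NormedAddCommGroup F] [NormedSpace ℝ F] [FiniteDimensional ℝ F] (f : D →ₗ[ℝ] F)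
    (J : ∀ i, D →ₗ[ℝ] E i) {C : ℝ}
    (hC : ∀ φ, ∀ B : ℝ, 0 ≤ B → (∀ i, ‖J i φ‖ ≤ B) → ‖f φ‖ ≤ C * B) :
    ∃ ℓ : ∀ i, E i →L[ℝ] F, ∀ φ, f φ = ∑ i, ℓ i (J i φ) := by
  have hb : ∃ C : ℝ, ∀ φ, ‖f φ‖ ≤ C * ‖LinearMap.pi J φ‖ :=
    ⟨C, fun φ => hC φ _ (norm_nonneg _) fun i => norm_le_pi_norm (LinearMap.pi J φ) i⟩
  obtain ⟨ℓ, hℓ⟩ := (f.compLeftInverse (LinearMap.pi J)).exist_extension_of_finiteDimensional_range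
  refine ⟨fun i => ℓ.comp (ContinuousLinearMap.single ℝ E i), fun φ => ?_⟩
  have h1 := f.compLeftInverse_apply_of_bdd (LinearMap.pi J) hb φ _ rfl
  rw [hℓ] at h1
  refine h1.symm.trans ?_
  simp only [ContinuousLinearMap.comp_apply]
  rw [← map_sum]
  congr 1
  exact (LinearMap.sum_single_apply (φ := E) (LinearMap.pi J φ)).symm

variable {n : ℕ} {F : Type} [NormedAddCommGroup F] [NormedSpace ℝ F] [FiniteDimensional ℝ F]

/-- A distribution has finite order on each compact set: there it is a continuous functional of
finitely many derivatives. -/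
theorem exists_factorization (v : Distr n F) (K : Compacts (Fin n → ℝ)) :
    ∃ (s : Finset ℕ) (ℓ : ∀ i : s, ((Fin n → ℝ) →ᵇ ((Fin n → ℝ) [×i.1]→L[ℝ] ℝ)) →L[ℝ] F),
      ∀ f : 𝓓_{K}(Fin n → ℝ, ℝ),
        v (TestFunction.ofSupportedIn (Ω := ⊤) (fun _ _ => trivial) f) =
          ∑ i : s, ℓ i (ContDiffMapSupportedIn.structureMapCLM ℝ ⊤ i.1 f) := by
  set f : 𝓓_{K}(Fin n → ℝ, ℝ) →ₗ[ℝ] F :=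
    { toFun := fun φ => v (TestFunction.ofSupportedIn (Ω := ⊤) (fun _ _ => trivial) φ)
      map_add' := fun φ ψ => map_add v
        (TestFunction.ofSupportedIn (Ω := ⊤) (fun _ _ => trivial) φ)
        (TestFunction.ofSupportedIn (Ω := ⊤) (fun _ _ => trivial) ψ)
      map_smul' := fun c φ => map_smul v c
        (TestFunction.ofSupportedIn (Ω := ⊤) (fun _ _ => trivial) φ) } with hf
  have hfc : Continuous f := v.continuous.comp (TestFunction.continuous_ofSupportedIn _)
  obtain ⟨s, C, -, hC⟩ := Seminorm.bound_of_continuous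
    (ContDiffMapSupportedIn.withSeminorms ℝ (Fin n → ℝ) ℝ ⊤ K)
    ((normSeminorm ℝ F).comp f) (continuous_norm.comp hfc)
  obtain ⟨ℓ, hℓ⟩ := exists_clm_of_bound (E := fun i : s =>
      (Fin n → ℝ) →ᵇ ((Fin n → ℝ) [×i.1]→L[ℝ] ℝ)) f
    (fun i : s => (ContDiffMapSupportedIn.structureMapCLM ℝ ⊤ i.1 :
      𝓓_{K}(Fin n → ℝ, ℝ) →L[ℝ] ((Fin n → ℝ) →ᵇ ((Fin n → ℝ) [×i.1]→L[ℝ] ℝ))).toLinearMap)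
    (C := C) fun φ B hB hφ => (hC φ).trans (by
      rw [smul_apply, NNReal.smul_def, smul_eq_mul]
      gcongr
      exact Seminorm.finset_sup_apply_le hB fun i hi =>
        le_of_eq_of_le (by rfl) (hφ ⟨i, hi⟩))
  exact ⟨s, ℓ, hℓ⟩

variable {X : Type} [NormedAddCommGroup X] [NormedSpace ℝ X] [FiniteDimensional ℝ X]

theorem iteratedFDeriv_zero_of_notMem {φ : (Fin n → ℝ) → ℝ} {K : Set (Fin n → ℝ)} (hK : IsCompact K)
    (h0 : ∀ y ∉ K, φ y = 0) (i : ℕ) {y : Fin n → ℝ} (hy : y ∉ K) : iteratedFDeriv ℝ i φ y = 0 := by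
  by_contra h
  have h1 : Function.support φ ⊆ K := fun z hz => by
    by_contra hzK
    exact hz (h0 z hzK)
  exact hy (closure_minimal h1 hK.isClosed (support_iteratedFDeriv_subset i h))

/-- A smooth family of test functions supported in a fixed compact set. -/
structure IsTestFamily (Φ : X → Test n ℝ) (K : Set (Fin n → ℝ)) : Prop where
  isCompact : IsCompact K
  contDiff : ContDiff ℝ ∞ (Function.uncurry fun x y => Φ x y)
  eq_zero : ∀ x, ∀ y ∉ K, Φ x y = 0

namespace IsTestFamily

variable {Φ : X → Test n ℝ} {K : Set (Fin n → ℝ)}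

/-- The members of the family, in the space of functions supported in `K`. -/
def supported (h : IsTestFamily Φ K) (x : X) : 𝓓_{(⟨K, h.isCompact⟩ : Compacts _)}(Fin n → ℝ, ℝ) :=
  .of_support_subset (Φ x).contDiff fun y hy => by
    by_contra hyK
    exact hy (h.eq_zero x y hyK)

theorem ofSupportedIn_supported (h : IsTestFamily Φ K) (x : X) :
    TestFunction.ofSupportedIn (Ω := ⊤) (fun _ _ => trivial) (h.supported x) = Φ x := rfl

theorem structureMap_apply (h : IsTestFamily Φ K) (i : ℕ) (x : X) (y : Fin n → ℝ) :
    ContDiffMapSupportedIn.structureMapCLM ℝ ⊤ i (h.supported x) y = iteratedFDeriv ℝ i (Φ x) y := by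
  rw [ContDiffMapSupportedIn.structureMapCLM_top_apply]
  rfl

theorem continuous_structureMap (h : IsTestFamily Φ K) (i : ℕ) :
    Continuous fun x => ContDiffMapSupportedIn.structureMapCLM ℝ ⊤ i (h.supported x) := by
  refine continuous_bcf_of_compact ?_ h.isCompact fun x y hy => ?_
  · simp_rw [h.structureMap_apply]
    exact (contDiff_iteratedFDeriv_right h.contDiff i).continuous
  · rw [h.structureMap_apply]
    exact iteratedFDeriv_zero_of_notMem h.isCompact (h.eq_zero x) i hy

theorem continuous_apply (h : IsTestFamily Φ K) (v : Distr n F) : Continuous fun x => v (Φ x) := by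
  obtain ⟨s, ℓ, hℓ⟩ := exists_factorization v ⟨K, h.isCompact⟩
  simp_rw [← h.ofSupportedIn_supported, hℓ]
  exact continuous_finsetSum _ fun i _ => (ℓ i).continuous.comp (h.continuous_structureMap i.1)

variable [MeasurableSpace X] [BorelSpace X] {μ : Measure X} [IsLocallyFiniteMeasure μ] {L : Set X}

/-- A distribution commutes with the integration of a compactly supported family. -/
theorem apply_integral (h : IsTestFamily Φ K) (hL : IsCompact L)
    (hL0 : ∀ x ∉ L, ∀ y, Φ x y = 0) (v : Distr n F) {I : Test n ℝ}
    (hI : ∀ y, I y = ∫ x, Φ x y ∂μ) : v I = ∫ x, v (Φ x) ∂μ := by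
  obtain ⟨s, ℓ, hℓ⟩ := exists_factorization v ⟨K, h.isCompact⟩
  have hIK : ∀ y ∉ K, I y = 0 := fun y hy => by
    rw [hI]
    simp [h.eq_zero _ y hy]
  have hIfam : IsTestFamily (fun _ : X => I) K :=
    ⟨h.isCompact, I.contDiff.comp contDiff_snd, fun _ => hIK⟩
  have h2 := hℓ (hIfam.supported 0)
  rw [hIfam.ofSupportedIn_supported] at h2
  have h3 : ∀ x, v (Φ x) = ∑ i : s, ℓ i
      (ContDiffMapSupportedIn.structureMapCLM ℝ ⊤ i.1 (h.supported x)) := fun x =>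
    hℓ (h.supported x)
  have := FiniteDimensional.complete ℝ F
  have h4 : (I : (Fin n → ℝ) → ℝ) = fun y => ∫ x, Φ x y ∂μ := funext hI
  have h5 : ∀ i : s, _ := fun i => integral_clm_bcf (μ := μ) (ℓ i) (h.continuous_structureMap i.1) hL
    (J := ContDiffMapSupportedIn.structureMapCLM ℝ ⊤ i.1 (hIfam.supported 0))
    (fun x hx y => by
      rw [h.structureMap_apply]
      have : (Φ x : (Fin n → ℝ) → ℝ) = 0 := funext fun y => hL0 x hx y
      rw [this]
      simp)
    (fun y => by
      simp_rw [hIfam.structureMap_apply, h.structureMap_apply, h4]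
      exact iteratedFDeriv_integral_of_compact h.contDiff hL hL0 i.1 y)
  simp_rw [h2, h3]
  rw [integral_finsetSum _ fun i _ => (h5 i).1]
  exact Finset.sum_congr rfl fun i _ => (h5 i).2.symm

end IsTestFamily

end Families

/-! ### Left-invariant operators on test functions -/

/-- A smooth function vanishing outside a compact set, as a test function. -/
def testOfCompact {n : ℕ} {F : Type} [NormedAddCommGroup F] [NormedSpace ℝ F]
    (f : (Fin n → ℝ) → F) (hf : ContDiff ℝ ∞ f) {K : Set (Fin n → ℝ)} (hK : IsCompact K)
    (h0 : ∀ x ∉ K, f x = 0) : Test n F where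
  toFun := f
  contDiff' := hf
  hasCompactSupport' := HasCompactSupport.intro hK h0
  tsupport_subset' := fun _ _ => trivial

@[simp]
theorem testOfCompact_apply {n : ℕ} {F : Type} [NormedAddCommGroup F] [NormedSpace ℝ F]
    (f : (Fin n → ℝ) → F) (hf : ContDiff ℝ ∞ f) {K : Set (Fin n → ℝ)} (hK : IsCompact K)
    (h0 : ∀ x ∉ K, f x = 0) (x : Fin n → ℝ) : testOfCompact f hf hK h0 x = f x := rfl

theorem memLp_test {n : ℕ} {F : Type} [NormedAddCommGroup F] [NormedSpace ℝ F] (φ : Test n F)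
    (p : ℝ≥0∞) : MemLp φ p (volume : Measure (Fin n → ℝ)) :=
  φ.continuous.memLp_of_hasCompactSupport φ.hasCompactSupport

namespace GradedLieGroup

variable {n : ℕ} (G : GradedLieGroup n)

/-- The coefficients of the vector field `Xⱼ`. -/
def frame (j : Fin n) (x : Fin n → ℝ) : Fin n → ℝ :=
  fderiv ℝ (fun y => G.mul x y) 0 (Pi.single j 1)

theorem contDiff_frame (j : Fin n) : ContDiff ℝ ∞ (G.frame j) := by
  have h := contDiff_fderiv_right (Φ := G.mul) G.contDiff_mul
  exact (h.comp (contDiff_id.prodMk contDiff_const)).clm_apply contDiff_const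

theorem vectorField_eq (j : Fin n) {f : (Fin n → ℝ) → ℂ} (hf : Differentiable ℝ f)
    (x : Fin n → ℝ) : G.vectorField j f x = fderiv ℝ f x (G.frame j x) := by
  have h1 : DifferentiableAt ℝ (fun y => G.mul x y) 0 :=
    ((G.contDiff_mul_left x).differentiable (by simp)) 0
  have h2 := fderiv_comp (𝕜 := ℝ) (g := f) (f := fun y => G.mul x y) 0 (hf _) h1
  simp only [vectorField, frame]
  rw [show (fun y => f (G.mul x y)) = f ∘ fun y => G.mul x y from rfl, h2, G.mul_zero]
  rfl

theorem contDiff_vectorField (j : Fin n) (φ : Test n ℂ) : ContDiff ℝ ∞ (G.vectorField j φ) := by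
  have h : G.vectorField j φ = fun x => fderiv ℝ φ x (G.frame j x) :=
    funext fun x => G.vectorField_eq j (φ.contDiff.differentiable (by simp)) x
  rw [h]
  exact (φ.contDiff.fderiv_right (by simp)).clm_apply (G.contDiff_frame j)

theorem vectorField_eq_zero (j : Fin n) (φ : Test n ℂ) {x : Fin n → ℝ} (hx : x ∉ tsupport φ) :
    G.vectorField j φ x = 0 := by
  rw [G.vectorField_eq j (φ.contDiff.differentiable (by simp)),
    image_eq_zero_of_notMem_tsupport fun h => hx (tsupport_fderiv_subset ℝ h)]
  rfl

/-- The operator `Xⱼ` on test functions. -/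
def vectorFieldTest (j : Fin n) : Module.End ℂ (Test n ℂ) where
  toFun φ := testOfCompact (G.vectorField j φ) (G.contDiff_vectorField j φ)
    φ.hasCompactSupport.isCompact fun _ hx => G.vectorField_eq_zero j φ hx
  map_add' φ ψ := by
    ext x
    have h1 := φ.contDiff.differentiable (by simp)
    have h2 := ψ.contDiff.differentiable (by simp)
    simp only [testOfCompact_apply, FunLike.coe_add, Pi.add_apply]
    rw [G.vectorField_eq j (h1.add h2), G.vectorField_eq j h1, G.vectorField_eq j h2,
      fderiv_add (h1 x) (h2 x)]
    rfl
  map_smul' a φ := by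
    ext x
    have h1 := φ.contDiff.differentiable (by simp)
    simp only [testOfCompact_apply, FunLike.coe_smul, Pi.smul_apply, RingHom.id_apply]
    rw [G.vectorField_eq j (h1.const_smul a), G.vectorField_eq j h1, fderiv_const_smul (h1 x)]
    rfl

@[simp]
theorem coe_vectorFieldTest (j : Fin n) (φ : Test n ℂ) :
    ⇑(G.vectorFieldTest j φ) = G.vectorField j φ := rfl

/-- The operator `X^α` on test functions. -/
def monomialTest (α : Fin n → ℕ) : Module.End ℂ (Test n ℂ) :=
  ((List.finRange n).map fun j => G.vectorFieldTest j ^ α j).prod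

theorem coe_vectorFieldTest_pow (j : Fin n) (m : ℕ) (φ : Test n ℂ) :
    ⇑((G.vectorFieldTest j ^ m) φ) = (G.vectorField j)^[m] φ := by
  induction m with
  | zero => rfl
  | succ m ih =>
    rw [pow_succ', Module.End.mul_apply, coe_vectorFieldTest, ih, Function.iterate_succ_apply']

theorem coe_monomialTest (α : Fin n → ℕ) (φ : Test n ℂ) :
    ⇑(G.monomialTest α φ) = G.monomial α φ := by
  unfold monomialTest monomial
  induction List.finRange n with
  | nil => rfl
  | cons j l ih =>
    rw [List.map_cons, List.prod_cons, Module.End.mul_apply, coe_vectorFieldTest_pow, ih,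
      List.foldr_cons]

/-- The operator `R` on test functions. -/
def diffOpTest (c : (Fin n → ℕ) →₀ ℂ) : Module.End ℂ (Test n ℂ) :=
  ∑ α ∈ c.support, c α • G.monomialTest α

theorem coe_diffOpTest (c : (Fin n → ℕ) →₀ ℂ) (φ : Test n ℂ) :
    ⇑(G.diffOpTest c φ) = G.diffOp c φ := by
  ext x
  have h : G.diffOpTest c φ = ∑ α ∈ c.support, c α • G.monomialTest α φ := by
    simp [diffOpTest, LinearMap.sum_apply]
  have h2 : ∀ s : Finset (Fin n → ℕ), (∑ α ∈ s, c α • G.monomialTest α φ) x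
      = ∑ α ∈ s, c α * G.monomial α φ x := fun s => by
    induction s using Finset.cons_induction with
    | empty => rfl
    | cons a s ha ih =>
      rw [Finset.sum_cons, Finset.sum_cons, FunLike.coe_add, Pi.add_apply, ih,
        FunLike.coe_smul, Pi.smul_apply, coe_monomialTest, smul_eq_mul]
  rw [h, h2]
  rfl

/-- `R` is a noncommutative polynomial in the `Xⱼ`, so it suffices to commute with each of them. -/
theorem commute_diffOpTest (c : (Fin n → ℕ) →₀ ℂ) {S : Module.End ℂ (Test n ℂ)}
    (h : ∀ j, Commute S (G.vectorFieldTest j)) : Commute S (G.diffOpTest c) := by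
  refine Commute.sum_right _ _ _ fun α _ => Commute.smul_right ?_ _
  refine Commute.list_prod_right _ _ fun x hx => ?_
  obtain ⟨j, -, rfl⟩ := List.mem_map.1 hx
  exact (h j).pow_right _

/-- Test functions as elements of `L²`, linearly. -/
def toL2Linear : Test n ℂ →ₗ[ℂ] L2 n where
  toFun := toL2
  map_add' _ _ := rfl
  map_smul' _ _ := rfl

@[simp]
theorem toL2Linear_apply (φ : Test n ℂ) : toL2Linear φ = toL2 φ := rfl

theorem coeFn_toL2 (φ : Test n ℂ) : toL2 φ =ᵐ[volume] φ := MemLp.coeFn_toLp _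

theorem inner_toL2 (φ : Test n ℂ) (f : L2 n) :
    inner ℂ (toL2 φ) f = ∫ x, conj (φ x) * f x := by
  rw [L2.inner_def]
  refine integral_congr_ae ?_
  filter_upwards [coeFn_toL2 φ] with x hx
  rw [hx, RCLike.inner_apply, mul_comm]

theorem inner_toL2_toL2 (φ ψ : Test n ℂ) :
    inner ℂ (toL2 φ) (toL2 ψ) = ∫ x, ψ x * conj (φ x) := by
  rw [inner_toL2]
  refine integral_congr_ae ?_
  filter_upwards [coeFn_toL2 ψ] with x hx
  rw [hx, mul_comm]

/-- The operator `R` from test functions to `L²`. -/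
def diffOpL2 (c : (Fin n → ℕ) →₀ ℂ) : Test n ℂ →ₗ[ℂ] L2 n :=
  toL2Linear ∘ₗ G.diffOpTest c

variable {G} {c : (Fin n → ℕ) →₀ ℂ} {ν : ℕ}

theorem inner_diffOpL2 (φ : Test n ℂ) :
    inner ℂ (toL2Linear φ) (G.diffOpL2 c φ) = ∫ x, G.diffOp c φ x * conj (φ x) := by
  rw [← G.coe_diffOpTest]
  exact inner_toL2_toL2 φ (G.diffOpTest c φ)

theorem energy_eq_inner (φ : Test n ℂ) :
    G.energy c φ = (inner ℂ (toL2Linear φ) (G.diffOpL2 c φ)).re := by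
  rw [inner_diffOpL2]
  rfl

theorem IsPositiveRockland.isPositiveSymmetric (hR : G.IsPositiveRockland c ν) :
    IsPositiveSymmetric toL2Linear (G.diffOpL2 c) :=
  .of_real (fun φ => by rw [inner_diffOpL2]; exact (hR.positive φ).2)
    fun φ => by rw [inner_diffOpL2]; exact (hR.positive φ).1

theorem isEnergyLimit_iff {f : L2 n} {e : ℝ} :
    G.IsEnergyLimit c f e ↔ EnergyLimit toL2Linear (G.diffOpL2 c) f e := by
  simp only [IsEnergyLimit, EnergyLimit, energy_eq_inner, toL2Linear_apply]

theorem isOpValue_iff {f g : L2 n} :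
    G.IsOpValue c f g ↔ FriedrichsValue toL2Linear (G.diffOpL2 c) f g := by
  simp only [IsOpValue, MemSobolev, FriedrichsValue, isEnergyLimit_iff]
  refine and_congr_right fun _ => forall_congr' fun φ => ?_
  rw [← G.coe_diffOpTest, ← inner_toL2, ← inner_toL2]
  rfl

theorem IsPositiveRockland.homSobolevNorm_eq (hR : G.IsPositiveRockland c ν) {f : L2 n} {e : ℝ}
    (h : G.IsEnergyLimit c f e) : G.homSobolevNorm c f = √e := by
  have : {e | G.IsEnergyLimit c f e} = {e} := by
    ext e'
    refine ⟨fun h' => ?_, fun h' => by rw [h']; exact h⟩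
    exact EnergyLimit.unique hR.isPositiveSymmetric (isEnergyLimit_iff.1 h')
      (isEnergyLimit_iff.1 h)
  rw [homSobolevNorm, this, csInf_singleton]

end GradedLieGroup

/-! ### Multiplication by a bounded potential -/

variable {n : ℕ}

theorem ae_norm_le_norm_Linfty (V : Linfty n) : ∀ᵐ x, ‖V x‖ ≤ ‖V‖ := by
  filter_upwards [ae_le_eLpNormEssSup (f := V) (μ := volume)] with x hx
  rw [Lp.norm_def, eLpNorm_exponent_top]
  rw [← toReal_enorm]
  refine ENNReal.toReal_mono ?_ hx
  have := Lp.eLpNorm_ne_top V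
  rwa [eLpNorm_exponent_top] at this

theorem memLp_mul_Linfty (V : Linfty n) (f : L2 n) :
    MemLp (fun x => (V x : ℂ) * f x) 2 (volume : Measure (Fin n → ℝ)) := by
  refine (Lp.memLp f).of_le_mul (c := ‖V‖) ?_ ?_
  · exact (Complex.continuous_ofReal.comp_aestronglyMeasurable (Lp.aestronglyMeasurable V)).mul
      (Lp.aestronglyMeasurable f)
  · filter_upwards [ae_norm_le_norm_Linfty V] with x hx
    rw [norm_mul, Complex.norm_real]
    gcongr

/-- Multiplication by `V ∈ L^∞` on `L²`. -/
def mulOp (V : Linfty n) : L2 n →L[ℂ] L2 n :=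
  LinearMap.mkContinuous
    { toFun := fun f => (memLp_mul_Linfty V f).toLp _
      map_add' := fun f g => by
        ext1
        filter_upwards [(memLp_mul_Linfty V (f + g)).coeFn_toLp, Lp.coeFn_add f g,
          (memLp_mul_Linfty V f).coeFn_toLp, (memLp_mul_Linfty V g).coeFn_toLp,
          Lp.coeFn_add ((memLp_mul_Linfty V f).toLp _) ((memLp_mul_Linfty V g).toLp _)]
          with x h1 h2 h3 h4 h5
        rw [h1, h5, Pi.add_apply, h3, h4, h2, Pi.add_apply, mul_add]
      map_smul' := fun a f => by
        ext1
        filter_upwards [(memLp_mul_Linfty V (a • f)).coeFn_toLp, Lp.coeFn_smul a f,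
          (memLp_mul_Linfty V f).coeFn_toLp,
          Lp.coeFn_smul a ((memLp_mul_Linfty V f).toLp _)] with x h1 h2 h3 h4
        rw [h1, RingHom.id_apply, h4, Pi.smul_apply, h3, h2, Pi.smul_apply, smul_eq_mul,
          smul_eq_mul, mul_left_comm] }
    ‖V‖ fun f => by
      refine Lp.norm_le_mul_norm_of_ae_le_mul ?_
      filter_upwards [(memLp_mul_Linfty V f).coeFn_toLp, ae_norm_le_norm_Linfty V] with x h1 hx
      change ‖((memLp_mul_Linfty V f).toLp _ : L2 n) x‖ ≤ _
      rw [h1, norm_mul, Complex.norm_real]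
      gcongr

theorem coeFn_mulOp (V : Linfty n) (f : L2 n) :
    mulOp V f =ᵐ[volume] fun x => (V x : ℂ) * f x :=
  (memLp_mul_Linfty V f).coeFn_toLp

theorem norm_mulOp_le (V : Linfty n) : ‖mulOp V‖ ≤ ‖V‖ :=
  LinearMap.mkContinuous_norm_le _ (norm_nonneg _) _

theorem isSelfAdjoint_mulOp (V : Linfty n) : IsSelfAdjoint (mulOp V) := by
  rw [ContinuousLinearMap.isSelfAdjoint_iff_isSymmetric]
  intro f g
  change inner ℂ (mulOp V f) g = inner ℂ f (mulOp V g)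
  rw [L2.inner_def, L2.inner_def]
  refine integral_congr_ae ?_
  filter_upwards [coeFn_mulOp V f, coeFn_mulOp V g] with x h1 h2
  rw [h1, h2, RCLike.inner_apply, RCLike.inner_apply, map_mul, Complex.conj_ofReal]
  ring

/-! ### Solutions on the group: existence, `L²` bound and energy bound -/

namespace GradedLieGroup

variable {G : GradedLieGroup n} {c : (Fin n → ℕ) →₀ ℂ} {ν : ℕ} {T : ℝ}

theorem isSolution_iff {V : Linfty n} {u₀ : L2 n} {u : ℝ → L2 n} :
    G.IsSolution c T V u₀ u ↔ IsEvolution toL2Linear (G.diffOpL2 c) T (mulOp V) u ∧ u 0 = u₀ := by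
  have key : ∀ u' Ru w : L2 n, (∀ᵐ x, u' x + Ru x + (V x : ℂ) * w x = 0) ↔
      u' + Ru + mulOp V w = 0 := fun u' Ru w => by
    rw [Lp.ext_iff]
    refine eventually_congr ?_
    filter_upwards [coeFn_mulOp V w, Lp.coeFn_add (u' + Ru) (mulOp V w), Lp.coeFn_add u' Ru,
      Lp.coeFn_zero ℂ 2 (volume : Measure (Fin n → ℝ))] with x h1 h2 h3 h4
    rw [h2, Pi.add_apply, h3, Pi.add_apply, h1, h4]
    rfl
  constructor
  · intro h
    refine ⟨⟨h.continuousOn, fun t ht => ?_⟩, h.initial⟩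
    obtain ⟨u', Ru, h1, h2, h3⟩ := h.equation t ht
    exact ⟨u', Ru, h1, isOpValue_iff.1 h2, (key _ _ _).1 h3⟩
  · rintro ⟨h, h0⟩
    refine ⟨h.continuousOn, h0, fun t ht => ?_⟩
    obtain ⟨u', Ru, h1, h2, h3⟩ := h.equation t ht
    exact ⟨u', Ru, h1, isOpValue_iff.2 h2, (key _ _ _).2 h3⟩

theorem IsPositiveRockland.exists_isSolution (hR : G.IsPositiveRockland c ν) (T : ℝ)
    (V : Linfty n) {u₀ : L2 n} (h0 : G.MemSobolev c u₀) :
    ∃ u, G.IsSolution c T V u₀ u := by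
  obtain ⟨e₀, he₀⟩ := h0
  obtain ⟨u, hu, hu0, -, -⟩ := exists_evolution hR.isPositiveSymmetric (isSelfAdjoint_mulOp V)
    (norm_mulOp_le V) (isEnergyLimit_iff.1 he₀) T
  exact ⟨u, isSolution_iff.2 ⟨hu, hu0⟩⟩

theorem IsPositiveRockland.norm_solution_le (hR : G.IsPositiveRockland c ν)
    {V : Linfty n} {u₀ : L2 n} {u : ℝ → L2 n} (hu : G.IsSolution c T V u₀ u) {t : ℝ}
    (ht : t ∈ Icc 0 T) : ‖u t‖ ≤ Real.exp (‖V‖ * T) * ‖u₀‖ := by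
  obtain ⟨h, rfl⟩ := isSolution_iff.1 hu
  refine (h.norm_le hR.isPositiveSymmetric (norm_mulOp_le V) ht).trans ?_
  gcongr
  exact ht.2

/-- Uniqueness in `L²` identifies the given solution with the constructed one, which is continuous
in energy up to `t = 0`. -/
theorem IsPositiveRockland.continuousSobolev (hR : G.IsPositiveRockland c ν)
    {V : Linfty n} {u₀ : L2 n} (h0 : G.MemSobolev c u₀) {u : ℝ → L2 n}
    (hu : G.IsSolution c T V u₀ u) : G.ContinuousSobolev c T u := by
  obtain ⟨e₀, he₀⟩ := h0
  obtain ⟨h, hu0⟩ := isSolution_iff.1 hu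
  obtain ⟨v, hv, hv0, h1, h2⟩ := exists_evolution hR.isPositiveSymmetric (isSelfAdjoint_mulOp V)
    (norm_mulOp_le V) (isEnergyLimit_iff.1 he₀) T
  have huv := h.eqOn hR.isPositiveSymmetric hv (hu0.trans hv0.symm)
  intro t ht
  obtain ⟨e, he, -⟩ := h1 t ht
  rw [huv ht]
  refine ⟨⟨e, isEnergyLimit_iff.2 he⟩, ?_⟩
  obtain ⟨a, ha, ha0⟩ := h2 t ht
  have h3 : Tendsto (fun s => √(a s) + ‖v s - v t‖) (𝓝[Icc 0 T] t) (𝓝 (√0 + ‖v t - v t‖)) :=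
    ha0.sqrt.add ((hv.continuousOn t ht).sub_const _).norm
  rw [Real.sqrt_zero, sub_self, norm_zero, add_zero] at h3
  refine h3.congr' ?_
  filter_upwards [self_mem_nhdsWithin] with s hs
  rw [huv hs, sobolevNorm, hR.homSobolevNorm_eq (isEnergyLimit_iff.2 (ha s))]

/-- The energy bound of the constructed solution, transferred by uniqueness. The root is removed by
`√e ≤ 1 + e`, so that the right side is a polynomial. -/
theorem IsPositiveRockland.sobolevNorm_solution_le (hR : G.IsPositiveRockland c ν)
    {V : Linfty n} {u₀ : L2 n} (h0 : G.MemSobolev c u₀) {u : ℝ → L2 n}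
    (hu : G.IsSolution c T V u₀ u) {t : ℝ} (ht : t ∈ Icc 0 T) :
    G.sobolevNorm c (u t) ≤
      1 + G.sobolevNorm c u₀ ^ 2 + ‖V‖ * ‖u₀‖ ^ 2 + ‖V‖ * ‖u t‖ ^ 2 + ‖u t‖ := by
  obtain ⟨e₀, he₀⟩ := h0
  obtain ⟨h, hu0⟩ := isSolution_iff.1 hu
  obtain ⟨v, hv, hv0, h1, -⟩ := exists_evolution hR.isPositiveSymmetric (isSelfAdjoint_mulOp V)
    (norm_mulOp_le V) (isEnergyLimit_iff.1 he₀) T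
  have huv := h.eqOn hR.isPositiveSymmetric hv (hu0.trans hv0.symm)
  obtain ⟨e, he, hle⟩ := h1 t ht
  have he0 : 0 ≤ e := he.nonneg hR.isPositiveSymmetric
  have he₀0 : 0 ≤ e₀ := (isEnergyLimit_iff.1 he₀).nonneg hR.isPositiveSymmetric
  rw [huv ht, sobolevNorm, sobolevNorm, hR.homSobolevNorm_eq (isEnergyLimit_iff.2 he),
    hR.homSobolevNorm_eq he₀]
  have h2 : √e ≤ 1 + e := by nlinarith [Real.sq_sqrt he0, sq_nonneg (√e - 1), Real.sqrt_nonneg e]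
  have h3 : e₀ ≤ (√e₀ + ‖u₀‖) ^ 2 := by
    nlinarith [Real.sq_sqrt he₀0, mul_nonneg (Real.sqrt_nonneg e₀) (norm_nonneg u₀),
      sq_nonneg ‖u₀‖]
  linarith

end GradedLieGroup

/-! ### Moderateness in the energy space -/

variable {n : ℕ}

/-- With `ρ ≤ b`, a smaller power of `1 / ρ` is at most a power of `b` times a larger one. This is
where boundedness of the scale enters. -/
theorem IsScale.exists_common_bound {ρ : ℝ → ℝ} (hρ : IsScale ρ) (N₁ N₂ : ℕ) (C₁ C₂ : ℝ) :
    ∃ (N : ℕ) (C : ℝ), ∀ ε ∈ Ioc (0 : ℝ) 1, 1 ≤ C * (ρ ε ^ N)⁻¹ ∧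
      C₁ * (ρ ε ^ N₁)⁻¹ ≤ C * (ρ ε ^ N)⁻¹ ∧ C₂ * (ρ ε ^ N₂)⁻¹ ≤ C * (ρ ε ^ N)⁻¹ := by
  obtain ⟨B, hB⟩ := hρ.bounded
  set b := max B 1
  have hb1 : 1 ≤ b := le_max_right _ _
  refine ⟨N₁ + N₂, (|C₁| + |C₂| + 1) * b ^ (N₁ + N₂), fun ε hε => ?_⟩
  have hr := hρ.pos ε hε
  have hrb : ρ ε ≤ b := (hB ε hε).trans (le_max_left _ _)
  have key : ∀ (D : ℝ) (k : ℕ), |D| ≤ |C₁| + |C₂| + 1 → k ≤ N₁ + N₂ →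
      D * (ρ ε ^ k)⁻¹ ≤ (|C₁| + |C₂| + 1) * b ^ (N₁ + N₂) * (ρ ε ^ (N₁ + N₂))⁻¹ := by
    intro D k hD hk
    obtain ⟨m, hm⟩ := Nat.exists_eq_add_of_le hk
    rw [hm, ← div_eq_mul_inv, ← div_eq_mul_inv, div_le_div_iff₀ (pow_pos hr _) (pow_pos hr _),
      pow_add (ρ ε), mul_comm (ρ ε ^ k), ← mul_assoc]
    gcongr
    · exact (le_abs_self D).trans hD
    · calc ρ ε ^ m ≤ b ^ m := by gcongr
        _ ≤ b ^ (k + m) := pow_le_pow_right₀ hb1 (by omega)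
  refine ⟨?_, key _ _ ?_ (by omega), key _ _ ?_ (by omega)⟩
  · have := key 1 0 (by rw [abs_one]; linarith [abs_nonneg C₁, abs_nonneg C₂]) (by omega)
    simpa using this
  · linarith [abs_nonneg C₂]
  · linarith [abs_nonneg C₁]

namespace GradedLieGroup

variable {G : GradedLieGroup n} {c : (Fin n → ℕ) →₀ ℂ} {ν : ℕ} {T : ℝ}

theorem homSobolevNorm_nonneg (f : L2 n) : 0 ≤ G.homSobolevNorm c f := Real.sqrt_nonneg _

/-- Every very weak solution is moderate in the energy space. -/
theorem IsVeryWeakSolution.isSobolevModerate (hR : G.IsPositiveRockland c ν) {ρ : ℝ → ℝ}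
    (hρ : IsScale ρ) {V : Distr n ℝ} {u₀ : Distr n ℂ} {Vε : ℝ → Linfty n} {u₀ε : ℝ → L2 n}
    {u : ℝ → ℝ → L2 n} (h : G.IsVeryWeakSolution c T ρ V u₀ Vε u₀ε u) :
    G.IsSobolevModerate c T ρ u := by
  obtain ⟨N₁, C₁, h1⟩ := h.potential_moderate
  obtain ⟨N₂, C₂, h2⟩ := h.data_moderate
  obtain ⟨N₃, C₃, h3⟩ := h.moderate
  refine ⟨fun ε hε => hR.continuousSobolev (h2 ε hε).1 (h.solution ε hε), ?_⟩
  obtain ⟨N₄, C₄, h4⟩ := hρ.exists_common_bound N₁ N₂ C₁ C₂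
  obtain ⟨N, C, h5⟩ := hρ.exists_common_bound N₃ N₄ C₃ C₄
  -- Potential, datum and solution are all at most `P = C ρ^{-N}` with `P ≥ 1`. The energy bound has
  -- five terms of degree at most three in these, hence `5 P³`.
  refine ⟨3 * N, 5 * C ^ 3, fun ε hε t ht => ?_⟩
  refine (hR.sobolevNorm_solution_le (h2 ε hε).1 (h.solution ε hε) ht).trans ?_
  obtain ⟨-, h41, h42⟩ := h4 ε hε
  obtain ⟨hP, h53, h54⟩ := h5 ε hε
  set P := C * (ρ ε ^ N)⁻¹ with hPdef
  have e1 : ‖Vε ε‖ ≤ P := (h1 ε hε).trans (h41.trans h54)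
  have e2 : G.sobolevNorm c (u₀ε ε) ≤ P := (h2 ε hε).2.trans (h42.trans h54)
  have e3 : ‖u ε t‖ ≤ P := (h3 ε hε t ht).trans h53
  have e20 : 0 ≤ G.sobolevNorm c (u₀ε ε) :=
    add_nonneg (homSobolevNorm_nonneg _) (norm_nonneg _)
  have e4 : ‖u₀ε ε‖ ≤ P := (le_add_of_nonneg_left (homSobolevNorm_nonneg _)).trans e2
  have hP3 : 5 * C ^ 3 * (ρ ε ^ (3 * N))⁻¹ = 5 * P ^ 3 := by
    rw [hPdef, mul_pow, inv_pow, ← pow_mul, mul_comm 3 N]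
    ring
  have hPP : P ≤ P ^ 3 := le_self_pow₀ hP (by norm_num)
  have hPP2 : P ^ 2 ≤ P ^ 3 := pow_le_pow_right₀ hP (by norm_num)
  rw [hP3]
  calc _ ≤ P ^ 3 + P ^ 2 + P * P ^ 2 + P * P ^ 2 + P := by
        gcongr
        exact hP.trans hPP
    _ ≤ 5 * P ^ 3 := by nlinarith

end GradedLieGroup

/-! ### Existence of very weak solutions by slow regularisation -/

variable {n : ℕ}

/-- Any sequence can be reparametrised slowly enough that it grows at most like `1 / r`. -/
theorem exists_slow_index (a : ℕ → ℝ) : ∃ κ : ℝ → ℕ,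
    (∀ r, 0 < r → a (κ r) ≤ a 0 + r⁻¹) ∧ Tendsto κ (𝓝[>] 0) atTop := by
  classical
  -- The largest index up to `1 / r` that respects the bound; index `0` always does, and any fixed
  -- index does once `r` is small.
  refine ⟨fun r => Nat.findGreatest (fun k => a k ≤ a 0 + r⁻¹) ⌊r⁻¹⌋₊, fun r hr => ?_, ?_⟩
  · exact Nat.findGreatest_spec (P := fun k => a k ≤ a 0 + r⁻¹) (Nat.zero_le _)
      (le_add_of_nonneg_right (inv_pos.2 hr).le)
  · refine tendsto_atTop.2 fun m => ?_
    have h := tendsto_inv_nhdsGT_zero (𝕜 := ℝ)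
    filter_upwards [h.eventually_ge_atTop (m : ℝ), h.eventually_ge_atTop (a m - a 0)]
      with r h1 h2
    exact Nat.le_findGreatest (Nat.le_floor h1) (by linarith)

namespace GradedLieGroup

variable {G : GradedLieGroup n} {c : (Fin n → ℕ) →₀ ℂ} {ν : ℕ} {T : ℝ}

/-- No rate is required of the mollified quantities. The problem is solved at the widths `1 / (k +
1)`, and a slow choice of `k` in terms of `ρ ε` makes even the factor `exp (‖V‖ T)` moderate; the
width still tends to `0`, so both nets are regularisations. -/
theorem exists_isVeryWeakSolution (hR : G.IsPositiveRockland c ν) {ρ : ℝ → ℝ} (hρ : IsScale ρ)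
    {V : Distr n ℝ} {ψ : Test n ℝ} (hψ : ∫ x, ψ x = 1)
    (hVm : ∀ δ, 0 < δ → MemLp (G.conv V (G.rescale ψ δ)) ∞ volume)
    (hVt : ∀ φ : Test n ℝ, Tendsto (fun δ => ∫ x, φ x * G.conv V (G.rescale ψ δ) x)
      (𝓝[>] 0) (𝓝 (V φ)))
    {u₀ : Distr n ℂ} {χ : Test n ℝ} (hχ : ∫ x, χ x = 1)
    (hu : ∀ δ, 0 < δ → ∃ f : L2 n, f =ᵐ[volume] G.conv u₀ (G.rescale χ δ) ∧ G.MemSobolev c f) :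
    ∃ (Vε : ℝ → Linfty n) (u₀ε : ℝ → L2 n) (u : ℝ → ℝ → L2 n),
      G.IsRegularisation V (fun ε => Vε ε) ∧ G.IsVeryWeakSolution c T ρ V u₀ Vε u₀ε u := by
  have hδ : ∀ k : ℕ, (0 : ℝ) < 1 / (k + 1) := fun k => Nat.one_div_pos_of_nat
  set W : ℕ → Linfty n := fun k => (hVm _ (hδ k)).toLp _ with hW
  choose f hf hfS using fun k : ℕ => hu _ (hδ k)
  choose u hu using fun k : ℕ => hR.exists_isSolution T (W k) (hfS k)
  obtain ⟨κ, hκ, hκt⟩ := exists_slow_index fun k =>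
    ‖W k‖ + Real.exp (‖W k‖ * T) * ‖f k‖ + G.sobolevNorm c (f k)
  have hρt : Tendsto ρ (𝓝[>] 0) (𝓝[>] 0) := by
    refine tendsto_nhdsWithin_iff.2 ⟨hρ.tendsto, ?_⟩
    filter_upwards [Ioc_mem_nhdsGT (one_pos : (0 : ℝ) < 1)] with ε hε using hρ.pos ε hε
  set σ : ℝ → ℝ := fun ε => 1 / ((κ (ρ ε) : ℝ) + 1) with hσ
  have hσs : IsScale σ := by
    refine ⟨fun ε _ => hδ _, ⟨1, fun ε _ => ?_⟩, ?_⟩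
    · rw [hσ, div_le_one (by positivity)]
      simp
    · exact tendsto_one_div_add_atTop_nhds_zero_nat.comp (hκt.comp hρt)
  have hσt : Tendsto σ (𝓝[>] 0) (𝓝[>] 0) :=
    tendsto_nhdsWithin_iff.2 ⟨hσs.tendsto, .of_forall fun ε => hδ _⟩
  obtain ⟨N, C, hNC⟩ := hρ.exists_common_bound 0 1
    (‖W 0‖ + Real.exp (‖W 0‖ * T) * ‖f 0‖ + G.sobolevNorm c (f 0)) 1
  have hb : ∀ ε ∈ Ioc (0 : ℝ) 1, ‖W (κ (ρ ε))‖ +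
      Real.exp (‖W (κ (ρ ε))‖ * T) * ‖f (κ (ρ ε))‖ + G.sobolevNorm c (f (κ (ρ ε))) ≤
      2 * C * (ρ ε ^ N)⁻¹ := fun ε hε => by
    have h1 := hκ (ρ ε) (hρ.pos ε hε)
    obtain ⟨-, h2, h3⟩ := hNC ε hε
    simp only [pow_zero, inv_one, mul_one, pow_one, one_mul] at h2 h3
    linarith
  have hs0 : ∀ k, 0 ≤ G.sobolevNorm c (f k) := fun k =>
    add_nonneg (homSobolevNorm_nonneg _) (norm_nonneg _)
  have he0 : ∀ k, 0 ≤ Real.exp (‖W k‖ * T) * ‖f k‖ := fun k => by positivity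
  have hcoe : ∀ ε, W (κ (ρ ε)) =ᵐ[volume] G.conv V (G.rescale ψ (σ ε)) := fun ε =>
    MemLp.coeFn_toLp _
  refine ⟨fun ε => W (κ (ρ ε)), fun ε => f (κ (ρ ε)), fun ε => u (κ (ρ ε)),
    ⟨ψ, hψ, σ, hσs, fun ε _ => hcoe ε⟩, ?_⟩
  refine ⟨fun φ => ?_, ⟨N, 2 * C, fun ε hε => ?_⟩, ⟨χ, hχ, σ, hσs, fun ε _ => hf _⟩,
    ⟨N, 2 * C, fun ε hε => ⟨hfS _, ?_⟩⟩, fun ε _ => hu _, ⟨N, 2 * C, fun ε hε t ht => ?_⟩⟩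
  · refine ((hVt φ).comp hσt).congr fun ε => integral_congr_ae ?_
    filter_upwards [hcoe ε] with x hx
    rw [hx]
  · linarith [hb ε hε, hs0 (κ (ρ ε)), he0 (κ (ρ ε))]
  · linarith [hb ε hε, norm_nonneg (W (κ (ρ ε))), he0 (κ (ρ ε))]
  · have := hR.norm_solution_le (hu (κ (ρ ε))) ht
    linarith [hb ε hε, hs0 (κ (ρ ε)), norm_nonneg (W (κ (ρ ε)))]

end GradedLieGroup

/-! ### Locally supported families, and vanishing off the support -/

variable {n : ℕ} {F : Type} [NormedAddCommGroup F] [NormedSpace ℝ F] [FiniteDimensional ℝ F]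

section Families

variable {X : Type} [NormedAddCommGroup X] [NormedSpace ℝ X] [FiniteDimensional ℝ X]
  {Φ : X → Test n ℝ}

/-- A cutoff in the parameter turns local control of the supports into one common compact set. -/
theorem IsTestFamily.smul_of_locally (hc : ContDiff ℝ ∞ (Function.uncurry fun x y => Φ x y))
    {b : X → ℝ} (hb : ContDiff ℝ ∞ b) {K : Set (Fin n → ℝ)} (hK : IsCompact K)
    (h0 : ∀ x, b x ≠ 0 → ∀ y ∉ K, Φ x y = 0) : IsTestFamily (fun x => b x • Φ x) K := by
  refine ⟨hK, ?_, fun x y hy => ?_⟩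
  · exact (hb.comp contDiff_fst).mul hc
  · by_cases hx : b x = 0
    · rw [FunLike.coe_smul, Pi.smul_apply, hx, zero_smul]
    · rw [FunLike.coe_smul, Pi.smul_apply, h0 x hx y hy, smul_zero]

theorem continuous_apply_of_locally (hc : ContDiff ℝ ∞ (Function.uncurry fun x y => Φ x y))
    (hK : ∀ L : Set X, IsCompact L → ∃ K, IsCompact K ∧ ∀ x ∈ L, ∀ y ∉ K, Φ x y = 0)
    (v : Distr n F) : Continuous fun x => v (Φ x) := by
  rw [continuous_iff_continuousAt]
  intro x₀
  obtain ⟨b, -, hb2, hb3, -, hb5⟩ :=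
    exists_contDiff_tsupport_subset (n := ⊤) (univ_mem : (univ : Set X) ∈ 𝓝 x₀)
  obtain ⟨K, hKc, hK⟩ := hK _ hb2.isCompact
  have h := (IsTestFamily.smul_of_locally hc hb3 hKc
    fun x hx => hK x (subset_tsupport _ hx)).continuous_apply v
  have h1 : ∀ᶠ x in 𝓝 x₀, b x ≠ 0 := hb3.continuous.continuousAt.eventually_ne (by simp [hb5])
  have h2 : ContinuousAt (fun x => (b x)⁻¹ • v (b x • Φ x)) x₀ :=
    (hb3.continuous.continuousAt.inv₀ (by simp [hb5])).smul h.continuousAt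
  refine h2.congr ?_
  filter_upwards [h1] with x hx
  rw [map_smul, smul_smul, inv_mul_cancel₀ hx, one_smul]

variable [MeasurableSpace X] [BorelSpace X] (μ : Measure X) [IsLocallyFiniteMeasure μ]

/-- The integral of a compactly supported family of test functions. -/
def IsTestFamily.integral {K : Set (Fin n → ℝ)} (h : IsTestFamily Φ K) {L : Set X}
    (hL : IsCompact L) (hL0 : ∀ x ∉ L, ∀ y, Φ x y = 0) : Test n ℝ :=
  testOfCompact (fun y => ∫ x, Φ x y ∂μ) (contDiff_integral_of_compact h.contDiff hL hL0)
    h.isCompact fun y hy => by simp [h.eq_zero _ y hy]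

theorem IsTestFamily.integral_apply {K : Set (Fin n → ℝ)} (h : IsTestFamily Φ K) {L : Set X}
    (hL : IsCompact L) (hL0 : ∀ x ∉ L, ∀ y, Φ x y = 0) (y : Fin n → ℝ) :
    h.integral μ hL hL0 y = ∫ x, Φ x y ∂μ := rfl

theorem IsTestFamily.apply_integral' {K : Set (Fin n → ℝ)} (h : IsTestFamily Φ K) {L : Set X}
    (hL : IsCompact L) (hL0 : ∀ x ∉ L, ∀ y, Φ x y = 0) (v : Distr n F) :
    v (h.integral μ hL hL0) = ∫ x, v (Φ x) ∂μ :=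
  h.apply_integral hL hL0 v fun _ => rfl

end Families

section Support

open Distribution

/-- A smooth partition: with `f = 0` near the complement of `U₁` and `f = 1` near the part of the
support of `φ` outside `U₂`, `f φ` is supported in `U₁` and `φ - f φ` in `U₂`. -/
theorem isVanishingOn_union {v : Distr n F} {U₁ U₂ : Set (Fin n → ℝ)} (h1o : IsOpen U₁)
    (h2o : IsOpen U₂) (h1 : IsVanishingOn v U₁) (h2 : IsVanishingOn v U₂) :
    IsVanishingOn v (U₁ ∪ U₂) := by
  intro φ hφ
  have hs : IsClosed (tsupport φ \ U₂) := (isClosed_tsupport _).sdiff h2o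
  have hd : Disjoint U₁ᶜ (tsupport φ \ U₂) := by
    rw [Set.disjoint_left]
    rintro x hx1 ⟨hx2, hx3⟩
    rcases hφ hx2 with h | h
    · exact hx1 h
    · exact hx3 h
  obtain ⟨f, hf1, hf2, -⟩ := exists_contMDiffMap_zero_one_nhds_of_isClosed
    (modelWithCornersSelf ℝ (Fin n → ℝ)) (n := ⊤) h1o.isClosed_compl hs hd
  have hf : ContDiff ℝ ∞ f := f.contMDiff.contDiff
  have hz : ∀ x ∉ tsupport φ, f x * φ x = 0 := fun x hx => by
    rw [image_eq_zero_of_notMem_tsupport hx, mul_zero]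
  set φ₁ : Test n ℝ := testOfCompact (fun x => f x * φ x) (hf.mul φ.contDiff)
    φ.hasCompactSupport.isCompact hz
  have hv1 : v φ₁ = 0 := by
    refine h1 _ fun x hx => ?_
    by_contra hxU
    have h3 : ∀ᶠ y in 𝓝 x, φ₁ y = 0 := by
      filter_upwards [(eventually_nhdsSet_iff_forall.1 hf1) x hxU] with y hy
      change f y * φ y = 0
      rw [hy, zero_mul]
    exact (notMem_tsupport_iff_eventuallyEq.2 h3) hx
  have hv2 : v (φ - φ₁) = 0 := by
    refine h2 _ fun x hx => ?_
    by_contra hxU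
    have h3 : ∀ᶠ y in 𝓝 x, (φ - φ₁) y = 0 := by
      by_cases hxφ : x ∈ tsupport φ
      · filter_upwards [(eventually_nhdsSet_iff_forall.1 hf2) x ⟨hxφ, hxU⟩] with y hy
        change φ y - f y * φ y = 0
        rw [hy, one_mul, sub_self]
      · filter_upwards [notMem_tsupport_iff_eventuallyEq.1 hxφ] with y hy
        change φ y - f y * φ y = 0
        rw [hy]
        simp
    exact (notMem_tsupport_iff_eventuallyEq.2 h3) hx
  rw [map_sub, hv1, sub_zero] at hv2
  exact hv2

/-- A distribution vanishes on the complement of its support. -/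
theorem isVanishingOn_compl_dsupport (v : Distr n F) : IsVanishingOn v (dsupport v)ᶜ := by
  intro φ hφ
  have h : ∃ U, IsOpen U ∧ tsupport φ ⊆ U ∧ IsVanishingOn v U := by
    refine φ.hasCompactSupport.isCompact.induction_on
      (p := fun s => ∃ U, IsOpen U ∧ s ⊆ U ∧ IsVanishingOn v U) ?_ ?_ ?_ ?_
    · refine ⟨∅, isOpen_empty, Subset.rfl, fun ψ hψ => ?_⟩
      have : ψ = 0 := by
        ext x
        exact image_eq_zero_of_notMem_tsupport fun hx => hψ hx
      rw [this, map_zero]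
    · rintro s t hst ⟨U, hU, hsU, hv⟩
      exact ⟨U, hU, hst.trans hsU, hv⟩
    · rintro s t ⟨U, hU, hsU, hv⟩ ⟨U', hU', hsU', hv'⟩
      exact ⟨U ∪ U', hU.union hU', union_subset_union hsU hsU', isVanishingOn_union hU hU' hv hv'⟩
    · intro x hx
      obtain ⟨U, hv, hU, hxU⟩ := (notMem_dsupport_iff x).1 (hφ hx)
      exact ⟨U, mem_nhdsWithin_of_mem_nhds (hU.mem_nhds hxU), U, hU, Subset.rfl, hv⟩
  obtain ⟨U, -, hs, hv⟩ := h
  exact hv φ hs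

end Support

/-! ### Group convolution with distributions -/

namespace GradedLieGroup

variable {n : ℕ} (G : GradedLieGroup n)
variable {F : Type} [NormedAddCommGroup F] [NormedSpace ℝ F] [FiniteDimensional ℝ F]

theorem reflect_apply (χ : Test n ℝ) (x y : Fin n → ℝ) :
    G.reflect χ x y = χ (G.mul (G.inv y) x) := rfl

theorem contDiff_inv_mul :
    ContDiff ℝ ∞ fun p : (Fin n → ℝ) × (Fin n → ℝ) => G.mul (G.inv p.2) p.1 :=
  G.contDiff_mul.comp ((G.contDiff_inv.comp contDiff_snd).prodMk contDiff_fst)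

theorem continuous_mul_inv :
    Continuous fun p : (Fin n → ℝ) × (Fin n → ℝ) => G.mul p.1 (G.inv p.2) :=
  G.continuous_mul.comp (continuous_fst.prodMk (G.continuous_inv.comp continuous_snd))

theorem mul_inv_inv_mul (x y : Fin n → ℝ) : G.mul x (G.inv (G.mul (G.inv y) x)) = y := by
  rw [G.inv_mul_rev, G.mul_inv_mul, G.inv_inv]

theorem contDiff_reflect (χ : Test n ℝ) :
    ContDiff ℝ ∞ (Function.uncurry fun x y => G.reflect χ x y) :=
  χ.contDiff.comp G.contDiff_inv_mul

theorem exists_isCompact_reflect (χ : Test n ℝ) (L : Set (Fin n → ℝ)) (hL : IsCompact L) :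
    ∃ K, IsCompact K ∧ ∀ x ∈ L, ∀ y ∉ K, G.reflect χ x y = 0 := by
  refine ⟨_, (hL.prod χ.hasCompactSupport.isCompact).image G.continuous_mul_inv,
    fun x hx y hy => ?_⟩
  by_contra h
  exact hy ⟨(x, _), ⟨hx, subset_tsupport _ h⟩, G.mul_inv_inv_mul x y⟩

theorem continuous_conv (v : Distr n F) (χ : Test n ℝ) : Continuous (G.conv v χ) :=
  continuous_apply_of_locally (G.contDiff_reflect χ) (G.exists_isCompact_reflect χ) v

/-- The convolution vanishes off the product of the supports of `v` and `χ`, which is compact. -/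
theorem exists_isCompact_conv {v : Distr n F} (hv : IsCompactlySupported v) (χ : Test n ℝ) :
    ∃ K, IsCompact K ∧ ∀ x ∉ K, G.conv v χ x = 0 := by
  refine ⟨_, (hv.prod χ.hasCompactSupport.isCompact).image G.continuous_mul, fun x hx => ?_⟩
  refine isVanishingOn_compl_dsupport v _ fun y hy hyv => hx ?_
  have h : tsupport (G.reflect χ x) ⊆ (fun y => G.mul (G.inv y) x) ⁻¹' tsupport χ :=
    closure_minimal (fun z hz => subset_tsupport _ hz) ((isClosed_tsupport _).preimage
      (G.contDiff_inv_mul.continuous.comp (continuous_const.prodMk continuous_id)))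
  exact ⟨(y, _), ⟨hyv, h hy⟩, G.mul_inv_mul y x⟩

/-- The right translate `y ↦ φ (y w)`. -/
def translate (φ : Test n ℝ) (w : Fin n → ℝ) : Test n ℝ :=
  testOfCompact (fun y => φ (G.mul y w)) (φ.contDiff.comp (G.contDiff_mul_right w))
    (φ.hasCompactSupport.isCompact.image
      (G.continuous_mul_inv.comp (continuous_id.prodMk continuous_const)))
    fun y hy => by
      by_contra h
      exact hy ⟨_, subset_tsupport _ h, G.mul_mul_inv y w⟩

theorem translate_apply (φ : Test n ℝ) (w y : Fin n → ℝ) :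
    G.translate φ w y = φ (G.mul y w) := rfl

theorem translate_zero (φ : Test n ℝ) : G.translate φ 0 = φ := by
  ext y
  rw [translate_apply, G.mul_zero]

theorem contDiff_translate (φ : Test n ℝ) :
    ContDiff ℝ ∞ (Function.uncurry fun w y => G.translate φ w y) :=
  φ.contDiff.comp (G.contDiff_mul.comp (contDiff_snd.prodMk contDiff_fst))

theorem exists_isCompact_translate (φ : Test n ℝ) (L : Set (Fin n → ℝ)) (hL : IsCompact L) :
    ∃ K, IsCompact K ∧ ∀ w ∈ L, ∀ y ∉ K, G.translate φ w y = 0 := by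
  refine ⟨_, (φ.hasCompactSupport.isCompact.prod hL).image G.continuous_mul_inv,
    fun w hw y hy => ?_⟩
  by_contra h
  exact hy ⟨(_, w), ⟨subset_tsupport _ h, hw⟩, G.mul_mul_inv y w⟩

theorem continuous_apply_translate (v : Distr n F) (φ : Test n ℝ) :
    Continuous fun w => v (G.translate φ w) :=
  continuous_apply_of_locally (G.contDiff_translate φ) (G.exists_isCompact_translate φ) v

theorem rescale_apply (ψ : Test n ℝ) {δ : ℝ} (hδ : 0 < δ) (x : Fin n → ℝ) :
    G.rescale ψ δ x = (δ ^ G.homDim)⁻¹ * ψ (dilation G.weight δ⁻¹ x) := by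
  rw [rescale, dif_pos hδ]
  rfl

theorem integral_mul_rescale (ψ : Test n ℝ) {δ : ℝ} (hδ : 0 < δ) (f : (Fin n → ℝ) → ℝ) :
    ∫ w, f w * G.rescale ψ δ w = ∫ z, ψ z * f (dilation G.weight δ z) := by
  have h := integral_comp_dilation G.weight (inv_pos.2 hδ)
    fun z => ψ z * f (dilation G.weight δ z)
  simp only [dilation_dilation_inv G.weight hδ] at h
  simp_rw [G.rescale_apply ψ hδ]
  have h2 : ∀ w, f w * ((δ ^ G.homDim)⁻¹ * ψ (dilation G.weight δ⁻¹ w)) =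
      (δ ^ G.homDim)⁻¹ * (ψ (dilation G.weight δ⁻¹ w) * f w) := fun w => by ring
  simp_rw [h2]
  rw [integral_const_mul, h, inv_pow, _root_.inv_inv, smul_eq_mul, homDim, ← _root_.mul_assoc,
    inv_mul_cancel₀ (pow_pos hδ _).ne', one_mul]

/-- Both sides are `V` applied to one test function, `y ↦ ∫ φ x ψ_δ (y⁻¹ x) dx`, rewritten by `x = y
D_δ z`. The right side makes sense and is continuous down to `δ = 0`. -/
theorem integral_mul_conv_rescale (V : Distr n ℝ) (φ ψ : Test n ℝ) {δ : ℝ} (hδ : 0 < δ) :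
    ∫ x, φ x * G.conv V (G.rescale ψ δ) x =
      ∫ z, ψ z * V (G.translate φ (dilation G.weight δ z)) := by
  obtain ⟨K, hKc, hK⟩ := G.exists_isCompact_reflect (G.rescale ψ δ) _ φ.hasCompactSupport.isCompact
  have hA := IsTestFamily.smul_of_locally (G.contDiff_reflect (G.rescale ψ δ)) φ.contDiff hKc
    fun x hx => hK x (subset_tsupport _ hx)
  have hcB : ContDiff ℝ ∞ (Function.uncurry fun z y =>
      G.translate φ (dilation G.weight δ z) y) :=
    (G.contDiff_translate φ).comp
      (((dilation_contDiff G.weight δ).comp contDiff_fst).prodMk contDiff_snd)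
  obtain ⟨K', hKc', hK'⟩ := G.exists_isCompact_translate φ _
    (ψ.hasCompactSupport.isCompact.image (dilation_continuous G.weight δ))
  have hB := IsTestFamily.smul_of_locally hcB ψ.contDiff hKc'
    fun z hz => hK' _ ⟨z, subset_tsupport _ hz, rfl⟩
  have hL : ∀ {Φ : (Fin n → ℝ) → Test n ℝ} (b : Test n ℝ), ∀ x ∉ tsupport b, ∀ y,
      (b x • Φ x) y = 0 := fun b x hx y => by
    rw [image_eq_zero_of_notMem_tsupport hx, zero_smul]
    rfl
  have h1 := hA.apply_integral' volume φ.hasCompactSupport.isCompact (hL φ) V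
  have h2 := hB.apply_integral' volume ψ.hasCompactSupport.isCompact (hL ψ) V
  simp only [map_smul, smul_eq_mul] at h1 h2
  refine h1.symm.trans (Eq.trans (congrArg V ?_) h2)
  ext y
  rw [IsTestFamily.integral_apply, IsTestFamily.integral_apply]
  simp only [FunLike.coe_smul, Pi.smul_apply, smul_eq_mul, reflect_apply, translate_apply]
  rw [← G.integral_mul_left y, ← G.integral_mul_rescale ψ hδ fun w => φ (G.mul y w)]
  simp only [inv_mul_mul]

/-- Mollifications of `V` converge to `V` in the sense of distributions. -/
theorem tendsto_integral_mul_conv_rescale (V : Distr n ℝ) {ψ : Test n ℝ} (hψ : ∫ x, ψ x = 1)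
    (φ : Test n ℝ) : Tendsto (fun δ => ∫ x, φ x * G.conv V (G.rescale ψ δ) x)
      (𝓝[>] 0) (𝓝 (V φ)) := by
  have hc : Continuous fun δ : ℝ => ∫ z, ψ z * V (G.translate φ (dilation G.weight δ z)) := by
    refine continuous_integral_of_compact (μ := volume)
      (Φ := fun z (δ : ℝ) => ψ z * V (G.translate φ (dilation G.weight δ z)))
      ?_ ψ.hasCompactSupport.isCompact fun z hz δ => ?_
    · refine (ψ.continuous.comp continuous_fst).mul ((G.continuous_apply_translate V φ).comp ?_)
      exact (continuous_dilation_uncurry G.weight).comp continuous_swap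
    · rw [image_eq_zero_of_notMem_tsupport hz, MulZeroClass.zero_mul]
  have h := (hc.tendsto 0).mono_left (nhdsWithin_le_nhds (s := Ioi 0))
  simp only [dilation_zero_left, translate_zero] at h
  rw [integral_mul_const, hψ, one_mul] at h
  refine h.congr' ?_
  filter_upwards [self_mem_nhdsWithin] with δ hδ
  exact (G.integral_mul_conv_rescale V φ ψ hδ).symm

end GradedLieGroup

/-! ### Convolution on `L²` -/

/-- Schur's test for nonnegative kernels. -/
theorem lintegral_sq_lintegral_mul_le {α : Type*} [MeasurableSpace α] {μ : Measure α} [SFinite μ]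
    {g : α → ℝ≥0∞} (hg : Measurable g) {k : α → α → ℝ≥0∞} (hk : Measurable (Function.uncurry k))
    {M : ℝ≥0∞} (h1 : ∀ x, ∫⁻ y, k x y ∂μ ≤ M) (h2 : ∀ y, ∫⁻ x, k x y ∂μ ≤ M) :
    ∫⁻ x, (∫⁻ y, g y * k x y ∂μ) ^ (2 : ℝ) ∂μ ≤ M ^ (2 : ℝ) * ∫⁻ y, g y ^ (2 : ℝ) ∂μ := by
  have hkx : ∀ x, Measurable (k x) := fun x => hk.comp measurable_prodMk_left
  have hky : ∀ y, Measurable fun x => k x y := fun y => hk.comp measurable_prodMk_right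
  have hp : ∀ x, (∫⁻ y, g y * k x y ∂μ) ^ (2 : ℝ) ≤ M * ∫⁻ y, g y ^ (2 : ℝ) * k x y ∂μ := by
    intro x
    have hs : ∀ a : ℝ≥0∞, a ^ (1 / 2 : ℝ) * a ^ (1 / 2 : ℝ) = a := fun a => by
      rw [← ENNReal.rpow_add_of_nonneg _ _ (by norm_num) (by norm_num)]
      norm_num
    have hs2 : ∀ a : ℝ≥0∞, (a ^ (1 / 2 : ℝ)) ^ (2 : ℝ) = a := fun a => by
      rw [← ENNReal.rpow_mul]
      norm_num
    -- Cauchy–Schwarz after splitting the kernel as `k^{1/2} k^{1/2}`, one factor kept with `g`.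
    have h := ENNReal.lintegral_mul_le_Lp_mul_Lq μ (p := 2) (q := 2)
      (f := fun y => g y * k x y ^ (1 / 2 : ℝ)) (g := fun y => k x y ^ (1 / 2 : ℝ))
      Real.HolderConjugate.two_two (hg.mul ((hkx x).pow_const _)).aemeasurable
      ((hkx x).pow_const _).aemeasurable
    simp only [Pi.mul_apply, mul_assoc, hs, hs2, ENNReal.mul_rpow_of_nonneg _ _ zero_le_two] at h
    calc (∫⁻ y, g y * k x y ∂μ) ^ (2 : ℝ)
        ≤ ((∫⁻ y, g y ^ (2 : ℝ) * k x y ∂μ) ^ (1 / 2 : ℝ) *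
            (∫⁻ y, k x y ∂μ) ^ (1 / 2 : ℝ)) ^ (2 : ℝ) := by gcongr
      _ = (∫⁻ y, g y ^ (2 : ℝ) * k x y ∂μ) * ∫⁻ y, k x y ∂μ := by
          rw [ENNReal.mul_rpow_of_nonneg _ _ zero_le_two, hs2, hs2]
      _ ≤ _ := by
          rw [mul_comm]
          gcongr
          exact h1 x
  calc ∫⁻ x, (∫⁻ y, g y * k x y ∂μ) ^ (2 : ℝ) ∂μ
      ≤ ∫⁻ x, M * ∫⁻ y, g y ^ (2 : ℝ) * k x y ∂μ ∂μ := lintegral_mono hp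
    _ = M * ∫⁻ x, ∫⁻ y, g y ^ (2 : ℝ) * k x y ∂μ ∂μ := by
        rw [lintegral_const_mul]
        exact Measurable.lintegral_prod_right
          (((hg.pow_const _).comp measurable_snd).mul hk)
    _ = M * ∫⁻ y, ∫⁻ x, g y ^ (2 : ℝ) * k x y ∂μ ∂μ := by
        rw [lintegral_lintegral_swap]
        exact (((hg.pow_const _).comp measurable_snd).mul hk).aemeasurable
    _ = M * ∫⁻ y, g y ^ (2 : ℝ) * ∫⁻ x, k x y ∂μ ∂μ := by
        simp_rw [lintegral_const_mul _ (hky _)]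
    _ ≤ M * ∫⁻ y, g y ^ (2 : ℝ) * M ∂μ := by
        gcongr
        exact h2 _
    _ = _ := by
        rw [lintegral_mul_const _ (hg.pow_const _), ENNReal.rpow_two]
        ring

namespace GradedLieGroup

variable {n : ℕ} (G : GradedLieGroup n)

section Convolution

variable {A : Type} [NormedRing A] [NormedAlgebra ℝ A]

/-- Group convolution of functions. -/
def mulConv (h χ : (Fin n → ℝ) → A) (x : Fin n → ℝ) : A := ∫ y, h y * χ (G.mul (G.inv y) x)

/-- Group convolution of test functions. -/
def testConv (h χ : Test n A) : Test n A :=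
  testOfCompact (G.mulConv h χ)
    (contDiff_integral_of_compact (Φ := fun y x => h y * χ (G.mul (G.inv y) x))
      ((h.contDiff.comp contDiff_fst).mul
        (χ.contDiff.comp (G.contDiff_inv_mul.comp (contDiff_snd.prodMk contDiff_fst))))
      h.hasCompactSupport.isCompact fun y hy x => by
        rw [image_eq_zero_of_notMem_tsupport hy, MulZeroClass.zero_mul])
    ((h.hasCompactSupport.isCompact.prod χ.hasCompactSupport.isCompact).image G.continuous_mul)
    fun x hx => by
      have h0 : ∀ y, h y * χ (G.mul (G.inv y) x) = 0 := fun y => by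
        by_cases hy : y ∈ tsupport h
        · by_cases hyx : G.mul (G.inv y) x ∈ tsupport χ
          · exact absurd ⟨(y, _), ⟨hy, hyx⟩, G.mul_inv_mul y x⟩ hx
          · rw [image_eq_zero_of_notMem_tsupport hyx, MulZeroClass.mul_zero]
        · rw [image_eq_zero_of_notMem_tsupport hy, MulZeroClass.zero_mul]
      simp [mulConv, h0]

theorem testConv_apply (h χ : Test n A) (x : Fin n → ℝ) :
    G.testConv h χ x = ∫ y, h y * χ (G.mul (G.inv y) x) := rfl

end Convolution

/-- Left-invariant vector fields commute with left convolution. -/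
theorem vectorFieldTest_testConv (j : Fin n) (h χ : Test n ℂ) :
    G.vectorFieldTest j (G.testConv h χ) = G.testConv h (G.vectorFieldTest j χ) := by
  ext x
  rw [testConv_apply, coe_vectorFieldTest]
  simp only [coe_vectorFieldTest]
  have hΦ : ContDiff ℝ ∞ (Function.uncurry fun y w => h y * χ (G.mul (G.inv y) (G.mul x w))) :=
    (h.contDiff.comp contDiff_fst).mul (χ.contDiff.comp (G.contDiff_inv_mul.comp
      (((G.contDiff_mul_left x).comp contDiff_snd).prodMk contDiff_fst)))
  have hd := hasFDerivAt_integral_of_compact (μ := volume) hΦ h.hasCompactSupport.isCompact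
    (fun y hy x => by rw [image_eq_zero_of_notMem_tsupport hy, MulZeroClass.zero_mul]) 0
  have h1 : G.vectorField j (G.testConv h χ) x =
      (∫ y, fderiv ℝ (fun w => h y * χ (G.mul (G.inv y) (G.mul x w))) 0) (Pi.single j 1) := by
    rw [← hd.fderiv]
    rfl
  have hdc : Continuous fun y =>
      fderiv ℝ (fun w => h y * χ (G.mul (G.inv y) (G.mul x w))) 0 :=
    (contDiff_fderiv_right hΦ).continuous.comp (continuous_id.prodMk continuous_const)
  have hdi : Integrable (fun y => fderiv ℝ (fun w => h y * χ (G.mul (G.inv y) (G.mul x w))) 0)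
      (volume : Measure (Fin n → ℝ)) :=
    hdc.integrable_of_hasCompactSupport (HasCompactSupport.intro h.hasCompactSupport.isCompact
      fun y hy => fderiv_eq_zero_of_forall (K := tsupport h)
        (Φ := fun y w => h y * χ (G.mul (G.inv y) (G.mul x w))) (fun y hy x => by
          rw [image_eq_zero_of_notMem_tsupport hy, MulZeroClass.zero_mul]) y hy 0)
  rw [h1, ContinuousLinearMap.integral_apply hdi]
  refine integral_congr_ae (.of_forall fun y => ?_)
  have hχd : Differentiable ℝ fun w => χ (G.mul (G.mul (G.inv y) x) w) :=
    (χ.contDiff.comp (G.contDiff_mul_left _)).differentiable (by simp)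
  simp only [vectorField]
  -- Left invariance: `y⁻¹ (x w) = (y⁻¹ x) w`, so the derivative in `w` at the unit is `Xⱼ χ` at
  -- `y⁻¹ x`.
  simp_rw [← G.mul_assoc]
  rw [fderiv_const_mul (hχd 0)]
  rfl

/-- All derivatives fall on `χ`, so `R` after convolution by `χ` is again convolution by a test
function, hence bounded on `L²`. -/
theorem diffOpTest_testConv (c : (Fin n → ℕ) →₀ ℂ) (h χ : Test n ℂ) :
    G.diffOpTest c (G.testConv h χ) = G.testConv h (G.diffOpTest c χ) := by
  have hint : ∀ (φ : Test n ℂ) (x : Fin n → ℝ),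
      Integrable (fun y => h y * φ (G.mul (G.inv y) x)) := fun φ x =>
    (h.continuous.mul (φ.continuous.comp (G.contDiff_inv_mul.continuous.comp
      (continuous_const.prodMk continuous_id)))).integrable_of_hasCompactSupport
      h.hasCompactSupport.mul_right
  let S : Module.End ℂ (Test n ℂ) :=
    { toFun := fun χ => G.testConv h χ
      map_add' := fun φ ψ => by
        ext x
        rw [FunLike.coe_add, Pi.add_apply, testConv_apply, testConv_apply, testConv_apply,
          ← integral_add (hint φ x) (hint ψ x)]
        simp only [FunLike.coe_add, Pi.add_apply, mul_add]
      map_smul' := fun a φ => by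
        ext x
        rw [RingHom.id_apply, FunLike.coe_smul, Pi.smul_apply, testConv_apply, testConv_apply,
          ← integral_smul]
        simp only [FunLike.coe_smul, Pi.smul_apply, smul_eq_mul]
        exact integral_congr_ae (.of_forall fun y => mul_left_comm _ _ _) }
  have hS : Commute S (G.diffOpTest c) := G.commute_diffOpTest c fun j =>
    LinearMap.ext fun χ => (G.vectorFieldTest_testConv j h χ).symm
  exact (LinearMap.congr_fun hS.eq χ).symm

/-! ### The convolution operator -/

theorem continuous_comp_inv_mul (χ : Test n ℂ) (x : Fin n → ℝ) :
    Continuous fun y => χ (G.mul (G.inv y) x) :=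
  χ.continuous.comp (G.contDiff_inv_mul.continuous.comp (continuous_const.prodMk continuous_id))

theorem hasCompactSupport_comp_inv_mul (χ : Test n ℂ) (x : Fin n → ℝ) :
    HasCompactSupport fun y => χ (G.mul (G.inv y) x) :=
  χ.hasCompactSupport.comp_homeomorph (G.invHomeo.trans (G.mulRight x))

theorem integrable_mul_comp_inv_mul {f : (Fin n → ℝ) → ℂ} (hf : MemLp f 2 volume) (χ : Test n ℂ)
    (x : Fin n → ℝ) : Integrable fun y => f y * χ (G.mul (G.inv y) x) :=
  hf.integrable_mul ((G.continuous_comp_inv_mul χ x).memLp_of_hasCompactSupport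
    (G.hasCompactSupport_comp_inv_mul χ x) : MemLp _ 2 volume)

theorem lintegral_enorm_ne_top (χ : Test n ℂ) : ∫⁻ x, ‖χ x‖ₑ ≠ ⊤ :=
  (χ.continuous.integrable_of_hasCompactSupport χ.hasCompactSupport).2.ne

/-- Schur's test for the kernel `|χ (y⁻¹ x)|`. Integration in either variable gives `‖χ‖₁`: in `x`
by left invariance, in `y` by left invariance and inversion. -/
theorem eLpNorm_mulConv_le {f : (Fin n → ℝ) → ℂ} (hf : StronglyMeasurable f) (χ : Test n ℂ) :
    eLpNorm (G.mulConv f χ) 2 volume ≤ (∫⁻ x, ‖χ x‖ₑ) * eLpNorm f 2 volume := by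
  rw [eLpNorm_eq_lintegral_rpow_enorm_toReal (by norm_num) (by norm_num),
    eLpNorm_eq_lintegral_rpow_enorm_toReal (by norm_num) (by norm_num)]
  simp only [ENNReal.toReal_ofNat]
  have hm : Measurable fun x => ‖χ x‖ₑ := χ.continuous.enorm.measurable
  have h := lintegral_sq_lintegral_mul_le (μ := (volume : Measure (Fin n → ℝ)))
    (g := fun y => ‖f y‖ₑ) hf.enorm
    (k := fun x y => ‖χ (G.mul (G.inv y) x)‖ₑ)
    (χ.continuous.comp G.contDiff_inv_mul.continuous).enorm.measurable (M := ∫⁻ x, ‖χ x‖ₑ)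
    (fun x => by
      rw [← (G.measurePreserving_mul_left x).lintegral_comp
        (G.continuous_comp_inv_mul χ x).enorm.measurable, ← G.measurePreserving_inv.lintegral_comp hm]
      simp only [G.inv_mul_rev, G.mul_inv_mul_right, le_refl])
    (fun y => ((G.measurePreserving_mul_left (G.inv y)).lintegral_comp hm).le)
  have h2 : ∫⁻ x, ‖G.mulConv f χ x‖ₑ ^ (2 : ℝ) ≤
      (∫⁻ x, ‖χ x‖ₑ) ^ (2 : ℝ) * ∫⁻ y, ‖f y‖ₑ ^ (2 : ℝ) := by
    refine le_trans (lintegral_mono fun x => ?_) h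
    gcongr
    refine (enorm_integral_le_lintegral_enorm _).trans_eq ?_
    simp only [enorm_mul]
  calc _ ≤ ((∫⁻ x, ‖χ x‖ₑ) ^ (2 : ℝ) * ∫⁻ y, ‖f y‖ₑ ^ (2 : ℝ)) ^ (1 / 2 : ℝ) := by gcongr
    _ = _ := by
      rw [ENNReal.mul_rpow_of_nonneg _ _ (by norm_num), ← ENNReal.rpow_mul]
      norm_num

theorem memLp_mulConv (f : L2 n) (χ : Test n ℂ) : MemLp (G.mulConv f χ) 2 volume := by
  refine ⟨?_, (G.eLpNorm_mulConv_le (Lp.stronglyMeasurable f) χ).trans_lt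
    (ENNReal.mul_lt_top (lintegral_enorm_ne_top χ).lt_top (Lp.eLpNorm_lt_top f))⟩
  refine StronglyMeasurable.aestronglyMeasurable (StronglyMeasurable.integral_prod_right ?_)
  exact ((Lp.stronglyMeasurable f).comp_measurable measurable_snd).mul
    (χ.continuous.comp G.contDiff_inv_mul.continuous).stronglyMeasurable

theorem mulConv_congr {f g : (Fin n → ℝ) → ℂ} (h : f =ᵐ[volume] g) (χ : (Fin n → ℝ) → ℂ) :
    G.mulConv f χ = G.mulConv g χ :=
  funext fun _ => integral_congr_ae (h.mono fun y hy => by simp only [hy])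

/-- Convolution on the right by a test function, on `L²`. -/
def convOp (χ : Test n ℂ) : L2 n →L[ℂ] L2 n :=
  LinearMap.mkContinuous
    { toFun := fun f => (G.memLp_mulConv f χ).toLp _
      map_add' := fun f g => by
        rw [← MemLp.toLp_add, MemLp.toLp_eq_toLp_iff, G.mulConv_congr (Lp.coeFn_add f g)]
        refine .of_forall fun x => ?_
        simp only [mulConv, Pi.add_apply, add_mul]
        exact integral_add (G.integrable_mul_comp_inv_mul (Lp.memLp f) χ x)
          (G.integrable_mul_comp_inv_mul (Lp.memLp g) χ x)
      map_smul' := fun a f => by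
        rw [RingHom.id_apply, ← MemLp.toLp_const_smul, MemLp.toLp_eq_toLp_iff,
          G.mulConv_congr (Lp.coeFn_smul a f)]
        refine .of_forall fun x => ?_
        simp only [mulConv, Pi.smul_apply, smul_mul_assoc]
        exact integral_smul _ _ }
    (∫⁻ x, ‖χ x‖ₑ).toReal fun f => by
      change ‖(G.memLp_mulConv f χ).toLp _‖ ≤ _
      rw [Lp.norm_toLp, Lp.norm_def, ← ENNReal.toReal_mul]
      exact ENNReal.toReal_mono (ENNReal.mul_ne_top (lintegral_enorm_ne_top χ) (Lp.eLpNorm_ne_top f))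
        (G.eLpNorm_mulConv_le (Lp.stronglyMeasurable f) χ)

theorem coeFn_convOp (χ : Test n ℂ) (f : L2 n) : G.convOp χ f =ᵐ[volume] G.mulConv f χ :=
  (G.memLp_mulConv f χ).coeFn_toLp

theorem convOp_toL2 (h χ : Test n ℂ) : G.convOp χ (toL2 h) = toL2 (G.testConv h χ) := by
  refine (MemLp.toLp_eq_toLp_iff (G.memLp_mulConv _ χ) _).2 ?_
  rw [G.mulConv_congr (coeFn_toL2 h)]
  rfl

theorem denseRange_toL2 : DenseRange (toL2 : Test n ℂ → L2 n) := by
  refine (Lp.dense_hasCompactSupport_contDiff (E := Fin n → ℝ) (F := ℂ) (μ := volume) (p := 2)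
    (by norm_num)).mono ?_
  rintro f ⟨g, hfg, hgc, hg⟩
  refine ⟨testOfCompact g hg hgc.isCompact fun x hx => image_eq_zero_of_notMem_tsupport hx, ?_⟩
  ext1
  exact (coeFn_toL2 _).trans hfg.symm

/-- Convolution by a test function maps `L²` into the energy space. -/
theorem memSobolev_convOp (c : (Fin n → ℕ) →₀ ℂ) (χ : Test n ℂ) (f : L2 n) :
    G.MemSobolev c (G.convOp χ f) := by
  obtain ⟨x, hx, hf⟩ := mem_closure_iff_seq_limit.1 (denseRange_toL2 f)
  choose φ hφ using hx
  have hφ' : Tendsto (fun m => toL2 (φ m)) atTop (𝓝 f) := hf.congr fun m => (hφ m).symm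
  have hE : ∀ h : Test n ℂ, G.diffOpL2 c (G.testConv h χ) =
      G.convOp (G.diffOpTest c χ) (toL2 h) := fun h => by
    rw [convOp_toL2, ← diffOpTest_testConv]
    rfl
  have hcont : Continuous fun f : L2 n =>
      (inner ℂ (G.convOp χ f) (G.convOp (G.diffOpTest c χ) f)).re :=
    Complex.continuous_re.comp (by fun_prop)
  -- The energy of `h ∗ χ` is an `L²`-continuous function of `h`, so any `L²` approximation of `f`
  -- by test functions becomes Cauchy in energy after convolution.
  have hEn : ∀ h : Test n ℂ, (inner ℂ (toL2Linear (G.testConv h χ))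
      (G.diffOpL2 c (G.testConv h χ))).re =
      (inner ℂ (G.convOp χ (toL2 h)) (G.convOp (G.diffOpTest c χ) (toL2 h))).re := fun h => by
    rw [hE, toL2Linear_apply, ← convOp_toL2]
  have hsub : ∀ h h' : Test n ℂ, G.testConv h χ - G.testConv h' χ = G.testConv (h - h') χ := by
    intro h h'
    ext x
    have hi : ∀ h : Test n ℂ, Integrable (fun y => h y * χ (G.mul (G.inv y) x)) := fun h =>
      G.integrable_mul_comp_inv_mul (memLp_test h 2) χ x
    rw [FunLike.coe_sub, Pi.sub_apply, testConv_apply, testConv_apply, testConv_apply,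
      ← integral_sub (hi h) (hi h')]
    simp only [FunLike.coe_sub, Pi.sub_apply, sub_mul]
  refine ⟨(inner ℂ (G.convOp χ f) (G.convOp (G.diffOpTest c χ) f)).re, isEnergyLimit_iff.2
    ⟨fun m => G.testConv (φ m) χ, ?_, ?_, ?_⟩⟩
  · simp only [toL2Linear_apply, ← convOp_toL2]
    exact ((G.convOp χ).continuous.tendsto f).comp hφ'
  · simp only [hsub, hEn]
    have h1 : Tendsto (fun p : ℕ × ℕ => toL2 (φ p.1 - φ p.2)) atTop (𝓝 0) := by
      have h2 : Tendsto (fun p : ℕ × ℕ => toL2 (φ p.1) - toL2 (φ p.2)) atTop (𝓝 (f - f)) := by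
        rw [← prod_atTop_atTop_eq]
        exact (hφ'.comp tendsto_fst).sub (hφ'.comp tendsto_snd)
      rw [sub_self] at h2
      exact h2
    have h3 := (hcont.tendsto 0).comp h1
    simpa [Function.comp_def] using h3
  · simp only [hEn]
    exact (hcont.tendsto f).comp hφ'

end GradedLieGroup

/-! ### Mollification of bounded, square integrable and compactly supported distributions -/

variable {n : ℕ}

theorem exists_test_integral_eq_one (n : ℕ) : ∃ ψ : Test n ℝ, ∫ x, ψ x = 1 := by
  let b : ContDiffBump (0 : Fin n → ℝ) := default
  have h := b.hasCompactSupport_normed (μ := volume)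
  exact ⟨testOfCompact (b.normed volume) b.contDiff_normed h.isCompact
    fun x hx => image_eq_zero_of_notMem_tsupport hx, b.integral_normed⟩

/-- A real test function as a complex one. -/
def complexTest (χ : Test n ℝ) : Test n ℂ :=
  testOfCompact (fun x => (χ x : ℂ)) (Complex.ofRealCLM.contDiff.comp χ.contDiff)
    χ.hasCompactSupport.isCompact fun x hx => by
      rw [image_eq_zero_of_notMem_tsupport hx, Complex.ofReal_zero]

theorem complexTest_apply (χ : Test n ℝ) (x : Fin n → ℝ) : complexTest χ x = (χ x : ℂ) := rfl

namespace GradedLieGroup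

variable (G : GradedLieGroup n)

theorem integral_comp_inv_mul {E : Type*} [NormedAddCommGroup E] [NormedSpace ℝ E]
    (f : (Fin n → ℝ) → E) (x : Fin n → ℝ) : ∫ y, f (G.mul (G.inv y) x) = ∫ y, f y := by
  rw [← G.integral_mul_left x, ← G.integral_inv f]
  simp only [G.inv_mul_rev, G.mul_inv_mul_right]

theorem memLp_top_conv_of_isLpDistr {V : Distr n ℝ} (hV : IsLpDistr ∞ V) (χ : Test n ℝ) :
    MemLp (G.conv V χ) ∞ volume := by
  obtain ⟨f, hf⟩ := hV
  refine memLp_top_of_bound (G.continuous_conv V χ).aestronglyMeasurable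
    ((∫ y, ‖χ y‖) * ‖f‖) (.of_forall fun x => ?_)
  rw [conv, hf, ← G.integral_comp_inv_mul (fun y => ‖χ y‖) x, ← integral_mul_const]
  refine norm_integral_le_of_norm_le (Integrable.mul_const ?_ _) ?_
  · exact ((G.reflect χ x).continuous.integrable_of_hasCompactSupport
      (G.reflect χ x).hasCompactSupport).norm
  · filter_upwards [ae_norm_le_norm_Linfty f] with y hy
    rw [norm_smul, reflect_apply]
    gcongr

theorem memLp_conv_of_isCompactlySupported {F : Type} [NormedAddCommGroup F] [NormedSpace ℝ F]
    [FiniteDimensional ℝ F] {v : Distr n F} (hv : IsCompactlySupported v) (χ : Test n ℝ)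
    (p : ℝ≥0∞) : MemLp (G.conv v χ) p volume := by
  obtain ⟨K, hK, h0⟩ := G.exists_isCompact_conv hv χ
  exact (G.continuous_conv v χ).memLp_of_hasCompactSupport (HasCompactSupport.intro hK h0)

/-- Associativity `v ∗ (ψ ∗ χ) = (v ∗ ψ) ∗ χ`: the distribution is moved inside the integral
defining `ψ ∗ χ`. -/
theorem conv_testConv {F : Type} [NormedAddCommGroup F] [NormedSpace ℝ F]
    [FiniteDimensional ℝ F] (v : Distr n F) (ψ χ : Test n ℝ) (x : Fin n → ℝ) :
    G.conv v (G.testConv ψ χ) x = ∫ w, χ (G.mul (G.inv w) x) • G.conv v ψ w := by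
  obtain ⟨K, hKc, hK⟩ := G.exists_isCompact_reflect ψ _
    (G.reflect χ x).hasCompactSupport.isCompact
  have hA := IsTestFamily.smul_of_locally (G.contDiff_reflect ψ) (G.reflect χ x).contDiff hKc
    fun w hw => hK w (subset_tsupport _ hw)
  have h := hA.apply_integral (μ := volume) (G.reflect χ x).hasCompactSupport.isCompact
    (fun w hw y => by
      rw [image_eq_zero_of_notMem_tsupport hw, zero_smul]
      rfl) v (I := G.reflect (G.testConv ψ χ) x) fun y => by
        rw [reflect_apply, testConv_apply, ← G.integral_mul_left (G.inv y)]
        refine integral_congr_ae (.of_forall fun w => ?_)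
        simp only [FunLike.coe_smul, Pi.smul_apply, smul_eq_mul, reflect_apply, G.inv_mul_rev,
          G.inv_inv]
        rw [G.mul_assoc, G.mul_inv_mul, mul_comm]
  simp only [map_smul] at h
  exact h

theorem integral_testConv (ψ χ : Test n ℝ) :
    ∫ x, G.testConv ψ χ x = (∫ x, ψ x) * ∫ x, χ x := by
  simp only [testConv_apply]
  have hc : Continuous (Function.uncurry fun x y => ψ y * χ (G.mul (G.inv y) x)) :=
    (ψ.continuous.comp continuous_snd).mul (χ.continuous.comp G.contDiff_inv_mul.continuous)
  have hs : HasCompactSupport (Function.uncurry fun x y => ψ y * χ (G.mul (G.inv y) x)) := by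
    refine HasCompactSupport.intro ((((ψ.hasCompactSupport.isCompact.prod
      χ.hasCompactSupport.isCompact).image G.continuous_mul)).prod
      ψ.hasCompactSupport.isCompact) ?_
    rintro ⟨x, y⟩ hxy
    change ψ y * χ (G.mul (G.inv y) x) = 0
    by_contra h
    have h1 := subset_tsupport _ (left_ne_zero_of_mul h)
    have h2 := subset_tsupport _ (right_ne_zero_of_mul h)
    exact hxy ⟨⟨(y, _), ⟨h1, h2⟩, G.mul_inv_mul y x⟩, h1⟩
  rw [integral_integral_swap_of_hasCompactSupport hc hs, ← integral_mul_const]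
  refine integral_congr_ae (.of_forall fun y => ?_)
  simp only
  rw [integral_const_mul, G.integral_mul_left (G.inv y)]

/-- Dilations are automorphisms with Jacobian `δ^Q`, so rescaling respects convolution. A
self-convolution is therefore an admissible mollifier that splits at every scale. -/
theorem rescale_testConv (ψ χ : Test n ℝ) {δ : ℝ} (hδ : 0 < δ) :
    G.rescale (G.testConv ψ χ) δ = G.testConv (G.rescale ψ δ) (G.rescale χ δ) := by
  ext x
  rw [testConv_apply, G.rescale_apply _ hδ, testConv_apply, ← integral_const_mul]
  simp_rw [mul_comm (G.rescale ψ δ _)]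
  rw [G.integral_mul_rescale ψ hδ]
  refine integral_congr_ae (.of_forall fun z => ?_)
  have h := dilation_dilation_inv G.weight (inv_pos.2 hδ) z
  rw [_root_.inv_inv] at h
  simp only [G.rescale_apply χ hδ]
  rw [G.dilation_mul _ (inv_pos.2 hδ), G.dilation_inv (inv_pos.2 hδ), h, mul_left_comm]

/-- Convolving an `L²` function with a real test function gives an element of the energy space. -/
theorem exists_memSobolev_of_conv_eq (c : (Fin n → ℕ) →₀ ℂ) {g : (Fin n → ℝ) → ℂ}
    (hg : MemLp g 2 volume) (χ : Test n ℝ) :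
    ∃ f : L2 n, (f =ᵐ[volume] fun x => ∫ y, χ (G.mul (G.inv y) x) • g y) ∧
      G.MemSobolev c f := by
  refine ⟨G.convOp (complexTest χ) (hg.toLp g), ?_, G.memSobolev_convOp c _ _⟩
  refine (G.coeFn_convOp _ _).trans (.of_eq ?_)
  rw [G.mulConv_congr hg.coeFn_toLp]
  funext x
  refine integral_congr_ae (.of_forall fun y => ?_)
  simp only [complexTest_apply, Complex.real_smul]
  exact mul_comm _ _

/-- For compactly supported data the mollifier is `ψ ∗ ψ`: the first factor yields a continuous
function with compact support, hence in `L²`, and the second maps it into the energy space. -/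
theorem exists_data_mollifier (c : (Fin n → ℕ) →₀ ℂ) {u₀ : Distr n ℂ}
    (hu₀ : IsLpDistr 2 u₀ ∨ IsCompactlySupported u₀) :
    ∃ χ : Test n ℝ, ∫ x, χ x = 1 ∧ ∀ δ, 0 < δ →
      ∃ f : L2 n, f =ᵐ[volume] G.conv u₀ (G.rescale χ δ) ∧ G.MemSobolev c f := by
  obtain ⟨ψ, hψ⟩ := exists_test_integral_eq_one n
  rcases hu₀ with ⟨g, hg⟩ | hu₀
  · refine ⟨ψ, hψ, fun δ _ => ?_⟩
    obtain ⟨f, hf, hfS⟩ := G.exists_memSobolev_of_conv_eq c (Lp.memLp g) (G.rescale ψ δ)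
    exact ⟨f, hf.trans (.of_eq (funext fun x => (hg (G.reflect (G.rescale ψ δ) x)).symm)), hfS⟩
  · refine ⟨G.testConv ψ ψ, by rw [integral_testConv, hψ, _root_.mul_one], fun δ hδ => ?_⟩
    obtain ⟨f, hf, hfS⟩ := G.exists_memSobolev_of_conv_eq c
      (G.memLp_conv_of_isCompactlySupported hu₀ (G.rescale ψ δ) 2) (G.rescale ψ δ)
    refine ⟨f, hf.trans (.of_eq (funext fun x => ?_)), hfS⟩
    rw [G.rescale_testConv ψ ψ hδ, conv_testConv]

end GradedLieGroup

end VeryWeakHeat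

end

/-! ### Assembly of existence and energy moderateness -/

theorem mainTheorem11 {n : ℕ} (G : VeryWeakHeat.GradedLieGroup n)
    (c : (Fin n → ℕ) →₀ ℂ) (ν : ℕ) (hR : G.IsPositiveRockland c ν)
    (T : ℝ) (hT : 0 < T)
    (V : VeryWeakHeat.Distr n ℝ)
    (hV : VeryWeakHeat.IsLpDistr ∞ V ∨ VeryWeakHeat.IsCompactlySupported V)
    (u₀ : VeryWeakHeat.Distr n ℂ)
    (hu₀ : VeryWeakHeat.IsLpDistr 2 u₀ ∨ VeryWeakHeat.IsCompactlySupported u₀)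
    (ρ : ℝ → ℝ) (hρ : VeryWeakHeat.IsScale ρ) :
    (∃ (Vε : ℝ → VeryWeakHeat.Linfty n) (u₀ε : ℝ → VeryWeakHeat.L2 n)
        (u : ℝ → ℝ → VeryWeakHeat.L2 n),
      G.IsRegularisation V (fun ε => Vε ε) ∧
      G.IsVeryWeakSolution c T ρ V u₀ Vε u₀ε u) ∧
    ∀ (Vε : ℝ → VeryWeakHeat.Linfty n) (u₀ε : ℝ → VeryWeakHeat.L2 n)
        (u : ℝ → ℝ → VeryWeakHeat.L2 n),
      G.IsVeryWeakSolution c T ρ V u₀ Vε u₀ε u → G.IsSobolevModerate c T ρ u := by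
  refine ⟨?_, fun Vε u₀ε u h => h.isSobolevModerate hR hρ⟩
  obtain ⟨ψ, hψ⟩ := VeryWeakHeat.exists_test_integral_eq_one n
  obtain ⟨χ, hχ, hu⟩ := G.exists_data_mollifier c hu₀
  refine VeryWeakHeat.GradedLieGroup.exists_isVeryWeakSolution hR hρ hψ (fun δ _ => ?_)
    (G.tendsto_integral_mul_conv_rescale V hψ) hχ hu
  rcases hV with hV | hV
  · exact G.memLp_top_conv_of_isLpDistr hV _
  · exact G.memLp_conv_of_isCompactlySupported hV _ ∞
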